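/- Let $p$ be an odd prime, $k$ a field of characteristic $0$ containing the $p$-th roots of unity, $n\ge 2$, $a_1,\dots,a_n\in k^\times$, and $G=\mu_p^n$. Let $E=k(\epsilon)$ be a field extension of degree $p$ of $k$ with $\epsilon^p\in k$. **Conventions.** All line bundles are $G$-equivariant and carry $G$-invariant $p$-forms. For a line bundle $L$ with $p$-form $\varphi$ on a variety, the tautological line bundle $\mathbb L$ on $\mathbb P(\mathcal O\oplus L)$ carries the $p$-form induced by $(t,u)\mapsto t^p-\varphi(u)$. Tensor products and exterior products carry the product forms. *The variety $S$.* Let $H_i$ ($1\le i\le n$) be the trivial line bundle on $\operatorname{Spec} k$ with $p$-form $t\mapsto a_it^p$, on which $G$ acts through the $i$-th projection $G\to\mu_p\subset\mathbb G_m$; its pull-backs are denoted by $H_i$ too. Over a base $B$ with line bundles $M_1,\dots,M_r$ put $Q_0=B$, $K_0=\mathcal O$ (with the form $t\mapsto t^p$) and, for $1\le i\le r$, with all products over $B$, $$P_i=\prod_{1}^{p-1}\mathbb P(\mathcal O\oplus M_i\otimes K_{i-1})\ (\text{bundles over }Q_{i-1}),\qquad Q_i=Q_{i-1}\times_B P_i,\qquad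 K_i=K_{i-1}\boxtimes\mathbb L(1,\dots,1),$$ where $\mathbb L(1,\dots,1)=\mathbb L\boxtimes\cdots\boxtimes\mathbb L$ on $P_i$. Write $P_r(B;M_1,\dots,M_r)=P_r$. Put $S_n=\operatorname{Spec}k$. For $i=n-1,n-2,\dots,1$, let $Y_0=S_{i+1}$, let $(L_0,L_{-1})=(H_{n-1},H_n)$ if $i=n-1$ and $(L_0,L_{-1})=(J_{i+1},H_i)$ if $i<n-1$, and for $1\le r\le p$ let $Y_r=P_i(Y_{r-1};H_1,\dots,H_{i-1},L_{r-1})$ and $L_r=L_{r-2}\otimes\mathbb L(1,\dots,1)$; then $S_i=Y_p$ and $J_i=L_p$. Let $S=S_1$, $J=J_1$, and let $\gamma$ be the resulting $p$-form on $J$. (This is the variety of Rost's chain lemma for $\{a_1,\dots,a_n\}$.) *The varieties $\mathbb P(\mathcal A)$ and $\bar Y_w$.* Let $\mathcal A=\bigoplus_{i=0}^{p-1}J^{\otimes i}$ be the bundle of Kummer algebras over $S$, locally $\mathcal O[u]/(u^p-\gamma(u))$ for a generator $u$ of $J$, and let $\mathcal B=(\mathcal A\otimes 1)\oplus(\mathcal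 O_S\otimes\epsilon)\subset\mathcal A\otimes_kE$, with $G$ acting trivially on $E$. Let $U=\mathbb P(\mathcal A)\times\mathbb P(\mathcal B)^{p-1}$ over $S^p$ (products over $k$), let $L$ be the exterior product of the $p$ tautological line bundles on $U$, and let $N:L\to\mathcal O\otimes_kE$ be the product of the norms of $\mathcal A$ and of $\mathcal A\otimes_kE$ (on each of the $\mathcal B$-factors). Let $\mathbb A^E=\mathrm{Res}_{E/k}\mathbb A^1$ be the Weil restriction, so $\mathbb A^E(F)=F\otimes_kE$. For a field $F\supseteq k$ and $w\in\mathbb A^E(F)$, let $\bar Y_w\subset\mathbb P(L\oplus\mathcal O)_F$ be the $F$-scheme of all $[\alpha:t]$ with $N(\alpha)=t^pw$. *Fixed point equivalence.* Two $G$-schemes $X,Y$ of finite type over a field $F$ are $G$-fixed point equivalent if $\mathrm{Fix}_GX$ and $\mathrm{Fix}_GY$ are $0$-dimensional (i.e. have finitely many points over every extension field of $F$) and lie in the smooth loci of $X$ and $Y$, and there are a separable algebraic extension $K/F$ over which all fixed points of $X$ and $Y$ become rational and a bijection $\mathrm{Fix}_G(X)(K)\to\mathrm{Fix}_G(Y)(K)$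 such that the tangent spaces of $X_K$ and $Y_K$ at corresponding points are isomorphic representations of $G$ over $K$. **Theorem.** There is a nonempty Zariski open subset $V\subset\mathbb A^E$ such that for every field extension $F/k$ and every $w\in V(F)$ (in particular for every closed point $w$ of $V$, with $F=k(w)$), $\bar Y_w$ is $G$-fixed point equivalent over $F$ to the disjoint union of $(p-1)!$ copies of $(\mathbb P(\mathcal A)^p)_F$ (product over the base field). -/

import Mathlib

open scoped TensorProduct

universe u

namespace NormPrinciple

/-! ### Varieties with a group action, through their points in local algebras -/

/-- A `k`-scheme with an action of an abstract group `G`, described by its functor of points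
`R ↦ X(R)` on local `k`-algebras `R` (and all `k`-algebra homomorphisms between them).  Points with
values in fields, tangent vectors and infinitesimal liftings are all points with values in local
algebras. -/
structure GFunctor (k : Type u) [Field k] (G : Type u) [Group G] where
  pts : (R : Type u) → [CommRing R] → [IsLocalRing R] → [Algebra k R] → Type u
  map : {R R' : Type u} → [CommRing R] → [IsLocalRing R] → [Algebra k R] →
    [CommRing R'] → [IsLocalRing R'] → [Algebra k R'] → (R →ₐ[k] R') → pts R → pts R'
  act : {R : Type u} → [CommRing R] → [IsLocalRing R] → [Algebra k R] → G → pts R → pts R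
  map_id : ∀ {R : Type u} [CommRing R] [IsLocalRing R] [Algebra k R] (x : pts R),
    map (AlgHom.id k R) x = x
  map_comp : ∀ {R R' R'' : Type u} [CommRing R] [IsLocalRing R] [Algebra k R]
    [CommRing R'] [IsLocalRing R'] [Algebra k R'] [CommRing R''] [IsLocalRing R''] [Algebra k R'']
    (f : R →ₐ[k] R') (f' : R' →ₐ[k] R'') (x : pts R), map (f'.comp f) x = map f' (map f x)
  act_one : ∀ {R : Type u} [CommRing R] [IsLocalRing R] [Algebra k R] (x : pts R), act 1 x = x
  act_mul : ∀ {R : Type u} [CommRing R] [IsLocalRing R] [Algebra k R] (g h : G) (x : pts R),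
    act (g * h) x = act g (act h x)
  map_act : ∀ {R R' : Type u} [CommRing R] [IsLocalRing R] [Algebra k R]
    [CommRing R'] [IsLocalRing R'] [Algebra k R'] (f : R →ₐ[k] R') (g : G) (x : pts R),
    map f (act g x) = act g (map f x)

namespace GFunctor

variable {k : Type u} [Field k] {G : Type u} [Group G]

/-- The product of copies of `X` indexed by `I`, with the diagonal action. -/
def pow (X : GFunctor k G) (I : Type) : GFunctor k G where
  pts R := I → X.pts R
  map f x i := X.map f (x i)
  act g x i := X.act g (x i)
  map_id x := funext fun i => X.map_id (x i)
  map_comp f f' x := funext fun i => X.map_comp f f' (x i)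
  act_one x := funext fun i => X.act_one (x i)
  act_mul g h x := funext fun i => X.act_mul g h (x i)
  map_act f g x := funext fun i => X.map_act f g (x i)

/-- The disjoint union of copies of `X` indexed by `I`.  The spectrum of a local ring is connected,
so an `R`-point of the disjoint union is an `R`-point of exactly one of the copies. -/
def copies (X : GFunctor k G) (I : Type) : GFunctor k G where
  pts R := I × X.pts R
  map f x := (x.1, X.map f x.2)
  act g x := (x.1, X.act g x.2)
  map_id x := Prod.ext rfl (X.map_id x.2)
  map_comp f f' x := Prod.ext rfl (X.map_comp f f' x.2)
  act_one x := Prod.ext rfl (X.act_one x.2)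
  act_mul g h x := Prod.ext rfl (X.act_mul g h x.2)
  map_act f g x := Prod.ext rfl (X.map_act f g x.2)

/-- The set `Fix_G(X)(L)` of `G`-fixed points with values in a field `L`. -/
def Fix (X : GFunctor k G) (L : Type u) [Field L] [Algebra k L] : Set (X.pts L) :=
  {x | ∀ g : G, X.act g x = x}

/-- The point `x` with values in the field `L` lies in the smooth locus of `X`: the infinitesimal
lifting criterion, for surjections of local Artinian `k`-algebras with residue field `L`. -/
def SmoothAt (X : GFunctor k G) {L : Type u} [Field L] [Algebra k L] (x : X.pts L) : Prop :=
  ∀ (A A' : Type u) [CommRing A] [IsLocalRing A] [IsArtinianRing A] [Algebra k A]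
    [CommRing A'] [IsLocalRing A'] [IsArtinianRing A'] [Algebra k A']
    (q : A' →ₐ[k] A) (r : A →ₐ[k] L), Function.Surjective q → Function.Surjective r →
    ∀ a : X.pts A, X.map r a = x → ∃ a' : X.pts A', X.map q a' = a

end GFunctor

/-- `K[ε₁, ε₂]` with `ε₁² = ε₁ε₂ = ε₂² = 0`. -/
abbrev DualNumber₂ (K : Type u) [Field K] : Type u := TrivSqZeroExt K (K × K)

instance (K : Type u) [Field K] : IsLocalRing (DualNumber₂ K) :=
  IsLocalRing.of_isUnit_or_isUnit_one_sub_self fun a => by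
    rw [TrivSqZeroExt.isUnit_iff_isUnit_fst, TrivSqZeroExt.isUnit_iff_isUnit_fst,
      TrivSqZeroExt.fst_sub, TrivSqZeroExt.fst_one]
    exact IsLocalRing.isUnit_or_isUnit_one_sub_self _

section Tangent

variable (k : Type u) [Field k] (K : Type u) [Field K] [Algebra k K]

/-- `K[ε] → K`, `ε ↦ 0`. -/
def augmentation : DualNumber K →ₐ[k] K := TrivSqZeroExt.fstHom k K K

/-- `K[ε] → K[ε]`, `ε ↦ c ε`. -/
def dilation (c : K) : DualNumber K →ₐ[k] DualNumber K :=
  (TrivSqZeroExt.map (c • (LinearMap.id : K →ₗ[K] K))).restrictScalars k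

/-- `K[ε₁, ε₂] → K[ε]`, `ε₁ ↦ a ε`, `ε₂ ↦ b ε`. -/
def specialization (a b : K) : DualNumber₂ K →ₐ[k] DualNumber K :=
  (TrivSqZeroExt.map
    (a • LinearMap.fst K K K + b • LinearMap.snd K K K)).restrictScalars k

end Tangent

namespace GFunctor

variable {k : Type u} [Field k] {G : Type u} [Group G]

/-- The tangent space of `X_K` at `x ∈ X(K)`: the `K[ε]`-points over `x`.  Its vector space
structure is the usual one: `c • v` is the image of `v` under `ε ↦ c ε`, and `v₁ + v₂` is the image
under `ε₁, ε₂ ↦ ε` of the point over `K[ε₁, ε₂]` that restricts to `v₁` and `v₂`. -/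
def tangent (X : GFunctor k G) {K : Type u} [Field K] [Algebra k K] (x : X.pts K) :
    Set (X.pts (DualNumber K)) :=
  {v | X.map (augmentation k K) v = x}

/-- `v₁ + v₂ = v` in a tangent space of `X_K`. -/
def IsSum (X : GFunctor k G) {K : Type u} [Field K] [Algebra k K]
    (v₁ v₂ v : X.pts (DualNumber K)) : Prop :=
  ∃ z : X.pts (DualNumber₂ K), X.map (specialization k K 1 0) z = v₁ ∧
    X.map (specialization k K 0 1) z = v₂ ∧ X.map (specialization k K 1 1) z = v

/-- The tangent spaces of `X_K` at `x` and of `Y_K` at `y` (both fixed by `G`) are isomorphic as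
representations of `G` over `K`. -/
def TangentIso (X Y : GFunctor k G) {K : Type u} [Field K] [Algebra k K]
    (x : X.pts K) (y : Y.pts K) : Prop :=
  ∃ φ : X.pts (DualNumber K) → Y.pts (DualNumber K),
    Set.BijOn φ (X.tangent x) (Y.tangent y) ∧
    (∀ v ∈ X.tangent x, ∀ c : K, φ (X.map (dilation k K c) v) = Y.map (dilation k K c) (φ v)) ∧
    (∀ v₁ ∈ X.tangent x, ∀ v₂ ∈ X.tangent x, ∀ v ∈ X.tangent x,
      X.IsSum v₁ v₂ v → Y.IsSum (φ v₁) (φ v₂) (φ v)) ∧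
    ∀ v ∈ X.tangent x, ∀ g : G, φ (X.act g v) = Y.act g (φ v)

/-- `Fix_G(X)` is 0-dimensional (for a scheme of finite type: it has only finitely many points with
values in any field) and lies in the smooth locus of `X`. -/
def HasGoodFixedPoints (X : GFunctor k G) : Prop :=
  ∀ (L : Type u) [Field L] [Algebra k L], (X.Fix L).Finite ∧ ∀ x ∈ X.Fix L, X.SmoothAt x

/-- All points of `Fix_G(X_K)` are `K`-rational. -/
def FixRational (X : GFunctor k G) (K : Type u) [Field K] [Algebra k K] : Prop :=
  ∀ (L : Type u) [Field L] [Algebra k L] (f : K →ₐ[k] L), ∀ y ∈ X.Fix L,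
    ∃ x ∈ X.Fix K, X.map f x = y

/-- `G`-fixed point equivalence.  The separable extension `K` is one over which the fixed points
become rational, so that their tangent spaces are representations over `K`. -/
def FixedPointEquivalent (X Y : GFunctor k G) : Prop :=
  X.HasGoodFixedPoints ∧ Y.HasGoodFixedPoints ∧
  ∃ (K : Type u) (_ : Field K) (_ : Algebra k K), Algebra.IsSeparable k K ∧
    X.FixRational K ∧ Y.FixRational K ∧
    ∃ e : X.Fix K ≃ Y.Fix K, ∀ x : X.Fix K, TangentIso X Y (x : X.pts K) (e x : Y.pts K)

end GFunctor

/-! ### Iterated projective bundles in homogeneous coordinates -/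

/-- The shape of an iterated bundle of projective spaces (over `Spec k`) in homogeneous
coordinates: a point is given by a family of coordinates indexed by `ι`, grouped by `blk` into
blocks indexed by `β`.  Each block `b` is the system of homogeneous coordinates of one projective
bundle: the coordinates in it generate the unit ideal, and there is a scaling factor `λ b`, by
which the chosen generator of the tautological line bundle is multiplied.  Under the factors `λ`
the `i`-th coordinate is multiplied by `∏ b, λ b ^ wt i b`, and `g = (g₁, …, gₙ)` in `μ_pⁿ` acts on
it as `∏ j, g j ^ chr i j`. -/
structure Shape (n : ℕ) where
  ι : Type
  β : Type
  fintype : Fintype β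
  blk : ι → β
  wt : ι → β → ℤ
  chr : ι → Fin n → ℤ

attribute [instance] Shape.fintype

namespace Shape

variable {n : ℕ}

/-- The scaling factor of weight `wt`. -/
def scale {R : Type u} [CommRing R] {β : Type} [Fintype β] (lam : β → Rˣ) (wt : β → ℤ) : Rˣ :=
  ∏ b, lam b ^ wt b

/-- The effect of scaling factors `lam` and of the group element `g` on coordinates. -/
def act (X : Shape n) {R : Type u} [CommRing R] (lam : X.β → Rˣ) (g : Fin n → Rˣ)
    (x : X.ι → R) : X.ι → R :=
  fun i => ((scale lam (X.wt i) * scale g (X.chr i) : Rˣ) : R) * x i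

/-- The coordinates of each block generate the unit ideal of the local ring `R`. -/
def IsCoord (X : Shape n) {R : Type u} [CommRing R] (x : X.ι → R) : Prop :=
  ∀ b, ∃ i, X.blk i = b ∧ IsUnit (x i)

/-- The point `Spec k`. -/
abbrev pt : Shape n := ⟨Empty, Empty, inferInstance, nofun, nofun, nofun⟩

end Shape

/-- `μ_pⁿ`, as a constant group: it is used over fields that contain the `p`-th roots of unity. -/
abbrev MuPow (k : Type u) [Field k] (p n : ℕ) : Type u := Fin n → rootsOfUnity p k

/-- The image of `g ∈ μ_pⁿ(k)` in `μ_pⁿ(R)`. -/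
def muUnits {k : Type u} [Field k] {p n : ℕ} (R : Type u) [CommRing R] [Algebra k R]
    (g : MuPow k p n) : Fin n → Rˣ :=
  fun j => Units.map (algebraMap k R : k →* R) (g j : kˣ)

/-- A line bundle with `μ_pⁿ`-action on a variety of shape `X`, of the form "tensor product of
tautological bundles and characters": each system of homogeneous coordinates `x` determines a
generator `ℓ_x` of its fibre, and `ℓ_{λx} = (∏ b, λ b ^ wt b) ℓ_x`, and
`g ℓ_x = (∏ j, g j ^ chr j) ℓ_{gx}`. -/
structure Line {n : ℕ} (X : Shape n) where
  wt : X.β → ℤ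
  chr : Fin n → ℤ

namespace Line

variable {n : ℕ} {X : Shape n}

/-- The trivial line bundle `𝒪`. -/
abbrev one : Line X := ⟨0, 0⟩

/-- The tensor power `L^{⊗ i}`. -/
abbrev npow (L : Line X) (i : ℕ) : Line X := ⟨(i : ℤ) • L.wt, (i : ℤ) • L.chr⟩

end Line

/-- A shape relative to a base of shape `B` (a variety over that base). -/
structure RelShape {n : ℕ} (B : Shape n) where
  ι : Type
  β : Type
  fintype : Fintype β
  blk : ι → β
  wt : ι → B.β ⊕ β → ℤ
  chr : ι → Fin n → ℤ

attribute [instance] RelShape.fintype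

namespace RelShape

variable {n : ℕ} {B : Shape n}

/-- The total space of a relative variety. -/
abbrev total (F : RelShape B) : Shape n where
  ι := B.ι ⊕ F.ι
  β := B.β ⊕ F.β
  fintype := inferInstance
  blk := Sum.map B.blk F.blk
  wt := Sum.elim (fun i => Sum.elim (B.wt i) 0) F.wt
  chr := Sum.elim B.chr F.chr

/-- The base itself. -/
abbrev base (B : Shape n) : RelShape B := ⟨Empty, Empty, inferInstance, nofun, nofun, nofun⟩

/-- A variety as a variety over the point. -/
abbrev overPt (X : Shape n) : RelShape (Shape.pt (n := n)) where
  ι := X.ι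
  β := X.β
  fintype := inferInstance
  blk := X.blk
  wt i := Sum.elim 0 (X.wt i)
  chr := X.chr

/-- The projective bundle `ℙ(⨁ j, L j)` over (the total space of) `F`.  The generator of the
tautological bundle at the point with coordinates `(x, y)` is `∑ j, y j • ℓ_{j, x}`, where `ℓ_{j, x}`
generates the fibre of `L j`. -/
abbrev proj (F : RelShape B) {J : Type} (L : J → Line F.total) : RelShape B where
  ι := F.ι ⊕ J
  β := F.β ⊕ Unit
  fintype := inferInstance
  blk := Sum.map F.blk fun _ => ()
  wt := Sum.elim
    (fun i => Sum.elim (fun b => F.wt i (.inl b)) (Sum.elim (fun b => F.wt i (.inr b)) 0))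
    (fun j => Sum.elim (fun b => -(L j).wt (.inl b))
      (Sum.elim (fun b => -(L j).wt (.inr b)) 1))
  chr := Sum.elim F.chr fun j => (L j).chr

/-- The fibre product of two varieties over the base. -/
abbrev mul (F F' : RelShape B) : RelShape B where
  ι := F.ι ⊕ F'.ι
  β := F.β ⊕ F'.β
  fintype := inferInstance
  blk := Sum.map F.blk F'.blk
  wt := Sum.elim
    (fun i => Sum.elim (fun b => F.wt i (.inl b)) (Sum.elim (fun b => F.wt i (.inr b)) 0))
    (fun i => Sum.elim (fun b => F'.wt i (.inl b)) (Sum.elim 0 (fun b => F'.wt i (.inr b))))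
  chr := Sum.elim F.chr F'.chr

/-- The fibre product of `m` copies of a variety over the base. -/
abbrev pow (F : RelShape B) (m : ℕ) : RelShape B where
  ι := Fin m × F.ι
  β := Fin m × F.β
  fintype := inferInstance
  blk i := (i.1, F.blk i.2)
  wt i := Sum.elim (fun b => F.wt i.2 (.inl b))
    (fun b => if i.1 = b.1 then F.wt i.2 (.inr b.2) else 0)
  chr i := F.chr i.2

/-- The tautological line bundle on a projective bundle. -/
abbrev taut (F : RelShape B) {J : Type} (L : J → Line F.total) : Line (F.proj L).total :=
  ⟨Sum.elim 0 (Sum.elim 0 1), 0⟩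

/-- The exterior product of line bundles on the factors of `F ×_B F'`. -/
abbrev lineMul {F F' : RelShape B} (L : Line F.total) (L' : Line F'.total) :
    Line (F.mul F').total :=
  ⟨Sum.elim (fun b => L.wt (.inl b) + L'.wt (.inl b))
    (Sum.elim (fun b => L.wt (.inr b)) (fun b => L'.wt (.inr b))), L.chr + L'.chr⟩

/-- The exterior product of copies of a line bundle on the factors of `F ×_B ⋯ ×_B F`. -/
abbrev linePow {F : RelShape B} (L : Line F.total) (m : ℕ) : Line (F.pow m).total :=
  ⟨Sum.elim (fun b => m * L.wt (.inl b)) (fun b => L.wt (.inr b.2)), (m : ℤ) • L.chr⟩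

end RelShape

/-! ### Line bundles with `p`-forms -/

/-- A line bundle on a variety of shape `X` with a `μ_pⁿ`-invariant `p`-form, given by its value
`form` at the generator `ℓ_x` of the fibre. -/
structure FormLine (k : Type u) [Field k] (p : ℕ) {n : ℕ} (X : Shape n) extends Line X where
  form : MvPolynomial X.ι k
  form_act : ∀ (R : Type u) [CommRing R] [Algebra k R] (lam : X.β → Rˣ) (g : Fin n → Rˣ)
    (_ : ∀ j, g j ^ p = 1) (x : X.ι → R),
    MvPolynomial.aeval (X.act lam g x) form =
      ((Shape.scale lam wt : Rˣ) : R) ^ p * MvPolynomial.aeval x form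

theorem Shape.scale_zero {R : Type u} [CommRing R] {β : Type} [Fintype β] (lam : β → Rˣ) :
    Shape.scale lam (0 : β → ℤ) = 1 := by
  simp [Shape.scale]

theorem Shape.scale_add {R : Type u} [CommRing R] {β : Type} [Fintype β] (lam : β → Rˣ)
    (w w' : β → ℤ) : Shape.scale lam (w + w') = Shape.scale lam w * Shape.scale lam w' := by
  simp [Shape.scale, zpow_add, Finset.prod_mul_distrib]

theorem Shape.scale_smul {R : Type u} [CommRing R] {β : Type} [Fintype β] (lam : β → Rˣ)
    (m : ℤ) (w : β → ℤ) : Shape.scale lam (m • w) = (Shape.scale lam w) ^ m := by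
  simp [Shape.scale, mul_comm m, zpow_mul, Finset.prod_zpow]

theorem Shape.scale_pow_eq_one {R : Type u} [CommRing R] {β : Type} [Fintype β] {g : β → Rˣ}
    {p : ℕ} (hg : ∀ j, g j ^ p = 1) (w : β → ℤ) : Shape.scale g w ^ p = 1 := by
  rw [Shape.scale, ← Finset.prod_pow]
  refine Finset.prod_eq_one fun b _ => ?_
  rw [← zpow_natCast, ← zpow_mul, mul_comm, zpow_mul, zpow_natCast, hg, one_zpow]

theorem Shape.scale_sum {R : Type u} [CommRing R] {β β' : Type} [Fintype β] [Fintype β']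
    (lam : β ⊕ β' → Rˣ) (w : β ⊕ β' → ℤ) :
    Shape.scale lam w = Shape.scale (fun b => lam (.inl b)) (fun b => w (.inl b)) *
      Shape.scale (fun b => lam (.inr b)) (fun b => w (.inr b)) := by
  simp [Shape.scale]

theorem Shape.scale_prod_ite {R : Type u} [CommRing R] {m : ℕ} {β : Type} [Fintype β]
    (lam : Fin m × β → Rˣ) (i : Fin m) (w : β → ℤ) :
    Shape.scale lam (fun b => if i = b.1 then w b.2 else 0) =
      Shape.scale (fun b => lam (i, b)) w := by
  rw [Shape.scale, Fintype.prod_prod_type, Finset.prod_eq_single i]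
  · simp [Shape.scale]
  · intro j _ hj
    simp [hj.symm]
  · simp

namespace FormLine

variable {k : Type u} [Field k] {p n : ℕ} {X : Shape n}

/-- Pulling back a `p`-form along a projection that is given by forgetting coordinates. -/
theorem aeval_act_rename {Y : Shape n} (L : FormLine k p X) (f : X.ι → Y.ι)
    {R : Type u} [CommRing R] [Algebra k R] (lam : Y.β → Rˣ) (lam' : X.β → Rˣ)
    (g : Fin n → Rˣ) (hg : ∀ j, g j ^ p = 1) (x : Y.ι → R)
    (hw : ∀ i, Shape.scale lam (Y.wt (f i)) = Shape.scale lam' (X.wt i))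
    (hc : ∀ i, Y.chr (f i) = X.chr i) :
    MvPolynomial.aeval (Y.act lam g x) (MvPolynomial.rename f L.form) =
      ((Shape.scale lam' L.wt : Rˣ) : R) ^ p *
        MvPolynomial.aeval x (MvPolynomial.rename f L.form) := by
  have h : (Y.act lam g x) ∘ f = X.act lam' g (x ∘ f) := by
    funext i
    simp [Shape.act, hw, hc]
  rw [MvPolynomial.aeval_rename, MvPolynomial.aeval_rename, h, L.form_act R lam' g hg]

/-- The line bundle on which `μ_pⁿ` acts through the character `c`, with the `p`-form
`t ↦ a t^p`. -/
noncomputable def const (c : Fin n → ℤ) (a : k) : FormLine k p X where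
  wt := 0
  chr := c
  form := MvPolynomial.C a
  form_act R _ _ lam g _ x := by simp [Shape.scale_zero]

/-- The trivial line bundle with the `p`-form `t ↦ t^p`. -/
noncomputable def one : FormLine k p X := const 0 1

/-- The tensor product of line bundles with `p`-forms. -/
noncomputable def tensor (L L' : FormLine k p X) : FormLine k p X where
  wt := L.wt + L'.wt
  chr := L.chr + L'.chr
  form := L.form * L'.form
  form_act R _ _ lam g hg x := by
    rw [map_mul, map_mul, L.form_act R lam g hg, L'.form_act R lam g hg, Shape.scale_add]
    push_cast
    ring

/-- The pull-back of a line bundle with `p`-form from the base. -/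
noncomputable def pull {B : Shape n} (L : FormLine k p B) (F : RelShape B) : FormLine k p F.total where
  wt := Sum.elim L.wt 0
  chr := L.chr
  form := MvPolynomial.rename Sum.inl L.form
  form_act R _ _ lam g hg x := by
    rw [L.aeval_act_rename (Y := F.total) Sum.inl lam (fun b => lam (.inl b)) g hg x]
    · congr 3
      simp [Shape.scale]
    · intro i
      simp [Shape.scale]
    · intro i; rfl

/-- A line bundle with `p`-form on a variety, considered over the point. -/
noncomputable def overPt (L : FormLine k p X) : FormLine k p (RelShape.overPt X).total where
  wt := Sum.elim 0 L.wt
  chr := L.chr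
  form := MvPolynomial.rename Sum.inr L.form
  form_act R _ _ lam g hg x := by
    rw [L.aeval_act_rename (Y := (RelShape.overPt X).total) Sum.inr lam (fun b => lam (.inr b))
      g hg x]
    · congr 3
      simp [Shape.scale]
    · intro i
      simp [Shape.scale]
    · intro i; rfl

variable {B : Shape n}

/-- The two summands of `𝒪 ⊕ L`. -/
abbrev oPlus {F : RelShape B} (L : FormLine k p F.total) : Bool → Line F.total :=
  fun b => bif b then L.toLine else Line.one

/-- The tautological line bundle on `ℙ(𝒪 ⊕ L)`, with the `p`-form induced by the `p`-form
`(t, u) ↦ t^p - φ(u)` on `𝒪 ⊕ L`. -/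
noncomputable def taut {F : RelShape B} (L : FormLine k p F.total) : FormLine k p (F.proj L.oPlus).total where
  toLine := F.taut L.oPlus
  form := MvPolynomial.X (.inr (.inr false)) ^ p -
    MvPolynomial.rename (Sum.map id Sum.inl) L.form * MvPolynomial.X (.inr (.inr true)) ^ p
  form_act R _ _ lam g hg x := by
    have h := L.aeval_act_rename (Y := (F.proj L.oPlus).total) (Sum.map id Sum.inl) lam
      (Sum.elim (fun b => lam (.inl b)) fun b => lam (.inr (.inl b))) g hg x
      (by
        rintro (i | i) <;>
        simp [Shape.scale])
      (by rintro (i | i) <;> rfl)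
    have h0 : ((F.proj L.oPlus).total.act lam g x) (.inr (.inr false)) =
        ((lam (.inr (.inr ())) : Rˣ) : R) * x (.inr (.inr false)) := by
      simp [Shape.act, Shape.scale, RelShape.total, RelShape.proj, oPlus, Line.one]
    have h1 : ((F.proj L.oPlus).total.act lam g x) (.inr (.inr true)) =
        (((Shape.scale (Sum.elim (fun b => lam (.inl b)) fun b => lam (.inr (.inl b))) L.wt)⁻¹ *
          lam (.inr (.inr ())) * Shape.scale g L.chr : Rˣ) : R) * x (.inr (.inr true)) := by
      have h2 : Shape.scale lam ((F.proj L.oPlus).total.wt (.inr (.inr true))) =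
          (Shape.scale (Sum.elim (fun b => lam (.inl b)) fun b => lam (.inr (.inl b))) L.wt)⁻¹ *
          lam (.inr (.inr ())) := by
        simp only [Shape.scale, oPlus, cond_true, Fintype.prod_sum_type, Sum.elim_inl,
          Sum.elim_inr, zpow_neg, Finset.prod_inv_distrib, mul_inv, Pi.one_apply, zpow_one,
          Finset.univ_unique, Finset.prod_singleton, mul_assoc]
      rw [← h2]
      rfl
    have h2 : Shape.scale lam (F.taut L.oPlus).wt = lam (.inr (.inr ())) := by
      simp [Shape.scale]
    have h3 : ((Shape.scale g L.chr : Rˣ) : R) ^ p = 1 := by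
      rw [← Units.val_pow_eq_pow_val, Shape.scale_pow_eq_one hg, Units.val_one]
    have h4 : ∀ c : Rˣ, (c : R) ^ p * ((c⁻¹ : Rˣ) : R) ^ p = 1 := fun c => by
      rw [← mul_pow, Units.mul_inv, one_pow]
    simp only [map_sub, map_mul, map_pow, MvPolynomial.aeval_X]
    rw [h, h0, h1, h2]
    push_cast
    simp only [mul_pow, h3]
    linear_combination (-((lam (.inr (.inr ())) : Rˣ) : R) ^ p *
      x (.inr (.inr true)) ^ p *
      MvPolynomial.aeval x (MvPolynomial.rename (Sum.map id Sum.inl) L.form)) *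
      h4 (Shape.scale (Sum.elim (fun b => lam (.inl b)) fun b => lam (.inr (.inl b))) L.wt)

/-- The exterior product of line bundles with `p`-forms on `F ×_B F'`. -/
noncomputable def mul {F F' : RelShape B} (L : FormLine k p F.total) (L' : FormLine k p F'.total) :
    FormLine k p (F.mul F').total where
  toLine := RelShape.lineMul L.toLine L'.toLine
  form := MvPolynomial.rename (Sum.map id Sum.inl) L.form *
    MvPolynomial.rename (Sum.map id Sum.inr) L'.form
  form_act R _ _ lam g hg x := by
    rw [map_mul, map_mul,
      L.aeval_act_rename (Y := (F.mul F').total) (Sum.map id Sum.inl) lam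
        (Sum.elim (fun b => lam (.inl b)) fun b => lam (.inr (.inl b))) g hg x
        (by
          rintro (i | i) <;>
          simp [Shape.scale])
        (by rintro (i | i) <;> rfl),
      L'.aeval_act_rename (Y := (F.mul F').total) (Sum.map id Sum.inr) lam
        (Sum.elim (fun b => lam (.inl b)) fun b => lam (.inr (.inr b))) g hg x
        (by
          rintro (i | i) <;>
          simp [Shape.scale])
        (by rintro (i | i) <;> rfl)]
    have h : Shape.scale lam (RelShape.lineMul L.toLine L'.toLine).wt =
        Shape.scale (Sum.elim (fun b => lam (.inl b)) fun b => lam (.inr (.inl b))) L.wt *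
        Shape.scale (Sum.elim (fun b => lam (.inl b)) fun b => lam (.inr (.inr b))) L'.wt := by
      simp only [Shape.scale, Fintype.prod_sum_type, Sum.elim_inl, Sum.elim_inr,
        zpow_add, Finset.prod_mul_distrib]
      exact mul_mul_mul_comm _ _ _ _
    rw [h]
    push_cast
    ring

/-- The exterior product of copies of a line bundle with `p`-form on `F ×_B ⋯ ×_B F`. -/
noncomputable def pow {F : RelShape B} (L : FormLine k p F.total) (m : ℕ) :
    FormLine k p (F.pow m).total where
  toLine := RelShape.linePow L.toLine m
  form := ∏ i : Fin m, MvPolynomial.rename (Sum.map id (Prod.mk i)) L.form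
  form_act R _ _ lam g hg x := by
    have h := fun i : Fin m => L.aeval_act_rename (Y := (F.pow m).total)
      (Sum.map id (Prod.mk i)) lam
      (Sum.elim (fun b => lam (.inl b)) fun b => lam (.inr (i, b))) g hg x
      (by
        rintro (j | j)
        · simp [Shape.scale]
        · rw [Shape.scale_sum, Shape.scale_sum]
          exact congrArg _ (Shape.scale_prod_ite (fun b => lam (.inr b)) i
            (fun b => F.wt j (.inr b))))
      (by rintro (j | j) <;> rfl)
    have h' : Shape.scale lam (RelShape.linePow L.toLine m).wt =
        ∏ i : Fin m, Shape.scale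
          (Sum.elim (fun b => lam (.inl b)) fun b => lam (.inr (i, b))) L.wt := by
      simp only [Shape.scale, Fintype.prod_sum_type, Sum.elim_inl, Sum.elim_inr,
        Finset.prod_mul_distrib, Fintype.prod_prod_type, Finset.prod_const, Finset.card_univ,
        Fintype.card_fin]
      congr 1
      rw [← Finset.prod_pow]
      refine Finset.prod_congr rfl fun b _ => ?_
      rw [mul_comm, zpow_mul, zpow_natCast]
    rw [map_prod, map_prod, h', Units.coe_prod, ← Finset.prod_pow, ← Finset.prod_mul_distrib]
    exact Finset.prod_congr rfl fun i _ => h i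

end FormLine

/-! ### The variety of the chain lemma -/

section Tower

variable {k : Type u} [Field k] {p n : ℕ} {B : Shape n}

/-- Given `F` with a line bundle `L` over the base `B`, the product over `B` of `p - 1` copies of
`ℙ(𝒪 ⊕ L)`, with the exterior product of the tautological bundles. -/
noncomputable def tautPower (F : RelShape B) (L : FormLine k p F.total) :
    Σ P : RelShape B, FormLine k p P.total :=
  ⟨(F.proj L.oPlus).pow (p - 1), L.taut.pow (p - 1)⟩

/-- `(Q_r, K_r)`, for a sequence `H` of line bundles with `p`-forms on the base
(`H_1, H_2, …` are `H 0, H 1, …`):  `Q_0` is the base, `K_0 = 𝒪`, and `Q_{r+1} = Q_r × P_{r+1}`,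
`K_{r+1} = K_r ⊠ 𝕃(1, …, 1)`, where `P_{r+1}` is the product of `p - 1` copies of
`ℙ(𝒪 ⊕ H_{r+1} ⊗ K_r)`, all products being over the base. -/
noncomputable def towerQ (H : ℕ → FormLine k p B) : ℕ → Σ Q : RelShape B, FormLine k p Q.total
  | 0 => ⟨RelShape.base B, FormLine.one⟩
  | r + 1 =>
    let Q := towerQ H r
    let P := tautPower Q.1 (((H r).pull Q.1).tensor Q.2)
    ⟨Q.1.mul P.1, Q.2.mul P.2⟩

/-- `P_{r+1}(B; H_1, …, H_{r+1})` with its line bundle `𝕃(1, …, 1)`. -/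
noncomputable def towerP (H : ℕ → FormLine k p B) (r : ℕ) :
    Σ P : RelShape B, FormLine k p P.total :=
  tautPower (towerQ H r).1 (((H r).pull (towerQ H r).1).tensor (towerQ H r).2)

/-- A stage of the construction: a variety with line bundles `H_1, H_2, …` (`H 0, H 1, …`) and two
further line bundles `J = L_r`, `J' = L_{r-1}`, all with `p`-forms. -/
structure Stage (k : Type u) [Field k] (p n : ℕ) where
  X : Shape n
  H : ℕ → FormLine k p X
  J : FormLine k p X
  J' : FormLine k p X

/-- `Y_{r+1} = P_{m+1}(Y_r; H_1, …, H_m, L_r)` with `L_{r+1} = L_{r-1} ⊗ 𝕃(1, …, 1)`. -/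
noncomputable def Stage.move (m : ℕ) (s : Stage k p n) : Stage k p n :=
  let P := towerP (fun i => if i < m then s.H i else s.J) m
  { X := P.1.total
    H := fun i => (s.H i).pull P.1
    J := (s.J'.pull P.1).tensor P.2
    J' := s.J.pull P.1 }

/-- Starting with `S_{m+2}`, apply `p` moves with `H_1, …, H_m`, which gives `S_{m+1}`; then put
`L_{-1} = H_m` and apply `p` moves with `H_1, …, H_{m-1}`; and so on, until `S_1` is reached. -/
noncomputable def Stage.chain : ℕ → Stage k p n → Stage k p n
  | 0, s => (Stage.move 0)^[p] s
  | m + 1, s =>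
    let s' := (Stage.move (m + 1))^[p] s
    Stage.chain m { s' with J' := s'.H m }

/-- The line bundle `H_{i+1}` on the point: the trivial line bundle with the `p`-form
`t ↦ a_{i+1} t^p`, on which the `i+1`-st factor of `μ_pⁿ` acts by multiplication. -/
noncomputable def baseLine (p : ℕ) (a : Fin n → k) (i : ℕ) :
    FormLine k p (Shape.pt (n := n)) :=
  if h : i < n then FormLine.const (Pi.single ⟨i, h⟩ 1) (a ⟨i, h⟩) else FormLine.one

/-- The variety `S` of the chain lemma for `a_1, …, a_n` (`n ≥ 2`), with its line bundle `J` and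
`p`-form `γ`: the chain starts with `S_n = Spec k`, `L_0 = H_{n-1}` and `L_{-1} = H_n`. -/
noncomputable def chainVariety (p : ℕ) (a : Fin n → k) : Stage k p n :=
  Stage.chain (n - 2)
    { X := Shape.pt
      H := baseLine p a
      J := baseLine p a (n - 2)
      J' := baseLine p a (n - 1) }

end Tower

/-! ### Points -/

namespace Shape

variable {n : ℕ} (X : Shape n)

theorem act_one {R : Type u} [CommRing R] (x : X.ι → R) : X.act 1 1 x = x := by
  funext i
  simp [act, scale]

theorem act_act {R : Type u} [CommRing R] (lam lam' : X.β → Rˣ) (g g' : Fin n → Rˣ)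
    (x : X.ι → R) : X.act lam g (X.act lam' g' x) = X.act (lam * lam') (g * g') x := by
  funext i
  simp only [act, scale, Pi.mul_apply, mul_zpow, Finset.prod_mul_distrib]
  push_cast
  ring

theorem map_scale {R R' : Type u} [CommRing R] [CommRing R'] (f : R →* R') {β : Type} [Fintype β]
    (lam : β → Rˣ) (w : β → ℤ) :
    Units.map f (scale lam w) = scale (fun b => Units.map f (lam b)) w := by
  simp [scale, map_prod, map_zpow]

theorem map_act {R R' : Type u} [CommRing R] [CommRing R'] (f : R →+* R') (lam : X.β → Rˣ)
    (g : Fin n → Rˣ) (x : X.ι → R) :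
    (fun i => f (X.act lam g x i)) =
      X.act (fun b => Units.map (f : R →* R') (lam b)) (fun j => Units.map (f : R →* R') (g j))
        (fun i => f (x i)) := by
  funext i
  simp only [act, ← map_scale]
  rw [← map_mul (Units.map (f : R →* R')), map_mul f]
  rfl

theorem isCoord_act {R : Type u} [CommRing R] (lam : X.β → Rˣ) (g : Fin n → Rˣ) {x : X.ι → R}
    (hx : X.IsCoord x) : X.IsCoord (X.act lam g x) := fun b => by
  obtain ⟨i, hi, hu⟩ := hx b
  exact ⟨i, hi, (Units.isUnit _).mul hu⟩

theorem isCoord_map {R R' : Type u} [CommRing R] [CommRing R'] (f : R →+* R') {x : X.ι → R}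
    (hx : X.IsCoord x) : X.IsCoord fun i => f (x i) := fun b => by
  obtain ⟨i, hi, hu⟩ := hx b
  exact ⟨i, hi, hu.map f⟩

end Shape

theorem muUnits_pow {k : Type u} [Field k] {p n : ℕ} (R : Type u) [CommRing R] [Algebra k R]
    (g : MuPow k p n) (j : Fin n) : muUnits R g j ^ p = 1 := by
  rw [muUnits, ← map_pow, (mem_rootsOfUnity p _).1 (g j).2, map_one]

theorem muUnits_one {k : Type u} [Field k] {p n : ℕ} (R : Type u) [CommRing R] [Algebra k R] :
    muUnits R (1 : MuPow k p n) = 1 := by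
  funext j
  simp [muUnits]

theorem muUnits_mul {k : Type u} [Field k] {p n : ℕ} (R : Type u) [CommRing R] [Algebra k R]
    (g h : MuPow k p n) : muUnits R (g * h) = muUnits R g * muUnits R h := by
  funext j
  simp [muUnits]

theorem map_muUnits {k : Type u} [Field k] {p n : ℕ} {R R' : Type u} [CommRing R] [Algebra k R]
    [CommRing R'] [Algebra k R'] (f : R →ₐ[k] R') (g : MuPow k p n) :
    (fun j => Units.map ((f : R →+* R') : R →* R') (muUnits R g j)) = muUnits R' g := by
  funext j
  ext
  simp [muUnits]

/-- A locus in a variety of shape `X` that is given by equations between homogeneous coordinates,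
compatible with change of rings, invariant under scaling and under `μ_pⁿ`. -/
structure Locus (k : Type u) [Field k] (p : ℕ) {n : ℕ} (X : Shape n) where
  eqn : ∀ (R : Type u) [CommRing R] [Algebra k R], (X.ι → R) → Prop
  eqn_map : ∀ {R R' : Type u} [CommRing R] [Algebra k R] [CommRing R'] [Algebra k R']
    (f : R →ₐ[k] R') (x : X.ι → R), eqn R x → eqn R' fun i => f (x i)
  eqn_act : ∀ {R : Type u} [CommRing R] [Algebra k R] (lam : X.β → Rˣ) (g : Fin n → Rˣ)
    (_ : ∀ j, g j ^ p = 1) (x : X.ι → R), eqn R x → eqn R (X.act lam g x)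

namespace Locus

variable {k : Type u} [Field k] {p n : ℕ} {X : Shape n}

/-- The whole variety. -/
def univ (k : Type u) [Field k] (p : ℕ) {n : ℕ} (X : Shape n) : Locus k p X where
  eqn _ _ _ _ := True
  eqn_map _ _ _ := trivial
  eqn_act _ _ _ _ _ := trivial

/-- The systems of homogeneous coordinates of the points of `Z` with values in `R`. -/
abbrev Coord (Z : Locus k p X) (R : Type u) [CommRing R] [Algebra k R] : Type u :=
  {x : X.ι → R // X.IsCoord x ∧ Z.eqn R x}

/-- Two systems of homogeneous coordinates describe the same point if they differ by scaling. -/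
def setoid (Z : Locus k p X) (R : Type u) [CommRing R] [Algebra k R] : Setoid (Z.Coord R) where
  r x y := ∃ lam : X.β → Rˣ, y.1 = X.act lam 1 x.1
  iseqv :=
    { refl := fun x => ⟨1, (X.act_one x.1).symm⟩
      symm := by
        rintro x y ⟨lam, h⟩
        exact ⟨lam⁻¹, by rw [h, X.act_act, inv_mul_cancel, one_mul, X.act_one]⟩
      trans := by
        rintro x y z ⟨lam, h⟩ ⟨lam', h'⟩
        exact ⟨lam' * lam, by rw [h', h, X.act_act, one_mul]⟩ }

/-- The variety with `μ_pⁿ`-action defined by `Z`.  (Line bundles on the spectrum of a local ring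
are trivial, so every point with values in a local ring has homogeneous coordinates.) -/
def toGFunctor (Z : Locus k p X) : GFunctor k (MuPow k p n) where
  pts R := Quotient (Z.setoid R)
  map {R R'} _ _ _ _ _ _ f := Quotient.map'
    (s₁ := Z.setoid R) (s₂ := Z.setoid R')
    (fun x => ⟨fun i => f (x.1 i), X.isCoord_map (f : R →+* R') x.2.1, Z.eqn_map f x.1 x.2.2⟩)
    (by
      rintro x y ⟨lam, h⟩
      refine ⟨fun b => Units.map ((f : R →+* R') : R →* R') (lam b), ?_⟩
      have := X.map_act (f : R →+* R') lam 1 x.1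
      simp only [Pi.one_apply, map_one] at this
      rw [← h] at this
      exact this)
  act {R} _ _ _ g := Quotient.map' (s₁ := Z.setoid R) (s₂ := Z.setoid R)
    (fun x => ⟨X.act 1 (muUnits R g) x.1, X.isCoord_act _ _ x.2.1,
      Z.eqn_act _ _ (muUnits_pow R g) x.1 x.2.2⟩)
    (by
      rintro x y ⟨lam, h⟩
      refine ⟨lam, ?_⟩
      simp only [h, X.act_act, one_mul, mul_one])
  map_id x := by
    induction x using Quotient.inductionOn
    rfl
  map_comp f f' x := by
    induction x using Quotient.inductionOn
    rfl
  act_one {R} _ _ _ x := by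
    induction x using Quotient.inductionOn with
    | _ x => exact congrArg _ (Subtype.ext (by simp only [muUnits_one, X.act_one]))
  act_mul {R} _ _ _ g h x := by
    induction x using Quotient.inductionOn with
    | _ x => exact congrArg _ (Subtype.ext (by simp only [muUnits_mul, X.act_act, mul_one]))
  map_act {R R'} _ _ _ _ _ _ f g x := by
    induction x using Quotient.inductionOn with
    | _ x =>
      refine congrArg _ (Subtype.ext ?_)
      have := X.map_act (f : R →+* R') 1 (muUnits R g) x.1
      rw [map_muUnits] at this
      simp only [Pi.one_apply, map_one] at this
      exact this

end Locus

/-! ### Kummer algebras, `ℙ(𝒜)` and `Ȳ_w` -/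

/-- The norm of `∑ j, b j • u ^ j` in the Kummer algebra `R[u]/(u ^ p - c)`: the determinant of the
multiplication by this element, in the basis `1, u, …, u ^ (p - 1)`. -/
def kummerNorm {R : Type u} [CommRing R] {p : ℕ} (c : R) (b : Fin p → R) : R :=
  (Matrix.of fun l j : Fin p => if j ≤ l then b (l - j) else c * b (l - j)).det

theorem map_kummerNorm {R R' : Type u} [CommRing R] [CommRing R'] (f : R →+* R') {p : ℕ} (c : R)
    (b : Fin p → R) : f (kummerNorm c b) = kummerNorm (f c) fun j => f (b j) := by
  rw [kummerNorm, kummerNorm, RingHom.map_det]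
  congr 1
  ext l j
  by_cases h : j ≤ l <;> simp [h]

theorem kummerNorm_scale {R : Type u} [CommRing R] {p : ℕ} (c c' : R) (b b' : Fin p → R)
    (μ : R) (ν : Rˣ) (hc : c' * (ν : R) ^ p = c)
    (hb : ∀ j : Fin p, b' j = μ * (ν : R) ^ (j : ℕ) * b j) :
    kummerNorm c' b' = μ ^ p * kummerNorm c b := by
  have h1 : ∀ m : ℕ, (ν : R) ^ m * ((ν⁻¹ : Rˣ) : R) ^ m = 1 := fun m => by
    rw [← mul_pow, Units.mul_inv, one_pow]
  have h : (Matrix.of fun l j : Fin p => if j ≤ l then b' (l - j) else c' * b' (l - j)) =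
      μ • (Matrix.of fun l j : Fin p => (ν : R) ^ (l : ℕ) *
        (Matrix.of fun l j : Fin p => ((ν⁻¹ : Rˣ) : R) ^ (j : ℕ) *
          (Matrix.of fun l j : Fin p => if j ≤ l then b (l - j) else c * b (l - j)) l j) l j) := by
    ext l j
    simp only [Matrix.of_apply, Matrix.smul_apply, smul_eq_mul, hb]
    by_cases hjl : j ≤ l
    · have h2 : (l : ℕ) = ((l - j : Fin p) : ℕ) + j := by
        rw [Fin.sub_val_of_le hjl]; have : (j : ℕ) ≤ l := hjl; omega
      simp only [hjl, if_true]
      rw [h2, pow_add]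
      linear_combination (-μ * (ν : R) ^ ((l - j : Fin p) : ℕ) * b (l - j)) * h1 j
    · have h2 : ((l - j : Fin p) : ℕ) + j = l + p := by
        have : (l : ℕ) < j := not_le.1 hjl
        rw [Fin.coe_sub_iff_lt.2 (not_le.1 hjl)]; omega
      have h3 : (ν : R) ^ ((l - j : Fin p) : ℕ) * (ν : R) ^ (j : ℕ) =
          (ν : R) ^ (l : ℕ) * (ν : R) ^ p := by rw [← pow_add, h2, pow_add]
      simp only [hjl, if_false]
      rw [← hc]
      linear_combination (μ * c' * b (l - j) * ((ν⁻¹ : Rˣ) : R) ^ (j : ℕ)) * h3 -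
        (μ * c' * (ν : R) ^ ((l - j : Fin p) : ℕ) * b (l - j)) * h1 j
  rw [kummerNorm, h, Matrix.det_smul, Matrix.det_mul_column, Matrix.det_mul_row, kummerNorm,
    Fintype.card_fin]
  have h4 : (∏ i : Fin p, (ν : R) ^ (i : ℕ)) * ∏ i : Fin p, ((ν⁻¹ : Rˣ) : R) ^ (i : ℕ) = 1 := by
    rw [← Finset.prod_mul_distrib]
    exact Finset.prod_eq_one fun i _ => h1 i
  linear_combination (μ ^ p * (Matrix.of fun l j : Fin p =>
    if j ≤ l then b (l - j) else c * b (l - j)).det) * h4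

section Kummer

variable {k : Type u} [Field k] {p n : ℕ} {S : Shape n} (J : FormLine k p S)

/-- The summands `J^{⊗ i}`, `0 ≤ i < p`, of the Kummer algebra `𝒜 = 𝒜(J)`. -/
noncomputable abbrev lineA : Fin p → Line (RelShape.overPt S).total := fun i => J.overPt.toLine.npow i

/-- The summands `J^{⊗ i}` (`some i`) and `𝒪 ⊗ ε` (`none`) of `ℬ = (𝒜 ⊗ 1) ⊕ (𝒪 ⊗ ε)`. -/
noncomputable abbrev lineB : Option (Fin p) → Line (RelShape.overPt S).total
  | none => Line.one
  | some i => lineA J i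

/-- `ℙ(𝒜)`. -/
noncomputable abbrev shapePA : RelShape (Shape.pt (n := n)) := (RelShape.overPt S).proj (lineA J)

/-- `ℙ(ℬ)`. -/
noncomputable abbrev shapePB : RelShape (Shape.pt (n := n)) := (RelShape.overPt S).proj (lineB J)

/-- `U = ℙ(𝒜) × ℙ(ℬ)^{p - 1}`. -/
noncomputable abbrev shapeU : RelShape (Shape.pt (n := n)) := (shapePA J).mul ((shapePB J).pow (p - 1))

/-- The exterior product `L` of the tautological line bundles on `U`. -/
noncomputable abbrev lineL : Line (shapeU J).total :=
  RelShape.lineMul ((RelShape.overPt S).taut (lineA J))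
    (RelShape.linePow ((RelShape.overPt S).taut (lineB J)) (p - 1))

/-- `ℙ(L ⊕ 𝒪)` over `U`. -/
noncomputable abbrev shapePL : RelShape (Shape.pt (n := n)) :=
  (shapeU J).proj fun b : Bool => bif b then lineL J else Line.one

/-- `ℙ(𝒜)` as a variety with `μ_pⁿ`-action. -/
noncomputable def varPA : GFunctor k (MuPow k p n) := (Locus.univ k p (shapePA J).total).toGFunctor

namespace PL

variable {J} {R : Type u} (x : (shapePL J).total.ι → R)

/-- The coordinates of the point `s₀` of `S`. -/
def s₀ (i : S.ι) : R := x (.inr (.inl (.inl (.inl i))))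

/-- The components of the element `b₀` of the Kummer algebra at `s₀`. -/
def b₀ (j : Fin p) : R := x (.inr (.inl (.inl (.inr j))))

/-- The coordinates of the points `s₁, …, s_{p-1}` of `S`. -/
def s (i : Fin (p - 1)) (j : S.ι) : R := x (.inr (.inl (.inr (i, .inl j))))

/-- The components of the elements `b₁, …, b_{p-1}` of the Kummer algebras at the `s_i`. -/
def b (i : Fin (p - 1)) (j : Fin p) : R := x (.inr (.inl (.inr (i, .inr (some j)))))

/-- The components `t₁, …, t_{p-1}` of `𝒪 ⊗ ε`. -/
def t (i : Fin (p - 1)) : R := x (.inr (.inl (.inr (i, .inr none))))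

/-- The point of `ℙ(L ⊕ 𝒪)` is `[α : t]` with `α = y • (b₀ ⊗ (b₁ + t₁ ε) ⊗ ⋯)`; this is `y`. -/
def y : R := x (.inr (.inr true))

/-- The coordinate `t` in `[α : t]`. -/
def tt : R := x (.inr (.inr false))

variable [CommRing R] [Algebra k R] (E : Type u) [CommRing E] [Algebra k E] (ε : E)

/-- `N(b₀)`, in the Kummer algebra `R[u]/(u ^ p - γ(s₀))`. -/
noncomputable def norm₀ : R := kummerNorm (MvPolynomial.aeval (s₀ x) J.form) (b₀ x)

/-- `N(b_i + t_i ε)`, in the Kummer algebra over `R ⊗ E`. -/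
noncomputable def norm (i : Fin (p - 1)) : R ⊗[k] E :=
  kummerNorm (algebraMap R (R ⊗[k] E) (MvPolynomial.aeval (s x i) J.form)) fun j =>
    algebraMap R (R ⊗[k] E) (b x i j) +
      if (j : ℕ) = 0 then algebraMap R (R ⊗[k] E) (t x i) * ((1 : R) ⊗ₜ[k] ε) else 0

/-- `N(α) = N(b₀) ∏ N(b_i + t_i ε)`, extended from `b₀ ⊗ (b₁ + t₁ ε) ⊗ ⋯` to its multiples. -/
noncomputable def normα : R ⊗[k] E :=
  algebraMap R (R ⊗[k] E) (y x ^ p * norm₀ x) * ∏ i, norm x E ε i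

end PL

namespace PL

variable {J} (E : Type u) [CommRing E] [Algebra k E] (ε : E)

theorem normα_map {R R' : Type u} [CommRing R] [Algebra k R] [CommRing R'] [Algebra k R']
    (f : R →ₐ[k] R') (x : (shapePL J).total.ι → R) :
    Algebra.TensorProduct.map f (AlgHom.id k E) (normα x E ε) = normα (fun i => f (x i)) E ε := by
  have hF : ∀ r : R, Algebra.TensorProduct.map f (AlgHom.id k E) (algebraMap R (R ⊗[k] E) r) =
      algebraMap R' (R' ⊗[k] E) (f r) := fun r => by simp
  have ha : ∀ (z : S.ι → R), f (MvPolynomial.aeval z J.form) =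
      MvPolynomial.aeval (fun i => f (z i)) J.form := fun z => by
    rw [MvPolynomial.comp_aeval_apply]
  have h₀ : f (norm₀ x) = norm₀ fun i => f (x i) :=
    (map_kummerNorm (f : R →+* R') _ _).trans (congrArg₂ kummerNorm (ha _) rfl)
  have hi : ∀ i, Algebra.TensorProduct.map f (AlgHom.id k E) (norm x E ε i) =
      norm (fun i => f (x i)) E ε i := fun i => by
    refine (map_kummerNorm ((Algebra.TensorProduct.map f (AlgHom.id k E) :
      R ⊗[k] E →ₐ[k] R' ⊗[k] E) : R ⊗[k] E →+* R' ⊗[k] E) _ _).trans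
      (congrArg₂ kummerNorm ((hF _).trans (congrArg _ (ha _))) (funext fun j => ?_))
    refine (map_add _ _ _).trans (congrArg₂ (· + ·) (hF _) ?_)
    split_ifs
    · refine (map_mul _ _ _).trans (congrArg₂ (· * ·) (hF _) ?_)
      simp
    · exact map_zero _
  rw [normα, normα, map_mul, hF, map_mul f, map_pow f, h₀, map_prod]
  simp only [hi]
  rfl

theorem kummerNorm_act {R R' : Type u} [CommRing R] [Algebra k R] [CommRing R']
    (f : R →+* R') (lam : S.β → Rˣ) (g : Fin n → Rˣ) (hg : ∀ j, g j ^ p = 1) (z : S.ι → R)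
    (μ : R') (b b' : Fin p → R')
    (hb : ∀ j : Fin p, b' j = μ * f ((((Shape.scale lam J.wt)⁻¹ * Shape.scale g J.chr : Rˣ) : R) ^
      (j : ℕ)) * b j) :
    kummerNorm (f (MvPolynomial.aeval (S.act lam g z) J.form)) b' =
      μ ^ p * kummerNorm (f (MvPolynomial.aeval z J.form)) b := by
  refine kummerNorm_scale _ _ _ _ μ (Units.map (f : R →* R')
    ((Shape.scale lam J.wt)⁻¹ * Shape.scale g J.chr)) ?_ fun j => (hb j).trans ?_
  · have h : (((Shape.scale lam J.wt : Rˣ) : R) ^ p) *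
        (((Shape.scale lam J.wt)⁻¹ * Shape.scale g J.chr : Rˣ) : R) ^ p = 1 := by
      rw [← mul_pow, ← Units.val_mul, mul_inv_cancel_left, ← Units.val_pow_eq_pow_val,
        Shape.scale_pow_eq_one hg, Units.val_one]
    rw [J.form_act R lam g hg, Units.coe_map, MonoidHom.coe_coe, ← map_pow, ← map_mul]
    congr 1
    linear_combination (MvPolynomial.aeval z J.form) * h
  · simp

theorem normα_act {R : Type u} [CommRing R] [Algebra k R] (lam : (shapePL J).total.β → Rˣ)
    (g : Fin n → Rˣ) (hg : ∀ j, g j ^ p = 1) (x : (shapePL J).total.ι → R) :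
    normα ((shapePL J).total.act lam g x) E ε =
      algebraMap R (R ⊗[k] E) (((lam (.inr (.inr ())) : Rˣ) : R) ^ p) * normα x E ε := by
  have h₀ : norm₀ ((shapePL J).total.act lam g x) =
      ((lam (.inr (.inl (.inl (.inr ())))) : Rˣ) : R) ^ p * norm₀ x := by
    have hs : s₀ ((shapePL J).total.act lam g x) =
        S.act (fun b => lam (.inr (.inl (.inl (.inl b))))) g (s₀ x) := by
      funext i
      simp [s₀, Shape.act, Shape.scale]
    have := kummerNorm_act (J := J) (RingHom.id R) (fun b => lam (.inr (.inl (.inl (.inl b))))) g hg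
      (s₀ x) ((lam (.inr (.inl (.inl (.inr ())))) : Rˣ) : R) (b₀ x)
      (b₀ ((shapePL J).total.act lam g x)) (fun j => by
        have hw : Shape.scale lam ((shapePL J).total.wt (.inr (.inl (.inl (.inr j))))) =
            lam (.inr (.inl (.inl (.inr ())))) *
              ((Shape.scale (fun b => lam (.inr (.inl (.inl (.inl b))))) J.wt)⁻¹) ^ (j : ℕ) := by
          simp [Shape.scale, FormLine.overPt, zpow_mul, mul_comm]
          rw [← Finset.prod_pow]
          refine Finset.prod_congr rfl fun b _ => ?_
          rw [← zpow_natCast, ← zpow_natCast, ← zpow_mul, ← zpow_mul, mul_comm]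
        have hc : Shape.scale g ((shapePL J).total.chr (.inr (.inl (.inl (.inr j))))) =
            Shape.scale g J.chr ^ (j : ℕ) := by
          exact (Shape.scale_smul g j J.chr).trans (zpow_natCast _ _)
        rw [b₀, Shape.act, hw, hc, RingHom.id_apply]
        push_cast
        rw [mul_pow, ← mul_assoc]
        rfl)
    rw [norm₀, norm₀, hs]
    exact this
  have hi : ∀ i, norm ((shapePL J).total.act lam g x) E ε i =
      algebraMap R (R ⊗[k] E) ((lam (.inr (.inl (.inr (i, .inr ())))) : Rˣ) : R) ^ p *
        norm x E ε i := fun i => by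
    have hs : s ((shapePL J).total.act lam g x) i =
        S.act (fun b => lam (.inr (.inl (.inr (i, .inl b))))) g (s x i) := by
      funext j
      simp [s, Shape.act, Shape.scale, Fintype.prod_prod_type]
    have := kummerNorm_act (J := J) (algebraMap R (R ⊗[k] E))
      (fun b => lam (.inr (.inl (.inr (i, .inl b))))) g hg
      (s x i) (algebraMap R (R ⊗[k] E) ((lam (.inr (.inl (.inr (i, .inr ())))) : Rˣ) : R))
      (fun j => algebraMap R (R ⊗[k] E) (b x i j) +
        if (j : ℕ) = 0 then algebraMap R (R ⊗[k] E) (t x i) * ((1 : R) ⊗ₜ[k] ε) else 0)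
      (fun j => algebraMap R (R ⊗[k] E) (b ((shapePL J).total.act lam g x) i j) +
        if (j : ℕ) = 0 then algebraMap R (R ⊗[k] E) (t ((shapePL J).total.act lam g x) i) *
          ((1 : R) ⊗ₜ[k] ε) else 0) (fun j => by
        have hw : Shape.scale lam ((shapePL J).total.wt (.inr (.inl (.inr (i, .inr (some j)))))) =
            lam (.inr (.inl (.inr (i, .inr ())))) *
              ((Shape.scale (fun b => lam (.inr (.inl (.inr (i, .inl b))))) J.wt)⁻¹) ^ (j : ℕ) := by
          simp [Shape.scale, FormLine.overPt, mul_comm]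
          rw [Fintype.prod_prod_type, Finset.prod_eq_single i
            (fun i' _ hi' => by simp [hi'.symm]) (by simp), ← Finset.prod_pow]
          simp
          rw [mul_comm]
          congr 2
          refine Finset.prod_congr rfl fun b _ => ?_
          rw [← zpow_natCast, ← zpow_mul, mul_comm]
        have hc : Shape.scale g ((shapePL J).total.chr (.inr (.inl (.inr (i, .inr (some j)))))) =
            Shape.scale g J.chr ^ (j : ℕ) := by
          exact (Shape.scale_smul g j J.chr).trans (zpow_natCast _ _)
        have hb : b ((shapePL J).total.act lam g x) i j =
            ((lam (.inr (.inl (.inr (i, .inr ())))) : Rˣ) : R) *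
            (((Shape.scale (fun b => lam (.inr (.inl (.inr (i, .inl b))))) J.wt)⁻¹ *
              Shape.scale g J.chr : Rˣ) : R) ^ (j : ℕ) * b x i j := by
          rw [b, Shape.act, hw, hc]
          push_cast
          rw [mul_pow, ← mul_assoc]
          rfl
        have ht : t ((shapePL J).total.act lam g x) i =
            ((lam (.inr (.inl (.inr (i, .inr ())))) : Rˣ) : R) * t x i := by
          simp [t, Shape.act, Shape.scale, Fintype.prod_prod_type]
        rw [hb, ht]
        by_cases hj : (j : ℕ) = 0
        · simp only [hj, if_true, pow_zero, map_mul, map_one, mul_one]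
          ring
        · simp only [hj, if_false, map_mul, add_zero])
    rw [norm, norm, hs]
    exact this
  have hy : y ((shapePL J).total.act lam g x) =
      ((lam (.inr (.inr ())) * (lam (.inr (.inl (.inl (.inr ())))))⁻¹ *
        (∏ i, lam (.inr (.inl (.inr (i, .inr ())))))⁻¹ : Rˣ) : R) * y x := by
    simp [y, Shape.act, Shape.scale, Fintype.prod_prod_type]
    ring
  have hP : (((∏ i, lam (.inr (.inl (.inr (i, .inr ())))) : Rˣ) : Rˣ) : R) =
      ∏ i, ((lam (.inr (.inl (.inr (i, .inr ())))) : Rˣ) : R) := Units.coe_prod _ _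
  have h1 := congrArg (· ^ p) (Units.mul_inv (lam (.inr (.inl (.inl (.inr ()))))))
  have h2 := congrArg (· ^ p) (Units.mul_inv (∏ i, lam (.inr (.inl (.inr (i, .inr ()))))))
  simp only [one_pow, mul_pow] at h1 h2
  rw [normα, normα, h₀, hy]
  simp only [hi, Finset.prod_mul_distrib, Finset.prod_pow]
  rw [← map_prod, ← hP, ← map_pow, ← mul_assoc, ← map_mul, ← mul_assoc (algebraMap R _ _),
    ← map_mul]
  congr 2
  rw [Units.val_mul, Units.val_mul]
  simp only [mul_pow]
  linear_combination (((lam (.inr (.inr ())) : Rˣ) : R) ^ p * y x ^ p * norm₀ x) *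
    (((((∏ i, lam (.inr (.inl (.inr (i, .inr ())))) : Rˣ) : Rˣ) : R) ^ p *
      (((∏ i, lam (.inr (.inl (.inr (i, .inr ())))))⁻¹ : Rˣ) : R) ^ p) * h1 + h2)

theorem tt_act {R : Type u} [CommRing R] (lam : (shapePL J).total.β → Rˣ)
    (g : Fin n → Rˣ) (x : (shapePL J).total.ι → R) :
    tt ((shapePL J).total.act lam g x) = ((lam (.inr (.inr ())) : Rˣ) : R) * tt x := by
  simp [tt, Shape.act, Shape.scale]

end PL

/-- The fibre `Ȳ_w` in `ℙ(L ⊕ 𝒪)`: the locus of all `[α : t]` such that `N(α) = t^p w`. -/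
noncomputable def locusY (E : Type u) [CommRing E] [Algebra k E] (ε w : E) :
    Locus k p (shapePL J).total where
  eqn R _ _ x := PL.normα x E ε =
    algebraMap R (R ⊗[k] E) (PL.tt x ^ p) * ((1 : R) ⊗ₜ[k] w)
  eqn_map {R R'} _ _ _ _ f x hx := by
    rw [← PL.normα_map, hx]
    simp [PL.tt]
  eqn_act {R} _ _ lam g hg x hx := by
    rw [PL.normα_act E ε lam g hg, PL.tt_act, hx, mul_pow, map_mul, mul_assoc]

/-- `Ȳ_w` as a variety with `μ_pⁿ`-action. -/
noncomputable def varY (E : Type u) [CommRing E] [Algebra k E] (ε w : E) :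
    GFunctor k (MuPow k p n) := (locusY J E ε w).toGFunctor

end Kummer

end NormPrinciple

/-!
All varieties in question are loci in iterated bundles of projective spaces, described by
homogeneous coordinates, and the proof consists in computing all fixed points, and the characters
of `μ_pⁿ` in the tangent spaces, in normalised coordinates.

*Fixed points on `S` and `ℙ(𝒜)`.* Selecting one nonzero coordinate in each block, homogeneous
coordinates can be normalised in exactly one way (`Shape.Unimodular`), and `μ_pⁿ` acts on the
normalised coordinates through characters (`Shape.FixPt.coordChar`). If none of the characters of
the remaining coordinates is trivial, the only fixed point is the one at which they all vanish. For
the chain lemma variety this holds at every torus-fixed point, and there `μ_pⁿ` acts nontrivially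
on the fibre of `J`, and `γ ≠ 0`: along the tower of projective bundles, the characters of the line
bundles in use stay linearly independent over `ℤ/p` (`chainVariety_good`). If `χ` is the character
of `J` at a fixed point `s`, then the fixed points of `ℙ(𝒜)` over `s` are the `p` lines `J^{⊗ l}`,
and the characters in the fibre direction are the `(j - l) χ` with `j ≠ l`, i.e. the nontrivial
multiples of `χ`, each once, whatever `l` is.

*Fixed points on `Ȳ_w`.* At a fixed point `[α : t]`, all `s_i` are fixed points of `S`, and each of
`b₀, …, b_{p-1}` is homogeneous, unless `t_i ≠ 0`, when `b_i + t_i ε` becomes `x_i + ε`. So `N(α)`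
is a scalar times the `p`-th power of `∏ (x_i + ε)`, over those `i` with `t_i ≠ 0`. For `w` outside
a hypersurface, every `p`-th root of `w` over a field extension is a unit of degree exactly `p - 1`
in `ε` that is a product of linear factors with different roots (`IsKummer.exists_isGeneric`).
Hence `t ≠ 0`, all `t_i ≠ 0`, `y ≠ 0`, and then `b₀` must be a scalar, as `μ_pⁿ` acts on `y`
through a multiple of `χ` (`PL.exists_pt_yCoord_eq`). The fixed points are thus the pairs of a
`p`-tuple of fixed points of `S` and a solution of `(y ∏ (x_i + ε)) ^ p = w`. Over an algebraically
closed field, `E` becomes a product of `p` copies of the field, so `w` has `p ^ p` roots of order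
`p`, and each of them has `(p - 1)!` orderings of its linear factors
(`IsKummer.nonempty_Sol_equiv`). This is the number of the choices of `(l_1, …, l_p)`, times
`(p - 1)!`, on the other side.

*Tangent spaces and smoothness.* The norm of `x + ∑ b_j u ^ j` is `x ^ p` up to terms of order two
in the `b_j`, `j ≠ 0`. As solutions `(y, x)` have no infinitesimal deformations, the tangent space
of `Ȳ_w` is the direct sum of the tangent spaces of `ℙ(𝒜)` at the points `1` over the `s_i`
(`PL.tangentChart`). Smoothness of `Ȳ_w` follows by Newton's method from the surjectivity of the
derivative of `(y, x) ↦ (y ∏ (x_i + ε)) ^ p`, which is Lagrange interpolation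
(`IsKummer.exists_normFun_eq`).
-/

namespace NormPrinciple

/-! ### Unimodular shapes -/

section Unimodular

universe v

variable {n : ℕ} {B : Shape n}

/-- Whichever coordinate is selected in each block, the exponents with which the scaling factors act
on the selected coordinates form an invertible integer matrix.  It is stated as unique solvability
in an arbitrary abelian group, which is what normalising homogeneous coordinates needs. -/
def Shape.Unimodular (X : Shape n) : Prop :=
  ∀ (A : Type v) [CommGroup A] (σ : X.β → X.ι), (∀ b, X.blk (σ b) = b) → ∀ c : X.β → A,
    ∃! lam : X.β → A, ∀ b, ∏ b', lam b' ^ X.wt (σ b) b' = c b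

/-- The relative version of `Shape.Unimodular`: only the scaling factors of the blocks of `F`
itself are unknown. -/
def RelShape.Unimodular (F : RelShape B) : Prop :=
  ∀ (A : Type v) [CommGroup A] (σ : F.β → F.ι), (∀ b, F.blk (σ b) = b) → ∀ c : F.β → A,
    ∃! lam : F.β → A, ∀ b, ∏ b', lam b' ^ F.wt (σ b) (.inr b') = c b

theorem exists_section_of_sumMap {α β γ δ : Type*} {f : α → γ} {g : β → δ} {σ : γ ⊕ δ → α ⊕ β}
    (h : ∀ b, Sum.map f g (σ b) = b) :
    ∃ (σ₁ : γ → α) (σ₂ : δ → β), (∀ b, f (σ₁ b) = b) ∧ (∀ b, g (σ₂ b) = b) ∧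
      (∀ b, σ (.inl b) = .inl (σ₁ b)) ∧ ∀ b, σ (.inr b) = .inr (σ₂ b) := by
  have h1 : ∀ b, ∃ i, f i = b ∧ σ (.inl b) = .inl i := fun b => by
    have := h (.inl b)
    rcases hs : σ (.inl b) with i | i <;> rw [hs] at this <;> simp at this
    exact ⟨i, this, rfl⟩
  have h2 : ∀ b, ∃ i, g i = b ∧ σ (.inr b) = .inr i := fun b => by
    have := h (.inr b)
    rcases hs : σ (.inr b) with i | i <;> rw [hs] at this <;> simp at this
    exact ⟨i, this, rfl⟩
  choose σ₁ h1 h1' using h1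
  choose σ₂ h2 h2' using h2
  exact ⟨σ₁, σ₂, h1, h2, h1', h2'⟩

theorem Shape.unimodular_pt : (Shape.pt (n := n)).Unimodular := fun _ _ _ _ c =>
  ⟨c, fun b => b.elim, fun _ _ => funext fun b => b.elim⟩

theorem RelShape.Unimodular.total {F : RelShape B} (hB : Shape.Unimodular.{v} B)
    (hF : RelShape.Unimodular.{v} F) : Shape.Unimodular.{v} F.total := by
  intro A _ σ hσ c
  obtain ⟨σ₁, σ₂, h1, h2, e1, e2⟩ := exists_section_of_sumMap hσ
  obtain ⟨l₁, hl₁, u₁⟩ := hB A σ₁ h1 fun b => c (.inl b)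
  obtain ⟨l₂, hl₂, u₂⟩ := hF A σ₂ h2 fun b =>
    (∏ b', l₁ b' ^ F.wt (σ₂ b) (.inl b'))⁻¹ * c (.inr b)
  refine ⟨Sum.elim l₁ l₂, ?_, fun m hm => ?_⟩
  · rintro (b | b)
    · simpa [e1] using hl₁ b
    · simp [e2, hl₂ b]
  · have h : (fun b => m (.inl b)) = l₁ := u₁ _ fun b => by simpa [e1] using hm (.inl b)
    have h' : (fun b => m (.inr b)) = l₂ := u₂ _ fun b => by
      have := hm (.inr b)
      rw [e2, Fintype.prod_sum_type] at this
      rw [eq_inv_mul_iff_mul_eq, ← h]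
      exact this
    funext b
    rcases b with b | b
    · exact congrFun h b
    · exact congrFun h' b

theorem RelShape.unimodular_base : (RelShape.base B).Unimodular := fun _ _ _ _ c =>
  ⟨c, fun b => b.elim, fun _ _ => funext fun b => b.elim⟩

theorem RelShape.Unimodular.overPt {X : Shape n} (hX : Shape.Unimodular.{v} X) :
    RelShape.Unimodular.{v} (RelShape.overPt X) := fun A _ σ h c => hX A σ h c

theorem RelShape.Unimodular.proj {F : RelShape B} (hF : RelShape.Unimodular.{v} F) {J : Type}
    (L : J → Line F.total) : RelShape.Unimodular.{v} (F.proj L) := by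
  intro A _ σ hσ c
  obtain ⟨σ₁, σ₂, h1, h2, e1, e2⟩ := exists_section_of_sumMap hσ
  obtain ⟨l₁, hl₁, u₁⟩ := hF A σ₁ h1 fun b => c (.inl b)
  refine ⟨Sum.elim l₁ fun _ => (∏ b', l₁ b' ^ (-(L (σ₂ ())).wt (.inr b')))⁻¹ * c (.inr ()),
    ?_, fun m hm => ?_⟩
  · rintro (b | b)
    · simpa [e1] using hl₁ b
    · simp [e2]
  · have h : (fun b => m (.inl b)) = l₁ := u₁ _ fun b => by simpa [e1] using hm (.inl b)
    have := hm (.inr ())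
    rw [e2, Fintype.prod_sum_type] at this
    funext b
    rcases b with b | b
    · exact congrFun h b
    · refine eq_inv_mul_of_mul_eq ?_
      rw [← h, ← this]
      simp

theorem RelShape.Unimodular.mul {F F' : RelShape B} (hF : RelShape.Unimodular.{v} F)
    (hF' : RelShape.Unimodular.{v} F') : RelShape.Unimodular.{v} (F.mul F') := by
  intro A _ σ hσ c
  obtain ⟨σ₁, σ₂, h1, h2, e1, e2⟩ := exists_section_of_sumMap hσ
  obtain ⟨l₁, hl₁, u₁⟩ := hF A σ₁ h1 fun b => c (.inl b)
  obtain ⟨l₂, hl₂, u₂⟩ := hF' A σ₂ h2 fun b => c (.inr b)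
  refine ⟨Sum.elim l₁ l₂, ?_, fun m hm => ?_⟩
  · rintro (b | b)
    · simpa [e1] using hl₁ b
    · simpa [e2] using hl₂ b
  · have h : (fun b => m (.inl b)) = l₁ := u₁ _ fun b => by simpa [e1] using hm (.inl b)
    have h' : (fun b => m (.inr b)) = l₂ := u₂ _ fun b => by simpa [e2] using hm (.inr b)
    funext b
    rcases b with b | b
    · exact congrFun h b
    · exact congrFun h' b

theorem exists_section_of_prodMap {α β γ : Type*} {f : β → γ} {σ : α × γ → α × β}
    (h : ∀ b, ((σ b).1, f (σ b).2) = b) :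
    ∃ σ' : α → γ → β, (∀ a b, f (σ' a b) = b) ∧ ∀ a b, σ (a, b) = (a, σ' a b) :=
  ⟨fun a b => (σ (a, b)).2, fun a b => congrArg Prod.snd (h (a, b)),
    fun a b => Prod.ext (congrArg (fun z : α × γ => z.1) (h (a, b)) :) rfl⟩

theorem RelShape.Unimodular.pow {F : RelShape B} (hF : RelShape.Unimodular.{v} F) (m : ℕ) :
    RelShape.Unimodular.{v} (F.pow m) := by
  intro A _ σ hσ c
  obtain ⟨σ', h, e⟩ := exists_section_of_prodMap hσ
  have key : ∀ (l : Fin m × F.β → A) a b,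
      ∏ b', l b' ^ (F.pow m).wt (σ (a, b)) (.inr b') =
        ∏ b', l (a, b') ^ F.wt (σ' a b) (.inr b') := fun l a b => by
    rw [Fintype.prod_prod_type, Finset.prod_eq_single a]
    · simp [e]
    · intro a' _ ha'
      simp [e, ha'.symm]
    · simp
  choose l hl u using fun a => hF A (σ' a) (h a) fun b => c (a, b)
  refine ⟨fun b => l b.1 b.2, ?_, fun m' hm => ?_⟩
  · rintro ⟨a, b⟩
    rw [key]
    exact hl a b
  · funext ⟨a, b⟩
    refine congrFun (u a (fun b => m' (a, b)) fun b => ?_) b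
    rw [← hm (a, b), key]

end Unimodular

/-! ### Torus-fixed points -/

/-- A fixed point of the big torus: the point all of whose homogeneous coordinates vanish except for
one in each block, together with the characters `D b` through which `μ_pⁿ` acts on the fibres of the
tautological line bundles at this point. -/
structure Shape.FixPt {n : ℕ} (X : Shape n) where
  σ : X.β → X.ι
  blk_σ : ∀ b, X.blk (σ b) = b
  D : X.β → Fin n → ℤ
  D_spec : ∀ b, ∑ b', X.wt (σ b) b' • D b' = X.chr (σ b)

namespace Shape.FixPt

variable {n : ℕ} {X : Shape n} (P : X.FixPt)

/-- The character through which `μ_pⁿ` acts on the `i`-th coordinate, the coordinates being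
normalised by the condition that those selected by `P` are `1`. -/
def coordChar (i : X.ι) : Fin n → ℤ := X.chr i - ∑ b, X.wt i b • P.D b

/-- The character through which `μ_pⁿ` acts on the fibre of a line bundle at `P`. -/
def lineChar (L : Line X) : Fin n → ℤ := ∑ b, L.wt b • P.D b + L.chr

open Classical in
/-- The homogeneous coordinates of the point `P`. -/
noncomputable def point (R : Type*) [CommRing R] (i : X.ι) : R :=
  if P.σ (X.blk i) = i then 1 else 0

theorem coordChar_σ (b : X.β) : P.coordChar (P.σ b) = 0 := by
  rw [coordChar, P.D_spec, sub_self]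

theorem point_σ (R : Type*) [CommRing R] (b : X.β) : P.point R (P.σ b) = 1 := by
  simp [point, P.blk_σ]

theorem point_of_ne (R : Type*) [CommRing R] {i : X.ι} (h : P.σ (X.blk i) ≠ i) :
    P.point R i = 0 := by
  simp [point, h]

theorem map_point {R R' : Type*} [CommRing R] [CommRing R'] (f : R →+* R') (i : X.ι) :
    f (P.point R i) = P.point R' i := by
  unfold point
  split_ifs <;> simp

variable {P}

theorem eq_of_σ_eq (hX : Shape.Unimodular.{0} X) {P Q : X.FixPt} (h : P.σ = Q.σ) : P = Q := by
  have hD : P.D = Q.D := by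
    obtain ⟨l, -, hu⟩ := hX (Multiplicative (Fin n → ℤ)) P.σ P.blk_σ
      fun b => Multiplicative.ofAdd (X.chr (P.σ b))
    have h1 := hu (fun b => Multiplicative.ofAdd (P.D b)) fun b => by
      rw [← P.D_spec b, ofAdd_sum]
      rfl
    have h2 := hu (fun b => Multiplicative.ofAdd (Q.D b)) fun b => by
      rw [h, ← Q.D_spec b, ofAdd_sum]
      rfl
    exact h1.trans h2.symm
  cases P
  cases Q
  cases h
  cases hD
  rfl

theorem exists_of_section (hX : Shape.Unimodular.{0} X) (σ : X.β → X.ι)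
    (hσ : ∀ b, X.blk (σ b) = b) : ∃ P : X.FixPt, P.σ = σ := by
  obtain ⟨l, hl, -⟩ := hX (Multiplicative (Fin n → ℤ)) σ hσ
    fun b => Multiplicative.ofAdd (X.chr (σ b))
  refine ⟨⟨σ, hσ, fun b => (l b).toAdd, fun b => ?_⟩, rfl⟩
  have := congrArg Multiplicative.toAdd (hl b)
  rw [toAdd_prod] at this
  exact this

theorem finite (hX : Shape.Unimodular.{0} X) [Finite X.ι] : Finite X.FixPt :=
  Finite.of_injective (fun P : X.FixPt => P.σ) fun _ _ h => eq_of_σ_eq hX h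

end Shape.FixPt

/-! ### Projections that forget coordinates -/

/-- A projection `Y → X` that forgets coordinates: the coordinates of a point of `X` are some of the
coordinates of a point of `Y`, in full blocks. -/
structure Shape.Forget {n : ℕ} (Y X : Shape n) where
  i : X.ι → Y.ι
  b : X.β → Y.β
  i_inj : Function.Injective i
  b_inj : Function.Injective b
  blk : ∀ c, Y.blk (i c) = b (X.blk c)
  full : ∀ d b', Y.blk d = b b' → ∃ c, i c = d
  wt : ∀ c b', Y.wt (i c) (b b') = X.wt c b'
  wt_zero : ∀ c d, d ∉ Set.range b → Y.wt (i c) d = 0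
  chr : ∀ c, Y.chr (i c) = X.chr c

namespace Shape.Forget

variable {n : ℕ} {X Y Z : Shape n}

/-- The composite of two projections. -/
def comp (f : Forget Y X) (g : Forget Z Y) : Forget Z X where
  i := g.i ∘ f.i
  b := g.b ∘ f.b
  i_inj := g.i_inj.comp f.i_inj
  b_inj := g.b_inj.comp f.b_inj
  blk c := by simp [g.blk, f.blk]
  full d b' h := by
    obtain ⟨c, rfl⟩ := g.full d _ h
    obtain ⟨c', rfl⟩ := f.full c b' (g.b_inj ((g.blk c).symm.trans h))
    exact ⟨c', rfl⟩
  wt c b' := by simp [g.wt, f.wt]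
  wt_zero c d hd := by
    by_cases h : d ∈ Set.range g.b
    · obtain ⟨d', rfl⟩ := h
      rw [Function.comp_apply, g.wt]
      refine f.wt_zero c d' ?_
      rintro ⟨e, rfl⟩
      exact hd ⟨e, rfl⟩
    · exact g.wt_zero _ _ h
  chr c := by simp [g.chr, f.chr]

theorem sum_wt (f : Forget Y X) {A : Type*} [AddCommGroup A] (D : Y.β → A) (c : X.ι) :
    ∑ d, Y.wt (f.i c) d • D d = ∑ b', X.wt c b' • D (f.b b') := by
  refine (Fintype.sum_of_injective f.b f.b_inj _ _ (fun d hd => ?_) fun b' => ?_).symm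
  · rw [f.wt_zero c d hd, zero_smul]
  · rw [f.wt]

/-- The image of a fixed point under a projection. -/
noncomputable def push (f : Forget Y X) (P : Y.FixPt) : X.FixPt where
  σ b' := (f.full (P.σ (f.b b')) b' (P.blk_σ _)).choose
  blk_σ b' := f.b_inj (by
    rw [← f.blk, (f.full (P.σ (f.b b')) b' (P.blk_σ _)).choose_spec, P.blk_σ])
  D b' := P.D (f.b b')
  D_spec b' := by
    rw [← f.sum_wt, ← f.chr, (f.full (P.σ (f.b b')) b' (P.blk_σ _)).choose_spec, P.D_spec]

variable (f : Forget Y X) (P : Y.FixPt)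

theorem i_push_σ (b' : X.β) : f.i ((f.push P).σ b') = P.σ (f.b b') :=
  (f.full (P.σ (f.b b')) b' (P.blk_σ _)).choose_spec

theorem push_D (b' : X.β) : (f.push P).D b' = P.D (f.b b') := rfl

theorem push_σ_blk (c : X.ι) : (f.push P).σ (X.blk c) = c ↔ P.σ (Y.blk (f.i c)) = f.i c := by
  rw [f.blk, ← f.i_push_σ, f.i_inj.eq_iff]

theorem coordChar_i (c : X.ι) : P.coordChar (f.i c) = (f.push P).coordChar c := by
  rw [Shape.FixPt.coordChar, Shape.FixPt.coordChar, f.chr, f.sum_wt]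
  rfl

theorem point_i (R : Type*) [CommRing R] (c : X.ι) :
    P.point R (f.i c) = (f.push P).point R c := by
  by_cases h : P.σ (Y.blk (f.i c)) = f.i c
  · rw [Shape.FixPt.point, Shape.FixPt.point, if_pos h, if_pos ((f.push_σ_blk P c).2 h)]
  · rw [P.point_of_ne R h, Shape.FixPt.point_of_ne _ R (mt (f.push_σ_blk P c).1 h)]

theorem lineChar_eq (L' : Line Y) (L : Line X) (hw : ∀ b', L'.wt (f.b b') = L.wt b')
    (hw0 : ∀ d, d ∉ Set.range f.b → L'.wt d = 0) (hc : L'.chr = L.chr) :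
    P.lineChar L' = (f.push P).lineChar L := by
  rw [Shape.FixPt.lineChar, Shape.FixPt.lineChar, hc]
  congr 1
  refine (Fintype.sum_of_injective f.b f.b_inj _ _ (fun d hd => ?_) fun b' => ?_).symm
  · rw [hw0 d hd, zero_smul]
  · rw [hw]
    rfl

end Shape.Forget

namespace RelShape

variable {n : ℕ} {B : Shape n}

/-- The projection of a relative variety to its base. -/
def forgetTotal (F : RelShape B) : Shape.Forget F.total B where
  i := Sum.inl
  b := Sum.inl
  i_inj := Sum.inl_injective
  b_inj := Sum.inl_injective
  blk _ := rfl
  full := by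
    rintro (d | d) b' h
    · exact ⟨d, rfl⟩
    · simp at h
  wt _ _ := rfl
  wt_zero := by
    rintro c (d | d) h
    · exact absurd ⟨d, rfl⟩ h
    · rfl
  chr _ := rfl

/-- A variety and the same variety over the point. -/
def forgetOverPt (X : Shape n) : Shape.Forget (overPt X).total X where
  i := Sum.inr
  b := Sum.inr
  i_inj := Sum.inr_injective
  b_inj := Sum.inr_injective
  blk _ := rfl
  full := by
    rintro (d | d) b' h
    · exact d.elim
    · exact ⟨d, rfl⟩
  wt _ _ := rfl
  wt_zero := by
    rintro c (d | d) h
    · rfl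
    · exact absurd ⟨d, rfl⟩ h
  chr _ := rfl

/-- The projection of a projective bundle. -/
def forgetProj (F : RelShape B) {J : Type} (L : J → Line F.total) :
    Shape.Forget (F.proj L).total F.total where
  i := Sum.map id Sum.inl
  b := Sum.map id Sum.inl
  i_inj := Function.injective_id.sumMap Sum.inl_injective
  b_inj := Function.injective_id.sumMap Sum.inl_injective
  blk := by rintro (c | c) <;> rfl
  full := by
    rintro (d | d | d) (b' | b') h
    · exact ⟨.inl d, rfl⟩
    · simp at h
    · exact ⟨.inr d, rfl⟩
    · exact ⟨.inr d, rfl⟩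
    · simp at h
    · simp at h
  wt := by rintro (c | c) (b' | b') <;> rfl
  wt_zero := by
    rintro (c | c) (d | d | d) h
    · exact absurd ⟨.inl d, rfl⟩ h
    · rfl
    · rfl
    · exact absurd ⟨.inl d, rfl⟩ h
    · exact absurd ⟨.inr d, rfl⟩ h
    · rfl
  chr := by rintro (c | c) <;> rfl

/-- The first projection of a fibre product. -/
def forgetFst (F F' : RelShape B) : Shape.Forget (F.mul F').total F.total where
  i := Sum.map id Sum.inl
  b := Sum.map id Sum.inl
  i_inj := Function.injective_id.sumMap Sum.inl_injective
  b_inj := Function.injective_id.sumMap Sum.inl_injective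
  blk := by rintro (c | c) <;> rfl
  full := by
    rintro (d | d | d) (b' | b') h
    · exact ⟨.inl d, rfl⟩
    · simp at h
    · exact ⟨.inr d, rfl⟩
    · exact ⟨.inr d, rfl⟩
    · simp at h
    · simp at h
  wt := by rintro (c | c) (b' | b') <;> rfl
  wt_zero := by
    rintro (c | c) (d | d | d) h
    · exact absurd ⟨.inl d, rfl⟩ h
    · rfl
    · rfl
    · exact absurd ⟨.inl d, rfl⟩ h
    · exact absurd ⟨.inr d, rfl⟩ h
    · rfl
  chr := by rintro (c | c) <;> rfl

/-- The second projection of a fibre product. -/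
def forgetSnd (F F' : RelShape B) : Shape.Forget (F.mul F').total F'.total where
  i := Sum.map id Sum.inr
  b := Sum.map id Sum.inr
  i_inj := Function.injective_id.sumMap Sum.inr_injective
  b_inj := Function.injective_id.sumMap Sum.inr_injective
  blk := by rintro (c | c) <;> rfl
  full := by
    rintro (d | d | d) (b' | b') h
    · exact ⟨.inl d, rfl⟩
    · simp at h
    · simp at h
    · simp at h
    · exact ⟨.inr d, rfl⟩
    · exact ⟨.inr d, rfl⟩
  wt := by rintro (c | c) (b' | b') <;> rfl
  wt_zero := by
    rintro (c | c) (d | d | d) h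
    · exact absurd ⟨.inl d, rfl⟩ h
    · rfl
    · rfl
    · exact absurd ⟨.inl d, rfl⟩ h
    · rfl
    · exact absurd ⟨.inr d, rfl⟩ h
  chr := by rintro (c | c) <;> rfl

/-- The projections of a fibre power. -/
def forgetPow (F : RelShape B) (m : ℕ) (a : Fin m) : Shape.Forget (F.pow m).total F.total where
  i := Sum.map id (Prod.mk a)
  b := Sum.map id (Prod.mk a)
  i_inj := Function.injective_id.sumMap (Prod.mk_right_injective a)
  b_inj := Function.injective_id.sumMap (Prod.mk_right_injective a)
  blk := by rintro (c | c) <;> rfl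
  full := by
    rintro (d | ⟨a', d⟩) (b' | b') h
    · exact ⟨.inl d, rfl⟩
    · simp at h
    · simp at h
    · simp at h
      exact ⟨.inr d, by simp [h.1]⟩
  wt := by
    rintro (c | c) (b' | b')
    · rfl
    · rfl
    · rfl
    · simp
  wt_zero := by
    rintro (c | c) (d | ⟨a', d⟩) h
    · exact absurd ⟨.inl d, rfl⟩ h
    · rfl
    · exact absurd ⟨.inl d, rfl⟩ h
    · have : a ≠ a' := by
        rintro rfl
        exact h ⟨.inr d, rfl⟩
      simp [this]
  chr := by rintro (c | c) <;> rfl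

variable {F F' : RelShape B} {J : Type} (L : J → Line F.total)

/-- The summand of `⨁ j, L j` that is selected by a fixed point of `ℙ(⨁ j, L j)`. -/
theorem exists_σ_proj (P : (F.proj L).total.FixPt) : ∃ j, P.σ (.inr (.inr ())) = .inr (.inr j) := by
  have := P.blk_σ (.inr (.inr ()))
  rcases h : P.σ (.inr (.inr ())) with i | i | j
  · rw [h] at this; simp at this
  · rw [h] at this; simp at this
  · exact ⟨j, rfl⟩

theorem sum_wt_proj (P : (F.proj L).total.FixPt) (j : J) :
    ∑ b, (F.proj L).total.wt (.inr (.inr j)) b • P.D b =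
      P.D (.inr (.inr ())) + (L j).chr - ((F.forgetProj L).push P).lineChar (L j) := by
  simp [Shape.FixPt.lineChar, Shape.Forget.push_D, forgetProj]
  abel

theorem D_proj (P : (F.proj L).total.FixPt) {j : J} (h : P.σ (.inr (.inr ())) = .inr (.inr j)) :
    P.D (.inr (.inr ())) = ((F.forgetProj L).push P).lineChar (L j) := by
  have h1 := P.D_spec (.inr (.inr ()))
  rw [h, sum_wt_proj] at h1
  have h2 : (F.proj L).total.chr (.inr (.inr j)) = (L j).chr := rfl
  rw [h2] at h1
  have := sub_eq_iff_eq_add.1 h1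
  rw [add_comm] at this
  exact add_left_cancel this

theorem coordChar_proj (P : (F.proj L).total.FixPt) {j : J}
    (h : P.σ (.inr (.inr ())) = .inr (.inr j)) (j' : J) :
    P.coordChar (.inr (.inr j')) =
      ((F.forgetProj L).push P).lineChar (L j') - ((F.forgetProj L).push P).lineChar (L j) := by
  rw [Shape.FixPt.coordChar, sum_wt_proj, D_proj L P h]
  have h2 : (F.proj L).total.chr (.inr (.inr j')) = (L j').chr := rfl
  rw [h2]
  abel

theorem lineChar_taut (P : (F.proj L).total.FixPt) {j : J}
    (h : P.σ (.inr (.inr ())) = .inr (.inr j)) :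
    P.lineChar (F.taut L) = ((F.forgetProj L).push P).lineChar (L j) := by
  rw [← D_proj L P h]
  simp [Shape.FixPt.lineChar]

theorem lineChar_lineMul (P : (F.mul F').total.FixPt) (L : Line F.total) (L' : Line F'.total) :
    P.lineChar (lineMul L L') =
      ((forgetFst F F').push P).lineChar L + ((forgetSnd F F').push P).lineChar L' := by
  simp [Shape.FixPt.lineChar, Shape.Forget.push_D, forgetFst, forgetSnd, add_mul,
    Finset.sum_add_distrib]
  abel

theorem lineChar_linePow {m : ℕ} (P : (F.pow m).total.FixPt) (L : Line F.total) :
    P.lineChar (linePow L m) = ∑ a, ((forgetPow F m a).push P).lineChar L := by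
  simp [Shape.FixPt.lineChar, Shape.Forget.push_D, forgetPow, Finset.sum_add_distrib,
    Fintype.sum_prod_type, mul_assoc, Finset.mul_sum]

end RelShape

namespace Shape.FixPt

variable {n : ℕ} {X : Shape n} (P : X.FixPt)

theorem lineChar_one : P.lineChar Line.one = 0 := by
  simp [lineChar]

theorem lineChar_npow (L : Line X) (i : ℕ) : P.lineChar (L.npow i) = (i : ℤ) • P.lineChar L := by
  simp [lineChar, mul_smul, Finset.smul_sum]

end Shape.FixPt

/-! ### Fixed points of the chain lemma variety -/

/-- Reduction modulo `p` of characters: `μ_pⁿ` acts trivially through a character if and only if its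
reduction vanishes. -/
def red (p : ℕ) {n : ℕ} : (Fin n → ℤ) →+ (Fin n → ZMod p) :=
  (Int.castAddHom (ZMod p)).compLeft (Fin n)

theorem red_zsmul (p : ℕ) {n : ℕ} (m : ℤ) (c : Fin n → ℤ) :
    red p (m • c) = (m : ZMod p) • red p c := by
  funext j
  simp [red]

namespace Shape

variable {n : ℕ} {X Y Z : Shape n}

/-- The tangent space at `P` contains no trivial character, i.e. `P` is an isolated point of the
fixed locus. -/
def FixPt.Regular (p : ℕ) (P : X.FixPt) : Prop :=
  ∀ i, P.σ (X.blk i) ≠ i → red p (P.coordChar i) ≠ 0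

theorem Forget.push_comp (f : Forget Y X) (g : Forget Z Y) (P : Z.FixPt) :
    (f.comp g).push P = f.push (g.push P) := by
  have h : ((f.comp g).push P).σ = (f.push (g.push P)).σ := by
    funext b'
    refine f.i_inj (g.i_inj ?_)
    rw [f.i_push_σ, g.i_push_σ]
    exact (f.comp g).i_push_σ P b'
  have h' : ((f.comp g).push P).D = (f.push (g.push P)).D := rfl
  generalize (f.comp g).push P = Q at h h'
  generalize f.push (g.push P) = Q' at h h'
  cases Q
  cases Q'
  cases h
  cases h'
  rfl

/-- The value of the `p`-form of a line bundle at the generator given by the coordinates of `P`. -/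
noncomputable def FixPt.formAt {k : Type u} [Field k] {p : ℕ} (P : X.FixPt) (L : FormLine k p X) :
    k :=
  MvPolynomial.aeval (P.point k) L.form

end Shape

namespace RelShape

variable {n : ℕ} {B : Shape n} {F F' : RelShape B} (p : ℕ)

/-- The relative tangent space at `P` contains no trivial character. -/
def FibreRegular (P : F.total.FixPt) : Prop :=
  ∀ i : F.ι, P.σ (F.total.blk (.inr i)) ≠ .inr i → red p (P.coordChar (.inr i)) ≠ 0

variable {p}

theorem FibreRegular.regular {P : F.total.FixPt} (h : FibreRegular p P)
    (h0 : (F.forgetTotal.push P).Regular p) : P.Regular p := by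
  rintro (i | i) hi
  · have := h0 i (mt (F.forgetTotal.push_σ_blk P i).1 hi)
    rwa [← F.forgetTotal.coordChar_i P i] at this
  · exact h i hi

theorem fibreRegular_proj {J : Type} (L : J → Line F.total) {P : (F.proj L).total.FixPt}
    (h : FibreRegular p ((F.forgetProj L).push P))
    (hL : Function.Injective fun j => red p (((F.forgetProj L).push P).lineChar (L j))) :
    FibreRegular p P := by
  rintro (i | j) hi
  · have := h i (mt ((F.forgetProj L).push_σ_blk P (.inr i)).1 hi)
    rwa [← (F.forgetProj L).coordChar_i P] at this
  · obtain ⟨j₀, hj₀⟩ := exists_σ_proj L P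
    rw [coordChar_proj L P hj₀, map_sub, sub_ne_zero]
    refine hL.ne ?_
    rintro rfl
    exact hi hj₀

theorem fibreRegular_mul {P : (F.mul F').total.FixPt}
    (h : FibreRegular p ((forgetFst F F').push P))
    (h' : FibreRegular p ((forgetSnd F F').push P)) : FibreRegular p P := by
  rintro (i | i) hi
  · have := h i (mt ((forgetFst F F').push_σ_blk P (.inr i)).1 hi)
    rwa [← (forgetFst F F').coordChar_i P] at this
  · have := h' i (mt ((forgetSnd F F').push_σ_blk P (.inr i)).1 hi)
    rwa [← (forgetSnd F F').coordChar_i P] at this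

theorem fibreRegular_pow {m : ℕ} {P : (F.pow m).total.FixPt}
    (h : ∀ a, FibreRegular p ((forgetPow F m a).push P)) : FibreRegular p P := by
  rintro ⟨a, i⟩ hi
  have := h a i (mt ((forgetPow F m a).push_σ_blk P (.inr i)).1 hi)
  rwa [← (forgetPow F m a).coordChar_i P] at this

end RelShape

namespace FormLine

variable {k : Type u} [Field k] {p n : ℕ} {X Y B : Shape n} {F F' : RelShape B}

open RelShape

theorem formAt_rename (f : Shape.Forget Y X) (P : Y.FixPt) (L : FormLine k p X) :
    MvPolynomial.aeval (P.point k) (MvPolynomial.rename f.i L.form) = (f.push P).formAt L := by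
  rw [MvPolynomial.aeval_rename, Shape.FixPt.formAt]
  congr 2
  funext c
  exact f.point_i P k c

theorem lineChar_tensor (P : X.FixPt) (L L' : FormLine k p X) :
    P.lineChar (L.tensor L').toLine = P.lineChar L.toLine + P.lineChar L'.toLine := by
  simp [Shape.FixPt.lineChar, tensor, add_mul, Finset.sum_add_distrib]
  abel

theorem formAt_tensor (P : X.FixPt) (L L' : FormLine k p X) :
    P.formAt (L.tensor L') = P.formAt L * P.formAt L' :=
  map_mul _ _ _

theorem lineChar_pull (P : F.total.FixPt) (L : FormLine k p B) :
    P.lineChar (L.pull F).toLine = (F.forgetTotal.push P).lineChar L.toLine :=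
  F.forgetTotal.lineChar_eq P _ _ (fun _ => rfl) (by
    rintro (d | d) h
    · exact absurd ⟨d, rfl⟩ h
    · rfl) rfl

theorem formAt_pull (P : F.total.FixPt) (L : FormLine k p B) :
    P.formAt (L.pull F) = (F.forgetTotal.push P).formAt L :=
  formAt_rename F.forgetTotal P L

theorem lineChar_overPt (P : (RelShape.overPt X).total.FixPt) (L : FormLine k p X) :
    P.lineChar L.overPt.toLine = ((forgetOverPt X).push P).lineChar L.toLine :=
  (forgetOverPt X).lineChar_eq P _ _ (fun _ => rfl) (by
    rintro (d | d) h
    · exact d.elim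
    · exact absurd ⟨d, rfl⟩ h) rfl

theorem lineChar_mul (P : (F.mul F').total.FixPt) (L : FormLine k p F.total)
    (L' : FormLine k p F'.total) :
    P.lineChar (L.mul L').toLine = ((forgetFst F F').push P).lineChar L.toLine +
      ((forgetSnd F F').push P).lineChar L'.toLine :=
  lineChar_lineMul P _ _

theorem formAt_mul (P : (F.mul F').total.FixPt) (L : FormLine k p F.total)
    (L' : FormLine k p F'.total) :
    P.formAt (L.mul L') = ((forgetFst F F').push P).formAt L *
      ((forgetSnd F F').push P).formAt L' := by
  rw [Shape.FixPt.formAt, mul, map_mul]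
  exact congrArg₂ _ (formAt_rename (forgetFst F F') P L) (formAt_rename (forgetSnd F F') P L')

theorem lineChar_pow {m : ℕ} (P : (F.pow m).total.FixPt) (L : FormLine k p F.total) :
    P.lineChar (L.pow m).toLine = ∑ a, ((forgetPow F m a).push P).lineChar L.toLine :=
  lineChar_linePow P _

theorem formAt_pow {m : ℕ} (P : (F.pow m).total.FixPt) (L : FormLine k p F.total) :
    P.formAt (L.pow m) = ∏ a, ((forgetPow F m a).push P).formAt L := by
  rw [Shape.FixPt.formAt, pow, map_prod]
  exact Finset.prod_congr rfl fun a _ => formAt_rename (forgetPow F m a) P L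

/-- At a fixed point of `ℙ(𝒪 ⊕ L)`, the tautological bundle is `𝒪` or `L`. -/
theorem lineChar_taut {L : FormLine k p F.total} (P : (F.proj L.oPlus).total.FixPt) :
    P.lineChar L.taut.toLine = 0 ∨
      P.lineChar L.taut.toLine = ((F.forgetProj L.oPlus).push P).lineChar L.toLine := by
  obtain ⟨j, hj⟩ := exists_σ_proj L.oPlus P
  have h : P.lineChar L.taut.toLine = _ := RelShape.lineChar_taut L.oPlus P hj
  rw [h]
  cases j
  · exact .inl (Shape.FixPt.lineChar_one _)
  · exact .inr rfl

theorem formAt_taut_ne_zero {L : FormLine k p F.total} (hp : p ≠ 0)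
    (P : (F.proj L.oPlus).total.FixPt)
    (hL : ((F.forgetProj L.oPlus).push P).formAt L ≠ 0) : P.formAt L.taut ≠ 0 := by
  obtain ⟨j, hj⟩ := exists_σ_proj L.oPlus P
  have h : P.formAt L.taut = P.point k (.inr (.inr false)) ^ p -
      ((F.forgetProj L.oPlus).push P).formAt L * P.point k (.inr (.inr true)) ^ p := by
    have := formAt_rename (F.forgetProj L.oPlus) P L
    rw [Shape.FixPt.formAt, taut, map_sub, map_mul, map_pow, map_pow, MvPolynomial.aeval_X,
      MvPolynomial.aeval_X, ← this]
    rfl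
  have h1 : P.point k (.inr (.inr j)) = 1 := by
    rw [← hj]
    exact P.point_σ k _
  have h2 : ∀ j', j' ≠ j → P.point k (.inr (.inr j')) = 0 := fun j' hj' => by
    refine P.point_of_ne k ?_
    change P.σ (.inr (.inr ())) ≠ _
    rw [hj]
    simpa using hj'.symm
  rw [h]
  cases j
  · rw [h1, h2 true (by simp)]
    simp [hp]
  · rw [h1, h2 false (by simp)]
    simpa [hp] using hL

end FormLine

section Tower

universe v

open RelShape FormLine

variable {k : Type u} [Field k] {p n : ℕ} {B : Shape n}

theorem tautPower_unimodular {F : RelShape B} (hF : RelShape.Unimodular.{v} F)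
    (L : FormLine k p F.total) : RelShape.Unimodular.{v} (tautPower F L).1 :=
  (hF.proj _).pow _

theorem tautPower_finite {F : RelShape B} [Finite F.ι] (L : FormLine k p F.total) :
    Finite (tautPower F L).1.ι :=
  inferInstanceAs (Finite (Fin (p - 1) × (F.ι ⊕ Bool)))

/-- Over a torus-fixed point `P₀` of the base, the characters `0` and `χ` of the two summands of
`𝒪 ⊕ L` differ, so that the fibres of `ℙ(𝒪 ⊕ L)` contribute no trivial character; and at such a
point `𝕃` is one of these summands. -/
theorem tautPower_spec (hp : p ≠ 0) {F : RelShape B} {L : FormLine k p F.total} (P₀ : B.FixPt)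
    (S : Submodule (ZMod p) (Fin n → ZMod p))
    (h : ∀ P : F.total.FixPt, F.forgetTotal.push P = P₀ → FibreRegular p P ∧ P.formAt L ≠ 0 ∧
      red p (P.lineChar L.toLine) ∈ S ∧ red p (P.lineChar L.toLine) ≠ 0)
    (P : (tautPower F L).1.total.FixPt) (hP : (tautPower F L).1.forgetTotal.push P = P₀) :
    FibreRegular p P ∧ P.formAt (tautPower F L).2 ≠ 0 ∧
      red p (P.lineChar (tautPower F L).2.toLine) ∈ S := by
  change ((F.proj L.oPlus).pow (p - 1)).total.FixPt at P
  have hQ : ∀ a, F.forgetTotal.push ((F.forgetProj L.oPlus).push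
      ((forgetPow (F.proj L.oPlus) (p - 1) a).push P)) = P₀ := fun a => by
    rw [← Shape.Forget.push_comp, ← Shape.Forget.push_comp, ← hP]
    rfl
  have hQ' := fun a => h _ (hQ a)
  refine ⟨?_, ?_, ?_⟩
  · refine fibreRegular_pow fun a => fibreRegular_proj _ (hQ' a).1 ?_
    have h0 := (hQ' a).2.2.2
    intro j j' hj
    cases j <;> cases j' <;> simp [Shape.FixPt.lineChar_one] at hj ⊢
    · exact absurd hj.symm h0
    · exact absurd hj h0
  · refine (formAt_pow P L.taut).trans_ne ?_
    exact Finset.prod_ne_zero_iff.2 fun a _ => formAt_taut_ne_zero hp _ (hQ' a).2.1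
  · have := lineChar_pow P L.taut
    have h2 : red p (P.lineChar (L.taut.pow (p - 1)).toLine) ∈ S := by
      rw [this, map_sum]
      refine S.sum_mem fun a _ => ?_
      rcases FormLine.lineChar_taut ((forgetPow (F.proj L.oPlus) (p - 1) a).push P) with h | h
      · rw [h, map_zero]
        exact S.zero_mem
      · rw [h]
        exact (hQ' a).2.2.1
    exact h2

theorem towerQ_unimodular (H : ℕ → FormLine k p B) (r : ℕ) :
    RelShape.Unimodular.{v} (towerQ H r).1 := by
  induction r with
  | zero => exact RelShape.unimodular_base
  | succ r ih => exact ih.mul (tautPower_unimodular ih _)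

theorem towerQ_finite (H : ℕ → FormLine k p B) (r : ℕ) : Finite (towerQ H r).1.ι := by
  induction r with
  | zero => exact inferInstanceAs (Finite Empty)
  | succ r ih =>
    have := tautPower_finite (((H r).pull (towerQ H r).1).tensor (towerQ H r).2)
    exact inferInstanceAs (Finite (_ ⊕ _))

theorem towerP_unimodular (H : ℕ → FormLine k p B) (r : ℕ) :
    RelShape.Unimodular.{v} (towerP H r).1 :=
  tautPower_unimodular (towerQ_unimodular H r) _

theorem towerP_finite (H : ℕ → FormLine k p B) (r : ℕ) : Finite (towerP H r).1.ι :=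
  have := towerQ_finite H r
  tautPower_finite _

/-- The characters of `H₀, …, H_{r-1}` at `P` span this subspace. -/
def charSpan (H : ℕ → FormLine k p B) (P : B.FixPt) (r : ℕ) :
    Submodule (ZMod p) (Fin n → ZMod p) :=
  Submodule.span _ ((fun i => red p (P.lineChar (H i).toLine)) '' Set.Iio r)

theorem charSpan_mono (H : ℕ → FormLine k p B) (P : B.FixPt) : Monotone (charSpan H P) :=
  fun _ _ h => Submodule.span_mono (Set.image_mono (Set.Iio_subset_Iio h))

theorem char_mem_charSpan (H : ℕ → FormLine k p B) (P : B.FixPt) {i r : ℕ} (h : i < r) :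
    red p (P.lineChar (H i).toLine) ∈ charSpan H P r :=
  Submodule.subset_span ⟨i, h, rfl⟩

theorem charSpan_succ (H : ℕ → FormLine k p B) (P : B.FixPt) (r : ℕ) :
    charSpan H P (r + 1) =
      charSpan H P r ⊔ Submodule.span _ {red p (P.lineChar (H r).toLine)} := by
  have : Set.Iio (r + 1) = Set.Iio r ∪ {r} := by
    ext i
    simp
  rw [charSpan, charSpan, this, Set.image_union, Submodule.span_union, Set.image_singleton]

/-- The line bundle used in the construction of `P_{r+1}` from `Q_r`. -/
theorem towerQ_line {H : ℕ → FormLine k p B} {P₀ : B.FixPt} {r : ℕ}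
    (hQ : ∀ P : (towerQ H r).1.total.FixPt, (towerQ H r).1.forgetTotal.push P = P₀ →
      FibreRegular p P ∧ P.formAt (towerQ H r).2 ≠ 0 ∧
        red p (P.lineChar (towerQ H r).2.toLine) ∈ charSpan H P₀ r)
    (hind : red p (P₀.lineChar (H r).toLine) ∉ charSpan H P₀ r) (hform : P₀.formAt (H r) ≠ 0)
    (P : (towerQ H r).1.total.FixPt) (hP : (towerQ H r).1.forgetTotal.push P = P₀) :
    FibreRegular p P ∧ P.formAt (((H r).pull (towerQ H r).1).tensor (towerQ H r).2) ≠ 0 ∧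
      red p (P.lineChar (((H r).pull (towerQ H r).1).tensor (towerQ H r).2).toLine) ∈
        charSpan H P₀ (r + 1) ∧
      red p (P.lineChar (((H r).pull (towerQ H r).1).tensor (towerQ H r).2).toLine) ≠ 0 := by
  obtain ⟨h1, h2, h3⟩ := hQ P hP
  rw [formAt_tensor, formAt_pull, lineChar_tensor, lineChar_pull, hP, map_add]
  refine ⟨h1, mul_ne_zero hform h2, Submodule.add_mem _ (char_mem_charSpan H P₀ r.lt_succ_self)
    (charSpan_mono H P₀ r.le_succ h3), fun h => hind ?_⟩
  rw [eq_neg_of_add_eq_zero_left h]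
  exact Submodule.neg_mem _ h3

/-- The character of `K_r` is a combination of those of `H₀, …, H_{r-1}`.  As that of `H_r` is not,
the character of `H_r ⊗ K_r` is nontrivial, and the next step of the tower can be made. -/
theorem towerQ_spec (hp : p ≠ 0) (H : ℕ → FormLine k p B) (P₀ : B.FixPt) (r : ℕ)
    (hind : ∀ i < r, red p (P₀.lineChar (H i).toLine) ∉ charSpan H P₀ i)
    (hform : ∀ i < r, P₀.formAt (H i) ≠ 0) (P : (towerQ H r).1.total.FixPt)
    (hP : (towerQ H r).1.forgetTotal.push P = P₀) :
    FibreRegular p P ∧ P.formAt (towerQ H r).2 ≠ 0 ∧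
      red p (P.lineChar (towerQ H r).2.toLine) ∈ charSpan H P₀ r := by
  induction r with
  | zero =>
    refine ⟨fun i => i.elim, ?_, ?_⟩
    · have : P.formAt (towerQ H 0).2 = 1 := by
        change MvPolynomial.aeval _ (MvPolynomial.C (1 : k)) = _
        simp
      rw [this]
      exact one_ne_zero
    · have : P.lineChar (towerQ H 0).2.toLine = 0 := by
        simp [towerQ, FormLine.one, FormLine.const, Shape.FixPt.lineChar]
      rw [this, map_zero]
      exact Submodule.zero_mem _
  | succ r ih =>
    have ih' := ih (fun i hi => hind i (hi.trans r.lt_succ_self))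
      (fun i hi => hform i (hi.trans r.lt_succ_self))
    have hl := towerQ_line ih' (hind r r.lt_succ_self) (hform r r.lt_succ_self)
    let Q := (towerQ H r).1
    let T := tautPower Q (((H r).pull Q).tensor (towerQ H r).2)
    change (Q.mul T.1).total.FixPt at P
    have e1 : Q.forgetTotal.push ((forgetFst Q T.1).push P) = P₀ := by
      rw [← Shape.Forget.push_comp, ← hP]
      rfl
    have e2 : T.1.forgetTotal.push ((forgetSnd Q T.1).push P) = P₀ := by
      rw [← Shape.Forget.push_comp, ← hP]
      rfl
    obtain ⟨a1, a2, a3⟩ := ih' _ e1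
    obtain ⟨b1, b2, b3⟩ := tautPower_spec hp P₀ _ hl _ e2
    refine ⟨fibreRegular_mul a1 b1, ?_, ?_⟩
    · exact (formAt_mul P (towerQ H r).2 T.2).trans_ne (mul_ne_zero a2 b2)
    · have := congrArg (red p) (lineChar_mul P (towerQ H r).2 T.2)
      rw [map_add] at this
      refine (this ▸ Submodule.add_mem _ (charSpan_mono H P₀ r.le_succ a3) b3 :)

theorem towerP_spec (hp : p ≠ 0) (H : ℕ → FormLine k p B) (P₀ : B.FixPt) (r : ℕ)
    (hind : ∀ i ≤ r, red p (P₀.lineChar (H i).toLine) ∉ charSpan H P₀ i)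
    (hform : ∀ i ≤ r, P₀.formAt (H i) ≠ 0) (P : (towerP H r).1.total.FixPt)
    (hP : (towerP H r).1.forgetTotal.push P = P₀) :
    FibreRegular p P ∧ P.formAt (towerP H r).2 ≠ 0 ∧
      red p (P.lineChar (towerP H r).2.toLine) ∈ charSpan H P₀ (r + 1) :=
  tautPower_spec hp P₀ _ (towerQ_line (towerQ_spec hp H P₀ r (fun i hi => hind i hi.le)
    fun i hi => hform i hi.le) (hind r le_rfl) (hform r le_rfl)) P hP

/-- The invariant of the construction of the chain lemma variety: at every fixed point, the
characters of `H₀, …, H_{m-1}, J, J'` are linearly independent, the `p`-forms of these line bundles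
are nonzero, and the tangent space contains no trivial character. -/
structure Stage.Good (m : ℕ) (s : Stage k p n) : Prop where
  finite : Finite s.X.ι
  regular : ∀ P : s.X.FixPt, P.Regular p
  form_H : ∀ P : s.X.FixPt, ∀ i < m, P.formAt (s.H i) ≠ 0
  form_J : ∀ P : s.X.FixPt, P.formAt s.J ≠ 0
  form_J' : ∀ P : s.X.FixPt, P.formAt s.J' ≠ 0
  ind_H : ∀ P : s.X.FixPt, ∀ i < m, red p (P.lineChar (s.H i).toLine) ∉ charSpan s.H P i
  ind_J : ∀ P : s.X.FixPt, red p (P.lineChar s.J.toLine) ∉ charSpan s.H P m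
  ind_J' : ∀ P : s.X.FixPt, red p (P.lineChar s.J'.toLine) ∉
    charSpan s.H P m ⊔ Submodule.span _ {red p (P.lineChar s.J.toLine)}

/-- Two vectors that are independent modulo a subspace may be exchanged. -/
theorem notMem_sup_span_symm {K V : Type*} [Field K] [AddCommGroup V] [Module K V]
    {S : Submodule K V} {x y : V} (hx : x ∉ S) (hy : y ∉ S ⊔ Submodule.span K {x}) :
    x ∉ S ⊔ Submodule.span K {y} := by
  intro h
  obtain ⟨s, hs, z, hz, rfl⟩ := Submodule.mem_sup.1 h
  obtain ⟨c, rfl⟩ := Submodule.mem_span_singleton.1 hz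
  have hc : c ≠ 0 := by
    rintro rfl
    simp at hx
    exact hx hs
  refine hy (Submodule.mem_sup.2 ⟨-(c⁻¹ • s), S.neg_mem (S.smul_mem _ hs), c⁻¹ • (s + c • y),
    Submodule.smul_mem _ _ (Submodule.mem_span_singleton_self _), ?_⟩)
  rw [smul_add, smul_smul, inv_mul_cancel₀ hc, one_smul]
  abel

/-- The new pair is `(J' ⊗ 𝕃(1, …, 1), J)`.  The character of `𝕃(1, …, 1)` is a combination of those
of `H₀, …, H_{m-1}, J`, so independence is not affected. -/
theorem Stage.Good.move [Fact p.Prime] {m : ℕ} {s : Stage k p n} (h : s.Good m) :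
    (s.move m).Good m := by
  have hp : p ≠ 0 := (Fact.out : p.Prime).ne_zero
  let M : ℕ → FormLine k p s.X := fun i => if i < m then s.H i else s.J
  let T := towerP M m
  have hM : ∀ i, i < m → M i = s.H i := fun i hi => if_pos hi
  have hMm : M m = s.J := if_neg (lt_irrefl m)
  have hspan : ∀ P i, i ≤ m → charSpan M P i = charSpan s.H P i := fun P i hi => by
    unfold charSpan
    congr 1
    refine Set.image_congr fun j hj => ?_
    rw [hM j (lt_of_lt_of_le hj hi)]
  have key : ∀ P : T.1.total.FixPt, FibreRegular p P ∧ P.formAt T.2 ≠ 0 ∧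
      red p (P.lineChar T.2.toLine) ∈ charSpan M (T.1.forgetTotal.push P) (m + 1) := fun P => by
    refine towerP_spec hp M _ m (fun i hi => ?_) (fun i hi => ?_) P rfl
    · rw [hspan _ i hi]
      rcases hi.lt_or_eq with hi | rfl
      · rw [hM i hi]
        exact h.ind_H _ i hi
      · rw [hMm]
        exact h.ind_J _
    · rcases hi.lt_or_eq with hi | rfl
      · rw [hM i hi]
        exact h.form_H _ i hi
      · rw [hMm]
        exact h.form_J _
  have hpull : ∀ (P : T.1.total.FixPt) i, charSpan (fun i => (s.H i).pull T.1) P i =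
      charSpan s.H (T.1.forgetTotal.push P) i := fun P i => by
    unfold charSpan
    congr 1
    refine Set.image_congr fun j _ => ?_
    rw [lineChar_pull]
  have hfin := h.finite
  have hfin' := towerP_finite M m
  have hJ' : ∀ P : T.1.total.FixPt, red p (P.lineChar ((s.J'.pull T.1).tensor T.2).toLine) ∉
      charSpan s.H (T.1.forgetTotal.push P) m ⊔
        Submodule.span _ {red p ((T.1.forgetTotal.push P).lineChar s.J.toLine)} := fun P hc => by
    refine h.ind_J' (T.1.forgetTotal.push P) ?_
    rw [lineChar_tensor, map_add, lineChar_pull] at hc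
    have h3 := (key P).2.2
    rw [charSpan_succ, hspan _ m le_rfl, hMm] at h3
    exact (Submodule.add_mem_iff_left _ h3).1 hc
  have indJ' : ∀ P : T.1.total.FixPt, red p (P.lineChar (s.J.pull T.1).toLine) ∉
      charSpan (fun i => (s.H i).pull T.1) P m ⊔
        Submodule.span _ {red p (P.lineChar ((s.J'.pull T.1).tensor T.2).toLine)} := fun P => by
    rw [hpull, lineChar_pull]
    exact notMem_sup_span_symm (h.ind_J (T.1.forgetTotal.push P)) (hJ' P)
  have indJ : ∀ P : T.1.total.FixPt, red p (P.lineChar ((s.J'.pull T.1).tensor T.2).toLine) ∉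
      charSpan (fun i => (s.H i).pull T.1) P m := fun P hc => by
    rw [hpull] at hc
    exact hJ' P (Submodule.mem_sup_left hc)
  have indH : ∀ P : T.1.total.FixPt, ∀ i < m, red p (P.lineChar ((s.H i).pull T.1).toLine) ∉
      charSpan (fun i => (s.H i).pull T.1) P i := fun P i hi => by
    rw [hpull, lineChar_pull]
    exact h.ind_H _ i hi
  have formJ : ∀ P : T.1.total.FixPt, P.formAt ((s.J'.pull T.1).tensor T.2) ≠ 0 := fun P => by
    rw [formAt_tensor, formAt_pull]
    exact mul_ne_zero (h.form_J' _) (key P).2.1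
  exact
    { finite := inferInstanceAs (Finite (s.X.ι ⊕ T.1.ι))
      regular := fun P => (key P).1.regular (h.regular _)
      form_H := fun P i hi => (formAt_pull (F := T.1) P (s.H i)).trans_ne (h.form_H _ i hi)
      form_J := formJ
      form_J' := fun P => (formAt_pull (F := T.1) P s.J).trans_ne (h.form_J _)
      ind_H := indH
      ind_J := indJ
      ind_J' := indJ' }

theorem Stage.Good.move_iterate [Fact p.Prime] {m : ℕ} {s : Stage k p n} (h : s.Good m) (r : ℕ) :
    ((Stage.move m)^[r] s).Good m := by
  induction r with
  | zero => exact h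
  | succ r ih =>
    rw [Function.iterate_succ_apply']
    exact ih.move

theorem Stage.Good.chain [Fact p.Prime] (m : ℕ) {s : Stage k p n} (h : s.Good m) :
    (s.chain m).Good 0 := by
  induction m generalizing s with
  | zero => exact h.move_iterate p
  | succ m ih =>
    have h' := h.move_iterate p
    refine ih (s := { (Stage.move (m + 1))^[p] s with J' := ((Stage.move (m + 1))^[p] s).H m }) ?_
    generalize (Stage.move (m + 1))^[p] s = s' at h'
    have hJ : ∀ P : s'.X.FixPt, red p (P.lineChar s'.J.toLine) ∉
        charSpan s'.H P m ⊔ Submodule.span _ {red p (P.lineChar (s'.H m).toLine)} := fun P => by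
      rw [← charSpan_succ]
      exact h'.ind_J P
    exact
      { finite := h'.finite
        regular := h'.regular
        form_H := fun P i hi => h'.form_H P i (hi.trans m.lt_succ_self)
        form_J := h'.form_J
        form_J' := fun P => h'.form_H P m m.lt_succ_self
        ind_H := fun P i hi => h'.ind_H P i (hi.trans m.lt_succ_self)
        ind_J := fun P hc => hJ P (Submodule.mem_sup_left hc)
        ind_J' := fun P => notMem_sup_span_symm (h'.ind_H P m m.lt_succ_self) (hJ P) }

theorem Stage.unimodular_chain (m : ℕ) {s : Stage k p n} (h : Shape.Unimodular.{v} s.X) :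
    Shape.Unimodular.{v} (s.chain m).X := by
  have hmove : ∀ (m : ℕ) (s : Stage k p n), Shape.Unimodular.{v} s.X →
      Shape.Unimodular.{v} (s.move m).X := fun m s h =>
    RelShape.Unimodular.total h (towerP_unimodular _ m)
  have hit : ∀ (m r : ℕ) (s : Stage k p n), Shape.Unimodular.{v} s.X →
      Shape.Unimodular.{v} ((Stage.move m)^[r] s).X := fun m r s h => by
    induction r with
    | zero => exact h
    | succ r ih =>
      rw [Function.iterate_succ_apply']
      exact hmove m _ ih
  induction m generalizing s with
  | zero => exact hit 0 p s h
  | succ m ih => exact ih (hit (m + 1) p s h)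

theorem chainVariety_unimodular (p : ℕ) (a : Fin n → k) :
    Shape.Unimodular.{v} (chainVariety p a).X :=
  Stage.unimodular_chain _ Shape.unimodular_pt

/-- At the start the characters of the line bundles are the coordinate characters of `μ_pⁿ`. -/
theorem chainVariety_good [Fact p.Prime] (hn : 2 ≤ n) {a : Fin n → k} (ha : ∀ i, a i ≠ 0) :
    (chainVariety p a).Good 0 := by
  have hchar : ∀ (P : (Shape.pt (n := n)).FixPt) i (hi : i < n),
      red p (P.lineChar (baseLine p a i).toLine) = Pi.single ⟨i, hi⟩ 1 := fun P i hi => by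
    rw [baseLine, dif_pos hi, Shape.FixPt.lineChar]
    funext j
    simp [red, FormLine.const, Pi.single_apply]
  have hform : ∀ (P : (Shape.pt (n := n)).FixPt) i, i < n → P.formAt (baseLine p a i) ≠ 0 :=
    fun P i hi => by
      rw [baseLine, dif_pos hi, Shape.FixPt.formAt]
      simpa [FormLine.const] using ha ⟨i, hi⟩
  -- the characters of `H_0, …, H_{r-1}` vanish at the `i`-th place if `r ≤ i`
  have hspan : ∀ (P : (Shape.pt (n := n)).FixPt) r i (hi : i < n), r ≤ i →
      charSpan (baseLine p a) P r ≤ LinearMap.ker (LinearMap.proj (R := ZMod p) ⟨i, hi⟩) :=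
    fun P r i hi hr => by
      refine Submodule.span_le.2 ?_
      rintro _ ⟨l, hl, rfl⟩
      have hl' : l < r := hl
      dsimp only
      rw [hchar P l (by omega)]
      simp
      exact Pi.single_eq_of_ne (by simpa using by omega) _
  have hne : ∀ (P : (Shape.pt (n := n)).FixPt) r i, i < n → r ≤ i →
      red p (P.lineChar (baseLine p a i).toLine) ∉ charSpan (baseLine p a) P r :=
    fun P r i hi hr hc => by
      have := hspan P r i hi hr hc
      rw [hchar P i hi] at this
      simp at this
  refine Stage.Good.chain (n - 2)
    { finite := inferInstanceAs (Finite Empty)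
      regular := fun P i => i.elim
      form_H := fun P i hi => hform P i (by omega)
      form_J := fun P => hform P _ (by omega)
      form_J' := fun P => hform P _ (by omega)
      ind_H := fun P i hi => hne P i i (by omega) le_rfl
      ind_J := fun P => hne P _ _ (by omega) le_rfl
      ind_J' := fun P => ?_ }
  dsimp only
  rw [← charSpan_succ]
  exact hne P _ _ (by omega) (by omega)

end Tower

/-! ### Normalised homogeneous coordinates -/

section Characters

variable {k : Type u} [Field k] {p n : ℕ}

theorem scale_muUnits (R : Type u) [CommRing R] [Algebra k R] (g : MuPow k p n) (c : Fin n → ℤ) :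
    ((Shape.scale (muUnits R g) c : Rˣ) : R) =
      algebraMap k R ((Shape.scale (muUnits k g) c : kˣ) : k) := by
  have := Shape.map_scale (algebraMap k R : k →* R) (muUnits k g) c
  refine (congrArg Units.val ?_).trans (congrArg Units.val this.symm)
  congr 1

theorem scale_muUnits_eq_of_red_eq (g : MuPow k p n) {c c' : Fin n → ℤ}
    (h : red p c = red p c') : Shape.scale (muUnits k g) c = Shape.scale (muUnits k g) c' := by
  refine Finset.prod_congr rfl fun j _ => ?_
  have hj : ((c j : ℤ) : ZMod p) = (c' j : ℤ) := congrFun h j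
  obtain ⟨d, hd⟩ := (ZMod.intCast_eq_intCast_iff_dvd_sub _ _ _).1 hj
  rw [sub_eq_iff_eq_add.1 hd, zpow_add, zpow_mul, zpow_natCast, muUnits_pow, one_zpow, one_mul]

theorem scale_muUnits_eq_one (g : MuPow k p n) {c : Fin n → ℤ} (h : red p c = 0) :
    Shape.scale (muUnits k g) c = 1 := by
  rw [scale_muUnits_eq_of_red_eq g (h.trans (map_zero (red p)).symm), Shape.scale_zero]

theorem exists_scale_muUnits_ne_one [NeZero p] {ζ : k} (hζ : IsPrimitiveRoot ζ p) {c : Fin n → ℤ}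
    (h : red p c ≠ 0) : ∃ g : MuPow k p n, ((Shape.scale (muUnits k g) c : kˣ) : k) ≠ 1 := by
  obtain ⟨j, hj⟩ := Function.ne_iff.1 h
  refine ⟨Pi.mulSingle j (rootsOfUnity.mkOfPowEq ζ hζ.pow_eq_one), fun hc => hj ?_⟩
  have h1 : Shape.scale (muUnits k (Pi.mulSingle (M := fun _ => rootsOfUnity p k) j
      (rootsOfUnity.mkOfPowEq ζ hζ.pow_eq_one))) c =
      ((rootsOfUnity.mkOfPowEq ζ hζ.pow_eq_one : rootsOfUnity p k) : kˣ) ^ c j := by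
    rw [Shape.scale, Finset.prod_eq_single j]
    · simp [muUnits]
    · intro i _ hi
      simp [muUnits, hi]
    · simp
  rw [h1] at hc
  rw [Units.val_zpow_eq_zpow_val, rootsOfUnity.val_mkOfPowEq_coe] at hc
  exact (ZMod.intCast_zmod_eq_zero_iff_dvd _ _).2 ((hζ.zpow_eq_one_iff_dvd _).1 hc)

end Characters

namespace Locus

variable {k : Type u} [Field k] {p n : ℕ} {X : Shape n} (Z : Locus k p X)

/-- The point with given homogeneous coordinates. -/
def pt {R : Type u} [CommRing R] [IsLocalRing R] [Algebra k R] (x : Z.Coord R) :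
    Z.toGFunctor.pts R :=
  Quotient.mk (Z.setoid R) x

variable {Z} {R R' : Type u} [CommRing R] [IsLocalRing R] [Algebra k R]
  [CommRing R'] [IsLocalRing R'] [Algebra k R']

theorem pt_eq_pt {x y : Z.Coord R} :
    Z.pt x = Z.pt y ↔ ∃ lam : X.β → Rˣ, y.1 = X.act lam 1 x.1 :=
  ⟨fun h => Quotient.exact (s := Z.setoid R) h, fun h => Quotient.sound (s := Z.setoid R) h⟩

theorem exists_pt (a : Z.toGFunctor.pts R) : ∃ x, Z.pt x = a :=
  Quotient.exists_rep (s := Z.setoid R) a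

/-- The image of coordinates under a ring homomorphism. -/
def mapCoord (f : R →ₐ[k] R') (x : Z.Coord R) : Z.Coord R' :=
  ⟨fun i => f (x.1 i), X.isCoord_map (f : R →+* R') x.2.1, Z.eqn_map f x.1 x.2.2⟩

theorem map_pt (f : R →ₐ[k] R') (x : Z.Coord R) :
    Z.toGFunctor.map f (Z.pt x) = Z.pt (mapCoord f x) := rfl

theorem eq_of_pt_eq (hX : Shape.Unimodular.{u} X) (P : X.FixPt) {x y : Z.Coord R}
    (hx : ∀ b, x.1 (P.σ b) = 1) (hy : ∀ b, y.1 (P.σ b) = 1) (h : Z.pt x = Z.pt y) : x = y := by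
  obtain ⟨lam, hl⟩ := pt_eq_pt.1 h
  have h1 : lam = 1 := (hX Rˣ P.σ P.blk_σ 1).unique (fun b => by
    have h2 := congrFun hl (P.σ b)
    simp only [Shape.act, hx, hy, mul_one] at h2
    rw [← Units.val_one, Units.val_inj] at h2
    have h3 : Shape.scale (1 : Fin n → Rˣ) (X.chr (P.σ b)) = 1 := by simp [Shape.scale]
    rw [h3, mul_one] at h2
    exact h2.symm) (fun b => by simp)
  refine Subtype.ext ?_
  rw [hl, h1, X.act_one]

theorem exists_normalized (hX : Shape.Unimodular.{u} X) (P : X.FixPt) (x : Z.Coord R)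
    (hx : ∀ b, IsUnit (x.1 (P.σ b))) :
    ∃ y : Z.Coord R, Z.pt y = Z.pt x ∧ (∀ b, y.1 (P.σ b) = 1) ∧
      ∀ i, x.1 i = 0 ↔ y.1 i = 0 := by
  obtain ⟨lam, hl, -⟩ := hX Rˣ P.σ P.blk_σ fun b => (hx b).unit⁻¹
  refine ⟨⟨X.act lam 1 x.1, X.isCoord_act _ _ x.2.1, Z.eqn_act _ _ (fun _ => one_pow _) _ x.2.2⟩,
    (pt_eq_pt.2 ⟨lam, rfl⟩).symm, fun b => ?_, fun i => ?_⟩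
  · have h3 : Shape.scale (1 : Fin n → Rˣ) (X.chr (P.σ b)) = 1 := by simp [Shape.scale]
    have h4 : Shape.scale lam (X.wt (P.σ b)) = (hx b).unit⁻¹ := hl b
    change ((Shape.scale lam (X.wt (P.σ b)) * Shape.scale (1 : Fin n → Rˣ) (X.chr (P.σ b)) : Rˣ)
      : R) * x.1 (P.σ b) = 1
    rw [h3, mul_one, h4]
    exact (hx b).val_inv_mul
  · change _ ↔ (_ * _ : R) = 0
    rw [Units.mul_right_eq_zero]

/-- Points above a point with normalised coordinates have normalised coordinates. -/
theorem exists_normalized_of_map (hX : Shape.Unimodular.{u} X) (P : X.FixPt) (f : R →ₐ[k] R')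
    [IsLocalHom f] {z : Z.Coord R'} (hz : ∀ b, z.1 (P.σ b) = 1) {a : Z.toGFunctor.pts R}
    (ha : Z.toGFunctor.map f a = Z.pt z) :
    ∃ x : Z.Coord R, Z.pt x = a ∧ (∀ b, x.1 (P.σ b) = 1) ∧ ∀ i, f (x.1 i) = z.1 i := by
  obtain ⟨x, rfl⟩ := exists_pt a
  have hu : ∀ b, IsUnit (x.1 (P.σ b)) := fun b => by
    rw [map_pt] at ha
    obtain ⟨lam, hl⟩ := pt_eq_pt.1 ha
    have h2 := congrFun hl (P.σ b)
    rw [hz] at h2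
    exact isUnit_of_map_unit f _ (IsUnit.of_mul_eq_one_right _ h2.symm)
  obtain ⟨y, hy, hy1, -⟩ := exists_normalized hX P x hu
  refine ⟨y, hy, hy1, fun i => ?_⟩
  rw [← hy, map_pt] at ha
  have := eq_of_pt_eq hX P (fun b => by simp [mapCoord, hy1]) hz ha
  rw [← this]
  rfl

/-- The action of `μ_pⁿ` in coordinates normalised at `P`. -/
theorem exists_act_pt (P : X.FixPt) (g : MuPow k p n) (x : Z.Coord R) :
    ∃ y : Z.Coord R, Z.toGFunctor.act g (Z.pt x) = Z.pt y ∧ ∀ i, y.1 i =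
      algebraMap k R ((Shape.scale (muUnits k g) (P.coordChar i) : kˣ) : k) * x.1 i := by
  refine ⟨⟨X.act (fun b => (Shape.scale (muUnits R g) (P.D b))⁻¹) (muUnits R g) x.1,
    X.isCoord_act _ _ x.2.1, Z.eqn_act _ _ (muUnits_pow R g) x.1 x.2.2⟩, ?_, fun i => ?_⟩
  · refine pt_eq_pt.2 ⟨fun b => (Shape.scale (muUnits R g) (P.D b))⁻¹, ?_⟩
    change _ = X.act _ _ (X.act _ _ x.1)
    rw [X.act_act, mul_one, one_mul]
  · rw [← scale_muUnits]
    change ((_ * _ : Rˣ) : R) * _ = _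
    congr 2
    have h : ∀ (s : Finset X.β), ∏ b ∈ s, (Shape.scale (muUnits R g) (P.D b))⁻¹ ^ X.wt i b =
        (Shape.scale (muUnits R g) (∑ b ∈ s, X.wt i b • P.D b))⁻¹ := fun s => by
      classical
      induction s using Finset.induction_on with
      | empty => simp [Shape.scale_zero]
      | insert b s hb ih =>
        rw [Finset.prod_insert hb, Finset.sum_insert hb, Shape.scale_add, Shape.scale_smul, ih,
          mul_inv, inv_zpow]
    have h2 : Shape.scale (fun b => (Shape.scale (muUnits R g) (P.D b))⁻¹) (X.wt i) = _ :=
      h Finset.univ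
    rw [h2, inv_mul_eq_iff_eq_mul, ← Shape.scale_add, Shape.FixPt.coordChar, add_sub_cancel]

/-- A point of the locus is fixed by `μ_pⁿ` if and only if its normalised coordinates with a
nontrivial character vanish. -/
theorem pt_mem_fix_iff [NeZero p] {ζ : k} (hζ : IsPrimitiveRoot ζ p)
    (hX : Shape.Unimodular.{u} X) (P : X.FixPt) {L : Type u} [Field L] [Algebra k L]
    (x : Z.Coord L) (hx : ∀ b, x.1 (P.σ b) = 1) :
    Z.pt x ∈ Z.toGFunctor.Fix L ↔ ∀ i, red p (P.coordChar i) ≠ 0 → x.1 i = 0 := by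
  constructor
  · intro h i hi
    obtain ⟨g, hg⟩ := exists_scale_muUnits_ne_one hζ hi
    obtain ⟨y, hy, hy'⟩ := exists_act_pt P g x
    have hyx : y = x := by
      refine eq_of_pt_eq hX P (fun b => ?_) hx (hy.symm.trans (h g))
      rw [hy', P.coordChar_σ, Shape.scale_zero, hx]
      simp
    have h1 := hy' i
    rw [hyx] at h1
    by_contra h0
    refine hg ((algebraMap k L).injective ?_)
    rw [map_one]
    exact mul_right_cancel₀ h0 (h1.symm.trans (one_mul _).symm)
  · intro h g
    obtain ⟨y, hy, hy'⟩ := exists_act_pt P g x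
    rw [hy]
    congr 1
    refine Subtype.ext (funext fun i => ?_)
    rw [hy']
    by_cases hi : red p (P.coordChar i) = 0
    · rw [scale_muUnits_eq_one g hi]
      simp
    · rw [h i hi, mul_zero]

theorem exists_section_ne_zero {L : Type u} [Field L] [Algebra k L] (x : Z.Coord L) :
    ∃ σ : X.β → X.ι, (∀ b, X.blk (σ b) = b) ∧ ∀ b, x.1 (σ b) ≠ 0 := by
  choose σ h1 h2 using x.2.1
  exact ⟨σ, h1, fun b => (h2 b).ne_zero⟩

end Locus

/-! ### Varieties of a given shape with isolated fixed points -/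

namespace Shape.FixPt

variable {k : Type u} [Field k] {p n : ℕ} {X : Shape n}

theorem isCoord_point (P : X.FixPt) (R : Type u) [CommRing R] : X.IsCoord (P.point R) := fun b =>
  ⟨P.σ b, P.blk_σ b, by rw [P.point_σ]; exact isUnit_one⟩

/-- The coordinates of `P`. -/
noncomputable def coord (k : Type u) [Field k] (p : ℕ) (P : X.FixPt) (R : Type u) [CommRing R]
    [Algebra k R] : (Locus.univ k p X).Coord R :=
  ⟨P.point R, P.isCoord_point R, trivial⟩

/-- The fixed point `P` as a point with values in a local ring. -/
noncomputable def toPts (k : Type u) [Field k] (p : ℕ) (P : X.FixPt) (R : Type u) [CommRing R]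
    [IsLocalRing R] [Algebra k R] : (Locus.univ k p X).toGFunctor.pts R :=
  (Locus.univ k p X).pt (P.coord k p R)

theorem map_toPts (P : X.FixPt) {R R' : Type u} [CommRing R] [IsLocalRing R] [Algebra k R]
    [CommRing R'] [IsLocalRing R'] [Algebra k R'] (f : R →ₐ[k] R') :
    (Locus.univ k p X).toGFunctor.map f (P.toPts k p R) = P.toPts k p R' := by
  rw [toPts, Locus.map_pt, toPts]
  congr 1
  exact Subtype.ext (funext fun i => P.map_point (f : R →+* R') i)

theorem eq_of_point_support (hX : Shape.Unimodular.{0} X) {P Q : X.FixPt} (R : Type u) [CommRing R]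
    (h : ∀ b, Q.point R (P.σ b) ≠ 0) : P = Q := by
  refine eq_of_σ_eq hX (funext fun b => ?_)
  by_contra hb
  refine h b (Q.point_of_ne R fun h' => hb ?_)
  rw [P.blk_σ] at h'
  exact h'.symm

theorem toPts_injective (hX : Shape.Unimodular.{0} X) (L : Type u) [Field L] [Algebra k L] :
    Function.Injective fun P : X.FixPt => P.toPts k p L := by
  intro P Q h
  obtain ⟨lam, hl⟩ := Locus.pt_eq_pt.1 h
  refine eq_of_point_support hX L fun b => ?_
  have h1 : Q.point L (P.σ b) = _ * P.point L (P.σ b) := congrFun hl (P.σ b)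
  rw [h1, P.point_σ, mul_one]
  exact Units.ne_zero _

/-- Coordinates normalised at a regular fixed point `P`, of a point fixed by `μ_pⁿ`, are those
of `P`. -/
theorem Regular.eq_point {P : X.FixPt} (hP : P.Regular p) {R : Type u} [CommRing R]
    {x : X.ι → R} (hx : ∀ b, x (P.σ b) = 1)
    (h : ∀ i, red p (P.coordChar i) ≠ 0 → x i = 0) : x = P.point R := by
  funext i
  by_cases hi : P.σ (X.blk i) = i
  · rw [← hi, hx, P.point_σ]
  · rw [h i (hP i hi), P.point_of_ne R hi]

theorem fix_univ [NeZero p] {ζ : k} (hζ : IsPrimitiveRoot ζ p) (hX : Shape.Unimodular.{u} X)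
    (hX' : Shape.Unimodular.{0} X) (hreg : ∀ P : X.FixPt, P.Regular p) (L : Type u) [Field L]
    [Algebra k L] :
    (Locus.univ k p X).toGFunctor.Fix L = Set.range fun P : X.FixPt => P.toPts k p L := by
  ext a
  constructor
  · intro ha
    obtain ⟨x, rfl⟩ := Locus.exists_pt a
    obtain ⟨σ, h1, h2⟩ := Locus.exists_section_ne_zero x
    obtain ⟨P, rfl⟩ := exists_of_section hX' σ h1
    obtain ⟨y, hy, hy1, -⟩ := Locus.exists_normalized hX P x fun b => (h2 b).isUnit
    rw [← hy] at ha ⊢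
    refine ⟨P, ?_⟩
    have := (Locus.pt_mem_fix_iff hζ hX P y hy1).1 ha
    dsimp only
    rw [toPts]
    congr 1
    exact Subtype.ext ((hreg P).eq_point hy1 this).symm
  · rintro ⟨P, rfl⟩
    refine (Locus.pt_mem_fix_iff hζ hX P _ (P.point_σ L)).2 fun i hi => P.point_of_ne L fun h => ?_
    rw [← h, P.coordChar_σ, map_zero] at hi
    exact hi rfl

end Shape.FixPt

/-! ### Smoothness -/

theorem isLocalHom_of_surjective_algHom {k R R' : Type u} [Field k] [CommRing R] [IsLocalRing R]
    [Algebra k R] [CommRing R'] [Nontrivial R'] [Algebra k R'] (f : R →ₐ[k] R')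
    (hf : Function.Surjective f) : IsLocalHom f :=
  ⟨(IsLocalHom.of_surjective (f : R →+* R') hf).map_nonunit⟩

theorem GFunctor.smoothAt_univ {k : Type u} [Field k] {p n : ℕ} (X : Shape n) {L : Type u} [Field L]
    [Algebra k L] (x : (Locus.univ k p X).toGFunctor.pts L) :
    (Locus.univ k p X).toGFunctor.SmoothAt x := by
  intro A A' _ _ _ _ _ _ _ _ q r hq hr a ha
  obtain ⟨y, rfl⟩ := Locus.exists_pt a
  have := isLocalHom_of_surjective_algHom q hq
  choose s hs using hq
  refine ⟨(Locus.univ k p X).pt ⟨fun i => s (y.1 i), fun b => ?_, trivial⟩, ?_⟩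
  · obtain ⟨i, hi, hu⟩ := y.2.1 b
    exact ⟨i, hi, isUnit_of_map_unit q _ (by rwa [hs])⟩
  · rw [Locus.map_pt]
    congr 1
    exact Subtype.ext (funext fun i => hs _)

theorem GFunctor.SmoothAt.pow {k : Type u} [Field k] {G : Type u} [Group G] {X : GFunctor k G}
    {I : Type} {L : Type u} [Field L] [Algebra k L] {x : (X.pow I).pts L}
    (h : ∀ i, X.SmoothAt (x i)) : (X.pow I).SmoothAt x := by
  intro A A' _ _ _ _ _ _ _ _ q r hq hr a ha
  choose a' ha' using fun i => h i A A' q r hq hr (a i) (congrFun ha i)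
  exact ⟨a', funext ha'⟩

theorem GFunctor.SmoothAt.copies {k : Type u} [Field k] {G : Type u} [Group G] {X : GFunctor k G}
    {I : Type} {L : Type u} [Field L] [Algebra k L] {x : (X.copies I).pts L}
    (h : X.SmoothAt x.2) : (X.copies I).SmoothAt x := by
  intro A A' _ _ _ _ _ _ _ _ q r hq hr a ha
  obtain ⟨a', ha'⟩ := h A A' q r hq hr a.2 (congrArg Prod.snd ha)
  exact ⟨(a.1, a'), Prod.ext rfl ha'⟩

/-! ### Linear charts of tangent spaces -/

/-- A local `k`-algebra `R` that is a square-zero extension of the field `K`, with a splitting. -/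
structure Thickening (k : Type u) [Field k] (K : Type u) [Field K] [Algebra k K] (R : Type u)
    [CommRing R] [Algebra k R] where
  s : K →ₐ[k] R
  π : R →ₐ[k] K
  π_s : ∀ c, π (s c) = c
  sq : ∀ a b, π a = 0 → π b = 0 → a * b = 0

namespace Thickening

variable {k : Type u} [Field k] {K : Type u} [Field K] [Algebra k K] {R : Type u} [CommRing R]
  [IsLocalRing R] [Algebra k R]

theorem isLocalHom (T : Thickening k K R) : IsLocalHom T.π :=
  isLocalHom_of_surjective_algHom T.π fun c => ⟨T.s c, T.π_s c⟩

variable (k K)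

/-- The dual numbers `K[ε]`. -/
def dual : Thickening k K (DualNumber K) where
  s := TrivSqZeroExt.inlAlgHom k K K
  π := augmentation k K
  π_s c := TrivSqZeroExt.fst_inl K c
  sq a b ha hb := by
    have ha' : a.fst = 0 := ha
    have hb' : b.fst = 0 := hb
    ext <;> simp [ha', hb']

/-- The ring `K[ε₁, ε₂]`. -/
def dual₂ : Thickening k K (DualNumber₂ K) where
  s := TrivSqZeroExt.inlAlgHom k K (K × K)
  π := TrivSqZeroExt.fstHom k K (K × K)
  π_s c := TrivSqZeroExt.fst_inl (K × K) c
  sq a b ha hb := by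
    have ha' : a.fst = 0 := ha
    have hb' : b.fst = 0 := hb
    ext <;> simp [ha', hb']

end Thickening

/-- Linear coordinates `v m`, `m ∈ M`, in the tangent space of `X` at `x`, such that `g` acts on the
coordinate `v m` by the factor `χ g m`.  They are given on the points above `x` with values in any
split square-zero extension `R` of `K`, naturally in `R`; this determines the vector space
structure. -/
structure TangentChart {k : Type u} [Field k] {G : Type u} [Group G] (X : GFunctor k G)
    {K : Type u} [Field K] [Algebra k K] (x : X.pts K) (M : Type) (χ : G → M → k) where
  τ : ∀ {R : Type u} [CommRing R] [IsLocalRing R] [Algebra k R] (T : Thickening k K R)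
    (v : M → R), (∀ m, T.π (v m) = 0) → X.pts R
  inj : ∀ {R : Type u} [CommRing R] [IsLocalRing R] [Algebra k R] (T : Thickening k K R)
    (v w : M → R) (hv : ∀ m, T.π (v m) = 0) (hw : ∀ m, T.π (w m) = 0), τ T v hv = τ T w hw → v = w
  map_π : ∀ {R : Type u} [CommRing R] [IsLocalRing R] [Algebra k R] (T : Thickening k K R)
    (v : M → R) (hv : ∀ m, T.π (v m) = 0), X.map T.π (τ T v hv) = x
  surj : ∀ {R : Type u} [CommRing R] [IsLocalRing R] [Algebra k R] (T : Thickening k K R)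
    (a : X.pts R), X.map T.π a = x → ∃ v hv, τ T v hv = a
  nat : ∀ {R R' : Type u} [CommRing R] [IsLocalRing R] [Algebra k R] [CommRing R']
    [IsLocalRing R'] [Algebra k R'] (T : Thickening k K R) (T' : Thickening k K R')
    (f : R →ₐ[k] R') (_ : ∀ c, f (T.s c) = T'.s c) (v : M → R) (hv : ∀ m, T.π (v m) = 0)
    (hv' : ∀ m, T'.π (f (v m)) = 0), X.map f (τ T v hv) = τ T' (fun m => f (v m)) hv'
  act : ∀ {R : Type u} [CommRing R] [IsLocalRing R] [Algebra k R] (T : Thickening k K R) (g : G)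
    (v : M → R) (hv : ∀ m, T.π (v m) = 0) (hv' : ∀ m, T.π (algebraMap k R (χ g m) * v m) = 0),
    X.act g (τ T v hv) = τ T (fun m => algebraMap k R (χ g m) * v m) hv'

namespace TangentChart

variable {k : Type u} [Field k] {G : Type u} [Group G] {X Y : GFunctor k G} {K : Type u} [Field K]
  [Algebra k K]

theorem tangentIso {x : X.pts K} {y : Y.pts K} {M M' : Type} {χ : G → M → k} {χ' : G → M' → k}
    (c : TangentChart X x M χ) (c' : TangentChart Y y M' χ') (e : M' ≃ M)
    (he : ∀ g m, χ g (e m) = χ' g m) : GFunctor.TangentIso X Y x y := by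
  classical
  let T := Thickening.dual k K
  let T₂ := Thickening.dual₂ k K
  have hex : ∀ a ∈ X.tangent x, ∃ v hv, c.τ T v hv = a := fun a ha => c.surj T a ha
  -- the isomorphism, in terms of the linear coordinates
  let φ : X.pts (DualNumber K) → Y.pts (DualNumber K) := fun a =>
    if h : a ∈ X.tangent x then
      c'.τ T (fun m => (hex a h).choose (e m)) (fun m => (hex a h).choose_spec.choose (e m))
    else c'.τ T (fun _ => 0) fun _ => map_zero _
  have hφ : ∀ v hv, φ (c.τ T v hv) = c'.τ T (fun m => v (e m)) fun m => hv (e m) := fun v hv => by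
    have hm : c.τ T v hv ∈ X.tangent x := c.map_π T v hv
    have h1 : φ (c.τ T v hv) = _ := dif_pos hm
    have h2 := c.inj T _ _ _ _ (hex _ hm).choose_spec.choose_spec
    rw [h1]
    congr 1
    funext m
    exact congrFun h2 (e m)
  refine ⟨φ, ⟨?_, ?_, ?_⟩, ?_, ?_, ?_⟩
  · intro a ha
    obtain ⟨v, hv, rfl⟩ := hex a ha
    rw [hφ]
    exact c'.map_π T _ _
  · intro a ha b hb hab
    obtain ⟨v, hv, rfl⟩ := hex a ha
    obtain ⟨w, hw, rfl⟩ := hex b hb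
    rw [hφ, hφ] at hab
    have := c'.inj T _ _ _ _ hab
    congr 1
    funext m
    have h := congrFun this (e.symm m)
    simpa using h
  · intro b hb
    obtain ⟨w, hw, rfl⟩ := c'.surj T b hb
    refine ⟨c.τ T (fun m => w (e.symm m)) fun m => hw _, c.map_π T _ _, ?_⟩
    rw [hφ]
    congr 1
    funext m
    simp
  · intro a ha t
    obtain ⟨v, hv, rfl⟩ := hex a ha
    have hs : ∀ d, dilation k K t (T.s d) = T.s d := fun d => TrivSqZeroExt.map_inl _ d
    have hd : ∀ d, T.π (dilation k K t d) = T.π d := fun d => TrivSqZeroExt.fst_map _ d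
    rw [hφ, c.nat T T _ hs v hv fun m => (hd _).trans (hv m), hφ,
      c'.nat T T _ hs _ _ fun m => (hd _).trans (hv _)]
  · rintro v₁ h₁ v₂ h₂ v - ⟨z, rfl, rfl, rfl⟩
    have hs : ∀ s t d, specialization k K s t (T₂.s d) = T.s d := fun s t d =>
      TrivSqZeroExt.map_inl _ d
    have hd : ∀ s t d, T.π (specialization k K s t d) = T₂.π d := fun s t d =>
      TrivSqZeroExt.fst_map _ d
    have hz : X.map T₂.π z = x := by
      have h : T₂.π = T.π.comp (specialization k K 1 0) := AlgHom.ext fun d => (hd 1 0 d).symm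
      rw [h, X.map_comp]
      exact h₁
    obtain ⟨w, hw, rfl⟩ := c.surj T₂ z hz
    refine ⟨c'.τ T₂ (fun m => w (e m)) fun m => hw _, ?_, ?_, ?_⟩ <;>
    rw [c.nat T₂ T _ (hs _ _) w hw fun m => (hd _ _ _).trans (hw m), hφ,
      c'.nat T₂ T _ (hs _ _) _ _ fun m => (hd _ _ _).trans (hw _)]
  · intro a ha g
    obtain ⟨v, hv, rfl⟩ := hex a ha
    have h1 : ∀ m, T.π (algebraMap k (DualNumber K) (χ g m) * v m) = 0 := fun m => by
      rw [map_mul, hv, mul_zero]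
    have h2 : ∀ m, T.π (algebraMap k (DualNumber K) (χ' g m) * v (e m)) = 0 := fun m => by
      rw [map_mul, hv, mul_zero]
    rw [hφ, c.act T g v hv h1, hφ, c'.act T g _ _ h2]
    congr 1
    funext m
    rw [he]

/-- The tangent space of a product is the direct sum of the tangent spaces. -/
def pow {I : Type} {x : (X.pow I).pts K} {M : I → Type} {χ : ∀ i, G → M i → k}
    (c : ∀ i, TangentChart X (x i) (M i) (χ i)) :
    TangentChart (X.pow I) x (Σ i, M i) fun g m => χ m.1 g m.2 where
  τ T v hv i := (c i).τ T (fun m => v ⟨i, m⟩) fun m => hv _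
  inj T v w hv hw h := by
    funext ⟨i, m⟩
    exact congrFun ((c i).inj T _ _ _ _ (congrFun h i)) m
  map_π T v hv := funext fun i => (c i).map_π T _ _
  surj T a ha := by
    choose v hv hva using fun i => (c i).surj T (a i) (congrFun ha i)
    exact ⟨fun m => v m.1 m.2, fun m => hv m.1 m.2, funext hva⟩
  nat T T' f hf v hv hv' := funext fun i => (c i).nat T T' f hf _ _ fun m => hv' _
  act T g v hv hv' := funext fun i => (c i).act T g _ _ fun m => hv' ⟨i, m⟩

/-- The tangent space of a disjoint union of copies of `X`. -/
def copies {I : Type} {x : (X.copies I).pts K} {M : Type} {χ : G → M → k}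
    (c : TangentChart X x.2 M χ) : TangentChart (X.copies I) x M χ where
  τ T v hv := (x.1, c.τ T v hv)
  inj T v w hv hw h := c.inj T v w hv hw (congrArg Prod.snd h)
  map_π T v hv := Prod.ext rfl (c.map_π T v hv)
  surj T a ha := by
    obtain ⟨v, hv, h⟩ := c.surj T a.2 (congrArg Prod.snd ha)
    exact ⟨v, hv, Prod.ext (congrArg Prod.fst ha).symm h⟩
  nat T T' f hf v hv hv' := Prod.ext rfl (c.nat T T' f hf v hv hv')
  act T g v hv hv' := Prod.ext rfl (c.act T g v hv hv')

variable {p n : ℕ} {S : Shape n}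

open Classical in
/-- The tangent space of a locus at a point fixed by `μ_pⁿ`, if the locus is given, to first order
and in normalised coordinates, by the equations saying that the coordinates outside `M` are
constant. -/
noncomputable def ofLocus {Z : Locus k p S} (hS : Shape.Unimodular.{u} S) (P : S.FixPt)
    (z : Z.Coord K) (hz : ∀ b, z.1 (P.σ b) = 1)
    (hfix : ∀ i, red p (P.coordChar i) ≠ 0 → z.1 i = 0) (M : Set S.ι) (hM : ∀ b, P.σ b ∉ M)
    (heqn : ∀ {R : Type u} [CommRing R] [IsLocalRing R] [Algebra k R] (T : Thickening k K R)
      (x : S.ι → R), (∀ b, x (P.σ b) = 1) → (∀ i, T.π (x i) = z.1 i) →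
        (Z.eqn R x ↔ ∀ i, i ∉ M → x i = T.s (z.1 i))) :
    TangentChart Z.toGFunctor (Z.pt z) M fun g m =>
      ((Shape.scale (muUnits k g) (P.coordChar m) : kˣ) : k) := by
  let vec : ∀ {R : Type u} [CommRing R] [Algebra k R] (T : Thickening k K R) (v : M → R),
    S.ι → R := fun T v i => T.s (z.1 i) + if h : i ∈ M then v ⟨i, h⟩ else 0
  have vec_of_mem : ∀ {R : Type u} [CommRing R] [Algebra k R] (T : Thickening k K R) (v : M → R)
      (m : M), vec T v m = T.s (z.1 m) + v m := fun T v m =>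
    congrArg (T.s (z.1 m) + ·) (dif_pos m.2)
  have vec_of_notMem : ∀ {R : Type u} [CommRing R] [Algebra k R] (T : Thickening k K R)
      (v : M → R) (i : S.ι), i ∉ M → vec T v i = T.s (z.1 i) := fun T v i hi => by
    refine (congrArg (T.s (z.1 i) + ·) (dif_neg hi)).trans (add_zero _)
  have vec_σ : ∀ {R : Type u} [CommRing R] [Algebra k R] (T : Thickening k K R)
      (v : M → R) b, vec T v (P.σ b) = 1 := fun T v b => by
    rw [vec_of_notMem T v _ (hM b), hz, map_one]
  have π_vec : ∀ {R : Type u} [CommRing R] [Algebra k R] (T : Thickening k K R)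
      (v : M → R) (_ : ∀ m, T.π (v m) = 0) i, T.π (vec T v i) = z.1 i := fun T v hv i => by
    by_cases hi : i ∈ M
    · rw [vec_of_mem T v ⟨i, hi⟩, map_add, T.π_s, hv, add_zero]
    · rw [vec_of_notMem T v i hi, T.π_s]
  let crd : ∀ {R : Type u} [CommRing R] [IsLocalRing R] [Algebra k R] (T : Thickening k K R)
      (v : M → R) (_ : ∀ m, T.π (v m) = 0), Z.Coord R := fun T v hv =>
    ⟨vec T v, fun b => ⟨P.σ b, P.blk_σ b, by rw [vec_σ]; exact isUnit_one⟩,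
      (heqn T _ (vec_σ T v) (π_vec T v hv)).2 (vec_of_notMem T v)⟩
  exact
    { τ := fun T v hv => Z.pt (crd T v hv)
      inj := fun T v w hv hw h => by
        have h1 := Locus.eq_of_pt_eq hS P (vec_σ T v) (vec_σ T w) h
        funext m
        have h2 : vec T v m = vec T w m := congrFun (congrArg Subtype.val h1) m
        rw [vec_of_mem, vec_of_mem] at h2
        exact add_left_cancel h2
      map_π := fun T v hv => by
        rw [Locus.map_pt]
        congr 1
        exact Subtype.ext (funext (π_vec T v hv))
      surj := fun T a ha => by
        have := T.isLocalHom
        obtain ⟨x, hx, hx1, hxz⟩ := Locus.exists_normalized_of_map hS P T.π hz ha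
        have h0 : ∀ m : M, T.π (x.1 m - T.s (z.1 m)) = 0 := fun m => by
          rw [map_sub, hxz, T.π_s, sub_self]
        refine ⟨fun m => x.1 m - T.s (z.1 m), h0, ?_⟩
        rw [← hx]
        congr 1
        refine Subtype.ext (funext fun i => ?_)
        by_cases hi : i ∈ M
        · exact (vec_of_mem T (fun m => x.1 m - T.s (z.1 m)) ⟨i, hi⟩).trans
            (add_sub_cancel _ _)
        · exact (vec_of_notMem T (fun m => x.1 m - T.s (z.1 m)) i hi).trans
            ((heqn T x.1 hx1 hxz).1 x.2.2 i hi).symm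
      nat := fun T T' f hf v hv hv' => by
        rw [Locus.map_pt]
        congr 1
        refine Subtype.ext (funext fun i => ?_)
        change f (vec T v i) = vec T' (fun m => f (v m)) i
        by_cases hi : i ∈ M
        · rw [vec_of_mem T v ⟨i, hi⟩, vec_of_mem T' (fun m => f (v m)) ⟨i, hi⟩, map_add, hf]
        · rw [vec_of_notMem T v i hi, vec_of_notMem T' (fun m => f (v m)) i hi, hf]
      act := fun {R} _ _ _ T g v hv hv' => by
        obtain ⟨y, hy, hy'⟩ := Locus.exists_act_pt P g (crd T v hv)
        rw [hy]
        congr 1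
        refine Subtype.ext (funext fun i => ?_)
        rw [hy']
        have hc : algebraMap k R ((Shape.scale (muUnits k g) (P.coordChar i) : kˣ) : k) *
            T.s (z.1 i) = T.s (z.1 i) := by
          by_cases hi : red p (P.coordChar i) = 0
          · rw [scale_muUnits_eq_one g hi]
            simp
          · rw [hfix i hi, map_zero, mul_zero]
        let w : M → R := fun m =>
          algebraMap k R ((Shape.scale (muUnits k g) (P.coordChar m) : kˣ) : k) * v m
        change _ * vec T v i = vec T w i
        by_cases hi : i ∈ M
        · rw [vec_of_mem T v ⟨i, hi⟩, vec_of_mem T w ⟨i, hi⟩, mul_add, hc]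
        · rw [vec_of_notMem T v i hi, vec_of_notMem T w i hi, hc] }

/-- The tangent space at a fixed point of the torus. -/
noncomputable def ofFixPt (hS : Shape.Unimodular.{u} S) (P : S.FixPt) :
    TangentChart (Locus.univ k p S).toGFunctor (P.toPts k p K) {i | P.σ (S.blk i) ≠ i} fun g m =>
      ((Shape.scale (muUnits k g) (P.coordChar m) : kˣ) : k) :=
  ofLocus hS P (P.coord k p K) (P.point_σ K)
    (fun i hi => P.point_of_ne K fun h => hi (by rw [← h, P.coordChar_σ, map_zero]))
    _ (fun b h => h (by rw [P.blk_σ])) fun T x hx hx' => by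
      refine ⟨fun _ i hi => ?_, fun _ => trivial⟩
      have hi' : P.σ (S.blk i) = i := not_not.1 hi
      have h1 : (P.coord k p K).1 i = 1 := by
        rw [← hi']
        exact P.point_σ K _
      rw [h1, map_one, ← hi', hx]

end TangentChart

/-! ### Generic `p`-th powers -/

section Generic

open MvPolynomial

variable {k E : Type u} [Field k] [Field E] [Algebra k E] {p : ℕ}

/-- The nodes `ζ^i ε`, i.e. the `p`-th roots of `ε ^ p`, are distinct. -/
theorem rootNode_injective {K : Type*} [Field K] {ζ ε : K} (hζ : IsPrimitiveRoot ζ p)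
    (hε : ε ≠ 0) : Function.Injective fun i : Fin p => ζ ^ (i : ℕ) * ε := fun i j h =>
  Fin.ext (hζ.pow_inj i.2 j.2 (mul_right_cancel₀ hε h))

theorem exists_rootNode_eq {K : Type*} [Field K] [NeZero p] {ζ ε θ : K} (hζ : IsPrimitiveRoot ζ p)
    (hε : ε ≠ 0) (hθ : θ ^ p = ε ^ p) : ∃ i : Fin p, ζ ^ (i : ℕ) * ε = θ := by
  obtain ⟨i, hi, h⟩ := hζ.eq_pow_of_pow_eq_one (ξ := θ / ε) (by
    rw [div_pow, hθ, div_self (pow_ne_zero _ hε)])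
  exact ⟨⟨i, hi⟩, by simp only [h, div_mul_cancel₀ _ hε]⟩

theorem rootNode_pow {K : Type*} [Field K] {ζ ε : K} (hζ : IsPrimitiveRoot ζ p) (i : ℕ) :
    (ζ ^ i * ε) ^ p = ε ^ p := by
  rw [mul_pow, ← pow_mul, mul_comm i, pow_mul, hζ.pow_eq_one, one_pow, one_mul]

/-- The matrix of the values at the nodes `ζ^i ε` of the monomials of degree less than `p`. -/
abbrev nodeMatrix (ζ : k) (ε : E) (p : ℕ) : Matrix (Fin p) (Fin p) E :=
  Matrix.vandermonde fun i : Fin p => algebraMap k E ζ ^ (i : ℕ) * ε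

variable {ζ : k} {ε : E}

theorem nodeMatrix_isUnit (hζ : IsPrimitiveRoot ζ p) (hε : ε ≠ 0) :
    IsUnit (nodeMatrix ζ ε p).det :=
  isUnit_iff_ne_zero.2 (Matrix.det_vandermonde_ne_zero_iff.2
    (rootNode_injective (hζ.map_of_injective (algebraMap k E).injective) hε))

/-- The value at the node `ζ^i ε` of the generic polynomial of degree less than `p`. -/
noncomputable def genericValue (ζ : k) (ε : E) (p : ℕ) (i : Fin p) : MvPolynomial (Fin p) E :=
  ∑ j, C (nodeMatrix ζ ε p i j) * X j

/-- The coefficients of the polynomial of degree less than `p` whose values at the nodes are the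
`p`-th powers of those of the generic polynomial. -/
noncomputable def genericPower (ζ : k) (ε : E) (p : ℕ) (l : Fin p) : MvPolynomial (Fin p) E :=
  ∑ i, C ((nodeMatrix ζ ε p)⁻¹ l i) * genericValue ζ ε p i ^ p

theorem sum_nodeMatrix_genericPower (hζ : IsPrimitiveRoot ζ p) (hε : ε ≠ 0) (i : Fin p) :
    ∑ l, C (nodeMatrix ζ ε p i l) * genericPower ζ ε p l = genericValue ζ ε p i ^ p := by
  have h := Matrix.mul_nonsing_inv _ (nodeMatrix_isUnit hζ hε)
  simp only [genericPower, Finset.mul_sum, ← mul_assoc, ← C_mul]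
  rw [Finset.sum_comm]
  simp only [← Finset.sum_mul, ← map_sum]
  have h' : ∀ j, ∑ l, nodeMatrix ζ ε p i l * (nodeMatrix ζ ε p)⁻¹ l j = if i = j then 1 else 0 :=
    fun j => by rw [← Matrix.mul_apply, h, Matrix.one_apply]
  rw [Finset.sum_congr rfl fun j _ => by rw [h']]
  simp

theorem sum_inv_nodeMatrix_genericValue (hζ : IsPrimitiveRoot ζ p) (hε : ε ≠ 0) (j : Fin p) :
    ∑ i, C ((nodeMatrix ζ ε p)⁻¹ j i) * genericValue ζ ε p i = X j := by
  have h := Matrix.nonsing_inv_mul _ (nodeMatrix_isUnit hζ hε)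
  simp only [genericValue, Finset.mul_sum, ← mul_assoc, ← C_mul]
  rw [Finset.sum_comm]
  simp only [← Finset.sum_mul, ← map_sum]
  have h' : ∀ l, ∑ i, (nodeMatrix ζ ε p)⁻¹ j i * nodeMatrix ζ ε p i l = if j = l then 1 else 0 :=
    fun l => by rw [← Matrix.mul_apply, h, Matrix.one_apply]
  rw [Finset.sum_congr rfl fun j _ => by rw [h']]
  simp

theorem genericValue_ne_zero [NeZero p] (i : Fin p) : genericValue ζ ε p i ≠ 0 := by
  intro h
  have h1 := congrArg (MvPolynomial.eval (Pi.single (0 : Fin p) (1 : E))) h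
  simp [genericValue, Pi.single_apply] at h1

/-- The map `v ↦ v ^ p`, in the coordinates given by the powers of `ε`. -/
noncomputable def powerMap (ζ : k) (ε : E) (p : ℕ) :
    MvPolynomial (Fin p) k →ₐ[k] MvPolynomial (Fin p) E :=
  aeval (genericPower ζ ε p)

/-- The map `v ↦ v ^ p` is finite. -/
theorem powerMap_isIntegral [FiniteDimensional k E] (hp : 0 < p) (hζ : IsPrimitiveRoot ζ p)
    (hε : ε ≠ 0) : (powerMap ζ ε p : MvPolynomial (Fin p) k →+* MvPolynomial (Fin p) E).IsIntegral
    := by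
  let : Algebra (MvPolynomial (Fin p) k) (MvPolynomial (Fin p) E) :=
    (powerMap ζ ε p : MvPolynomial (Fin p) k →+* MvPolynomial (Fin p) E).toAlgebra
  have : IsScalarTower k (MvPolynomial (Fin p) k) (MvPolynomial (Fin p) E) :=
    IsScalarTower.of_algebraMap_eq fun x => ((powerMap ζ ε p).commutes x).symm
  intro s
  change IsIntegral (MvPolynomial (Fin p) k) s
  have hC : ∀ x : E, IsIntegral (MvPolynomial (Fin p) k) (C x : MvPolynomial (Fin p) E) := fun x =>
    ((Algebra.IsIntegral.isIntegral (R := k) x).map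
      (IsScalarTower.toAlgHom k E (MvPolynomial (Fin p) E))).tower_top
  have hW : ∀ l, IsIntegral (MvPolynomial (Fin p) k) (genericPower ζ ε p l) := fun l => by
    have h : algebraMap (MvPolynomial (Fin p) k) (MvPolynomial (Fin p) E) (X l) =
        genericPower ζ ε p l := aeval_X _ l
    rw [← h]
    exact isIntegral_algebraMap
  have hV : ∀ i, IsIntegral (MvPolynomial (Fin p) k) (genericValue ζ ε p i) := fun i => by
    refine IsIntegral.of_pow hp ?_
    rw [← sum_nodeMatrix_genericPower hζ hε]
    exact IsIntegral.sum _ fun l _ => (hC _).mul (hW l)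
  induction s using MvPolynomial.induction_on with
  | C x => exact hC x
  | add a b ha hb => exact ha.add hb
  | mul_X a j ha =>
    refine ha.mul ?_
    rw [← sum_inv_nodeMatrix_genericValue hζ hε]
    exact IsIntegral.sum _ fun i _ => (hC _).mul (hV i)

/-- The coefficients of `y ∏ (T + x_i)` for generic `y` and `x_i`. -/
noncomputable def genericProduct (E : Type u) [Field E] (p : ℕ) :
    Polynomial (MvPolynomial (Option (Fin (p - 1))) E) :=
  Polynomial.C (X none) * ∏ i, (Polynomial.X + Polynomial.C (X (some i)))

theorem natDegree_C_mul_prod_le {R : Type*} [CommRing R] {m : ℕ} (y : R) (x : Fin m → R) :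
    (Polynomial.C y * ∏ i, (Polynomial.X + Polynomial.C (x i))).natDegree ≤ m := by
  refine (Polynomial.natDegree_C_mul_le _ _).trans ?_
  refine (Polynomial.natDegree_prod_le _ _).trans ?_
  refine (Finset.sum_le_card_nsmul _ _ 1 fun i _ => ?_).trans (by simp)
  exact (Polynomial.natDegree_add_le _ _).trans (by simp [Polynomial.natDegree_X_le])

theorem coeff_C_mul_prod {R : Type*} [CommRing R] {m : ℕ} (y : R) (x : Fin m → R) :
    (Polynomial.C y * ∏ i, (Polynomial.X + Polynomial.C (x i))).coeff m = y := by
  rcases subsingleton_or_nontrivial R with h | h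
  · exact Subsingleton.elim _ _
  have hm : (∏ i, (Polynomial.X + Polynomial.C (x i))).Monic :=
    Polynomial.monic_prod_of_monic _ _ fun i _ => Polynomial.monic_X_add_C _
  have hd : (∏ i, (Polynomial.X + Polynomial.C (x i))).natDegree = m := by
    rw [Polynomial.natDegree_prod_of_monic _ _ fun i _ => Polynomial.monic_X_add_C _]
    simp
  rw [Polynomial.coeff_C_mul]
  have := hm.coeff_natDegree
  rw [hd] at this
  rw [this, mul_one]

/-- The map sending a scalar and `p - 1` linear factors to the coefficients of their product. -/
noncomputable def productMap (E : Type u) [Field E] (p : ℕ) :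
    MvPolynomial (Fin p) E →ₐ[E] MvPolynomial (Option (Fin (p - 1))) E :=
  aeval fun j : Fin p => (genericProduct E p).coeff j

/-- A polynomial splits into linear factors in finitely many ways. -/
theorem productMap_isAlgebraic (E : Type u) [Field E] (hp : 0 < p)
    (s : MvPolynomial (Option (Fin (p - 1))) E) :
    letI := (productMap E p : MvPolynomial (Fin p) E →+*
      MvPolynomial (Option (Fin (p - 1))) E).toAlgebra
    IsAlgebraic (MvPolynomial (Fin p) E) s := by
  let := (productMap E p : MvPolynomial (Fin p) E →+*
      MvPolynomial (Option (Fin (p - 1))) E).toAlgebra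
  have hmap : ∀ j : Fin p, algebraMap (MvPolynomial (Fin p) E)
      (MvPolynomial (Option (Fin (p - 1))) E) (X j) = (genericProduct E p).coeff j :=
    fun j => aeval_X _ j
  have hdeg : (genericProduct E p).natDegree < p :=
    (natDegree_C_mul_prod_le _ _).trans_lt (by omega)
  change IsAlgebraic (MvPolynomial (Fin p) E) s
  induction s using MvPolynomial.induction_on with
  | C x =>
    have h : (C x : MvPolynomial (Option (Fin (p - 1))) E) =
        algebraMap (MvPolynomial (Fin p) E) _ (C x) := ((productMap E p).commutes x).symm
    rw [h]
    exact isAlgebraic_algebraMap _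
  | add a b ha hb => exact ha.add hb
  | mul_X a j ha =>
    refine ha.mul ?_
    rcases j with _ | i
    · have h := hmap ⟨p - 1, by omega⟩
      rw [genericProduct, coeff_C_mul_prod] at h
      rw [← h]
      exact isAlgebraic_algebraMap _
    · -- `-x_i` is a root of the polynomial whose coefficients are the coordinates
      rw [← neg_neg (X (some i))]
      refine IsAlgebraic.neg ?_
      refine ⟨∑ j : Fin p, Polynomial.C (X j) * Polynomial.X ^ (j : ℕ), fun h => ?_, ?_⟩
      · have h1 := congrArg (fun q => Polynomial.coeff q 0) h
        simp only [Polynomial.finsetSum_coeff, Polynomial.coeff_C_mul_X_pow,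
          Polynomial.coeff_zero] at h1
        rw [Finset.sum_eq_single ⟨0, hp⟩] at h1
        · simp at h1
        · intro b _ hb
          rw [if_neg fun h0 => hb (Fin.ext h0.symm)]
        · simp
      · simp only [map_sum, map_mul, map_pow, Polynomial.aeval_C, Polynomial.aeval_X, hmap]
        have h := Polynomial.eval_eq_sum_range' hdeg (-X (some i))
        rw [Finset.sum_range] at h
        rw [← h, genericProduct, Polynomial.eval_mul, Polynomial.eval_prod,
          Finset.prod_eq_zero (Finset.mem_univ i), mul_zero]
        simp

/-- If `g` is a nonzero polynomial function of `v`, then `g(v) ≠ 0` for all `v` whose `p`-th power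
is generic. -/
theorem exists_dvd_powerMap [FiniteDimensional k E] (hp : 0 < p)
    (hζ : IsPrimitiveRoot ζ p) (hε : ε ≠ 0)
    (g : MvPolynomial (Fin p) E) (hg : g ≠ 0) :
    ∃ r : MvPolynomial (Fin p) k, r ≠ 0 ∧ g ∣ powerMap ζ ε p r := by
  let : Algebra (MvPolynomial (Fin p) k) (MvPolynomial (Fin p) E) :=
    (powerMap ζ ε p : MvPolynomial (Fin p) k →+* MvPolynomial (Fin p) E).toAlgebra
  have : IsIntegral (MvPolynomial (Fin p) k) g := powerMap_isIntegral hp hζ hε g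
  exact this.isAlgebraic.exists_nonzero_dvd (mem_nonZeroDivisors_of_ne_zero hg)

theorem exists_dvd_productMap_powerMap [FiniteDimensional k E] (hp : 0 < p)
    (hζ : IsPrimitiveRoot ζ p) (hε : ε ≠ 0)
    (g : MvPolynomial (Option (Fin (p - 1))) E) (hg : g ≠ 0) :
    ∃ r : MvPolynomial (Fin p) k, r ≠ 0 ∧ g ∣ productMap E p (powerMap ζ ε p r) := by
  let : Algebra (MvPolynomial (Fin p) k) (MvPolynomial (Fin p) E) :=
    (powerMap ζ ε p : MvPolynomial (Fin p) k →+* MvPolynomial (Fin p) E).toAlgebra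
  let := (productMap E p : MvPolynomial (Fin p) E →+*
      MvPolynomial (Option (Fin (p - 1))) E).toAlgebra
  let : Algebra (MvPolynomial (Fin p) k) (MvPolynomial (Option (Fin (p - 1))) E) :=
    ((algebraMap (MvPolynomial (Fin p) E) (MvPolynomial (Option (Fin (p - 1))) E)).comp
      (algebraMap (MvPolynomial (Fin p) k) (MvPolynomial (Fin p) E))).toAlgebra
  have : IsScalarTower (MvPolynomial (Fin p) k) (MvPolynomial (Fin p) E)
      (MvPolynomial (Option (Fin (p - 1))) E) := IsScalarTower.of_algebraMap_eq fun _ => rfl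
  have : Algebra.IsAlgebraic (MvPolynomial (Fin p) k) (MvPolynomial (Fin p) E) :=
    ⟨fun s => (show IsIntegral _ s from powerMap_isIntegral hp hζ hε s).isAlgebraic⟩
  have : Algebra.IsAlgebraic (MvPolynomial (Fin p) E) (MvPolynomial (Option (Fin (p - 1))) E) :=
    ⟨productMap_isAlgebraic E hp⟩
  have := (Algebra.IsAlgebraic.trans (MvPolynomial (Fin p) k) (MvPolynomial (Fin p) E)
    (MvPolynomial (Option (Fin (p - 1))) E)).isAlgebraic g
  exact this.exists_nonzero_dvd (mem_nonZeroDivisors_of_ne_zero hg)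

/-- For generic `w`, every `v` with `v ^ p = w` is a unit of `E`, and a polynomial of degree exactly
`p - 1` in `ε` without multiple roots. -/
theorem exists_generic [FiniteDimensional k E] (hp : 0 < p)
    (hζ : IsPrimitiveRoot ζ p) (hε : ε ≠ 0) :
    ∃ f : MvPolynomial (Fin p) k, f ≠ 0 ∧ ∀ (L : Type u) [Field L] [Algebra k L] [IsAlgClosed L]
      (c : Fin p → L), MvPolynomial.aeval c f ≠ 0 → ∀ (e : k), ε ^ p = algebraMap k E e →
      ∀ v : Polynomial L, v.natDegree < p →
      (∀ θ : L, θ ^ p = algebraMap k L e → v.eval θ ^ p = ∑ i, c i * θ ^ (i : ℕ)) →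
      v.coeff (p - 1) ≠ 0 ∧ (∀ θ : L, θ ^ p = algebraMap k L e → v.eval θ ≠ 0) ∧
      ∀ (y : L) (x : Fin (p - 1) → L),
        v = Polynomial.C y * ∏ i, (Polynomial.X + Polynomial.C (x i)) → Function.Injective x := by
  have : NeZero p := ⟨hp.ne'⟩
  classical
  obtain ⟨r₁, hr₁, hd₁⟩ := exists_dvd_powerMap hp hζ hε
    (X ⟨p - 1, by omega⟩ * ∏ i, genericValue ζ ε p i)
    (mul_ne_zero (X_ne_zero _) (Finset.prod_ne_zero_iff.2 fun i _ => genericValue_ne_zero i))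
  obtain ⟨r₂, hr₂, hd₂⟩ := exists_dvd_productMap_powerMap hp hζ hε
    (∏ i : Fin (p - 1), ∏ j ∈ Finset.univ.erase i, (X (some i) - X (some j)))
    (Finset.prod_ne_zero_iff.2 fun i _ => Finset.prod_ne_zero_iff.2 fun j hj => sub_ne_zero.2
      fun h => (Finset.ne_of_mem_erase hj) (Option.some_injective _ (X_injective h)).symm)
  refine ⟨r₁ * r₂, mul_ne_zero hr₁ hr₂, fun L _ _ _ c hc e he v hdeg hv => ?_⟩
  rw [map_mul] at hc
  have hc₁ := left_ne_zero_of_mul hc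
  have hc₂ := right_ne_zero_of_mul hc
  let ι : E →ₐ[k] L := IsAlgClosed.lift
  have hζL : IsPrimitiveRoot (algebraMap k L ζ) p := hζ.map_of_injective (algebraMap k L).injective
  have hεL : ι ε ≠ 0 := (map_ne_zero ι).2 hε
  have hεp : ι ε ^ p = algebraMap k L e := by rw [← map_pow, he, ι.commutes]
  have hnode : ∀ i j : Fin p, ι (nodeMatrix ζ ε p i j) =
      (algebraMap k L ζ ^ (i : ℕ) * ι ε) ^ (j : ℕ) := fun i j => by
    simp
  let ev : MvPolynomial (Fin p) E →+* L := eval₂Hom (ι : E →+* L) fun j => v.coeff j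
  have hevC : ∀ a, ev (C a) = ι a := fun a => eval₂_C _ _ _
  have hevX : ∀ j, ev (X j) = v.coeff j := fun j => eval₂_X _ _ _
  have hvalue : ∀ i, ev (genericValue ζ ε p i) = v.eval (algebraMap k L ζ ^ (i : ℕ) * ι ε) :=
    fun i => by
      rw [Polynomial.eval_eq_sum_range' hdeg, Finset.sum_range, genericValue, map_sum]
      refine Finset.sum_congr rfl fun j _ => ?_
      rw [map_mul, hevC, hevX, hnode, mul_comm]
  have hpower : ∀ l, ev (genericPower ζ ε p l) = c l := fun l => by
    have h1 : ∀ i, ev (genericValue ζ ε p i ^ p) =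
        ∑ j, ι (nodeMatrix ζ ε p i j) * c j := fun i => by
      rw [map_pow, hvalue, hv _ (by rw [rootNode_pow hζL, hεp])]
      exact Finset.sum_congr rfl fun j _ => by rw [hnode, mul_comm]
    have h := Matrix.nonsing_inv_mul _ (nodeMatrix_isUnit hζ hε)
    have h' : ∀ j, ∑ i, ι ((nodeMatrix ζ ε p)⁻¹ l i) * ι (nodeMatrix ζ ε p i j) =
        if l = j then 1 else 0 := fun j => by
      simp only [← map_mul, ← map_sum]
      rw [← Matrix.mul_apply, h, Matrix.one_apply]
      split_ifs <;> simp
    simp only [genericPower, map_sum, map_mul, hevC, h1, Finset.mul_sum, ← mul_assoc]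
    rw [Finset.sum_comm]
    simp only [← Finset.sum_mul, h']
    simp
  have hpowerMap : ∀ r, ev (powerMap ζ ε p r) = MvPolynomial.aeval c r := fun r => by
    induction r using MvPolynomial.induction_on with
    | C a =>
      have : powerMap ζ ε p (C a) = C (algebraMap k E a) := (powerMap ζ ε p).commutes a
      rw [this, hevC, ι.commutes]
      simp
    | add a b ha hb => simp only [map_add, ha, hb]
    | mul_X a j ha =>
      have : powerMap ζ ε p (X j) = genericPower ζ ε p j := aeval_X _ j
      simp only [map_mul, ha, this, hpower, aeval_X]
  have hg₁ : ev (X ⟨p - 1, by omega⟩ * ∏ i, genericValue ζ ε p i) ≠ 0 := by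
    obtain ⟨q, hq⟩ := hd₁
    have h := hpowerMap r₁
    rw [hq, map_mul] at h
    rw [← h] at hc₁
    exact left_ne_zero_of_mul hc₁
  rw [map_mul, map_prod, hevX] at hg₁
  refine ⟨left_ne_zero_of_mul hg₁, fun θ hθ => ?_, fun y x hyx => ?_⟩
  · obtain ⟨i, rfl⟩ := exists_rootNode_eq hζL hεL (hθ.trans hεp.symm)
    rw [← hvalue]
    exact Finset.prod_ne_zero_iff.1 (right_ne_zero_of_mul hg₁) i (Finset.mem_univ i)
  · let ev₂ : MvPolynomial (Option (Fin (p - 1))) E →+* L :=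
      eval₂Hom (ι : E →+* L) fun o => o.elim y x
    have hev₂X : ∀ o, ev₂ (X o) = o.elim y x := fun o => eval₂_X _ _ _
    have hprod : (genericProduct E p).map ev₂ = v := by
      rw [hyx, genericProduct, Polynomial.map_mul, Polynomial.map_prod, Polynomial.map_C, hev₂X]
      simp only [Polynomial.map_add, Polynomial.map_X, Polynomial.map_C, hev₂X]
      rfl
    have hcomp : ∀ s, ev₂ (productMap E p s) = ev s := fun s => by
      induction s using MvPolynomial.induction_on with
      | C a =>
        have : productMap E p (C a) = C a := (productMap E p).commutes a
        rw [this, hevC]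
        exact eval₂_C _ _ _
      | add a b ha hb => simp only [map_add, ha, hb]
      | mul_X a j ha =>
        have : productMap E p (X j) = (genericProduct E p).coeff j := aeval_X _ j
        rw [map_mul, map_mul, map_mul, ha, this, hevX, ← Polynomial.coeff_map, hprod]
    have hg₂ : ev₂
        (∏ i : Fin (p - 1), ∏ j ∈ Finset.univ.erase i, (X (some i) - X (some j))) ≠ 0 := by
      obtain ⟨q, hq⟩ := hd₂
      have h := (hcomp _).trans (hpowerMap r₂)
      rw [hq, map_mul] at h
      rw [← h] at hc₂
      exact left_ne_zero_of_mul hc₂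
    intro i j hij
    by_contra hne
    refine hg₂ ?_
    rw [map_prod, Finset.prod_eq_zero (Finset.mem_univ i)]
    rw [map_prod, Finset.prod_eq_zero (Finset.mem_erase.2 ⟨Ne.symm hne, Finset.mem_univ j⟩)]
    rw [map_sub, hev₂X, hev₂X]
    simp [hij]

end Generic

/-! ### Kummer extensions after base change -/

/-- `A` is the algebra `F[ε]/(ε ^ p - e)`: it has the basis `1, ε, …, ε ^ (p - 1)`, and `ε` can be
mapped to every `p`-th root of `e`. -/
structure IsKummer (F : Type u) [Field F] (A : Type u) [CommRing A] [Algebra F A] (p : ℕ) (ε : A)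
    (e : F) : Prop where
  basis : ∃ b : Module.Basis (Fin p) F A, ∀ i, b i = ε ^ (i : ℕ)
  hom : ∀ (R : Type u) [CommRing R] [Algebra F R] (θ : R), θ ^ p = algebraMap F R e →
    ∃ φ : A →ₐ[F] R, φ ε = θ

namespace IsKummer

theorem of_field {k E : Type u} [Field k] [Field E] [Algebra k E] {p : ℕ} (hp : 0 < p) {e : k}
    {ε : E} (hε : ε ^ p = algebraMap k E e) (hgen : IntermediateField.adjoin k {ε} = ⊤)
    (hdeg : Module.finrank k E = p) (F : Type u) [Field F] [Algebra k F] :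
    IsKummer F (F ⊗[k] E) p ((1 : F) ⊗ₜ[k] ε) (algebraMap k F e) := by
  have : FiniteDimensional k E := FiniteDimensional.of_finrank_pos (hdeg ▸ hp)
  have hint : IsIntegral k ε := Algebra.IsIntegral.isIntegral ε
  have hadj : Algebra.adjoin k {ε} = ⊤ := by
    rw [← IntermediateField.adjoin_simple_toSubalgebra_of_isAlgebraic hint.isAlgebraic, hgen,
      IntermediateField.top_toSubalgebra]
  let pb : PowerBasis k E := PowerBasis.ofAdjoinEqTop hint hadj
  have hpg : pb.gen = ε := PowerBasis.ofAdjoinEqTop_gen hint hadj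
  have hdim : pb.dim = p := by rw [← hdeg, pb.finrank]
  have hmin : minpoly k ε = Polynomial.X ^ p - Polynomial.C e := by
    have hd : (minpoly k ε).natDegree = p := by rw [← hpg, pb.natDegree_minpoly, hdim]
    refine (Polynomial.eq_of_monic_of_dvd_of_natDegree_le (minpoly.monic hint)
      (Polynomial.monic_X_pow_sub_C e hp.ne') (minpoly.dvd k ε (by simp [hε])) ?_).symm
    rw [hd, Polynomial.natDegree_X_pow_sub_C]
  refine ⟨⟨(Algebra.TensorProduct.basis F pb.basis).reindex (finCongr hdim), fun i => ?_⟩, ?_⟩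
  · simp [hpg]
  · intro R _ _ θ hθ
    let : Algebra k R := ((algebraMap F R).comp (algebraMap k F)).toAlgebra
    have : IsScalarTower k F R := IsScalarTower.of_algebraMap_eq fun _ => rfl
    let φ : E →ₐ[k] R := pb.lift θ (by
      rw [hpg, hmin]
      simp [hθ, IsScalarTower.algebraMap_apply k F R])
    refine ⟨Algebra.TensorProduct.lift (Algebra.ofId F R) φ fun _ _ => Commute.all _ _, ?_⟩
    rw [Algebra.TensorProduct.lift_tmul, map_one, one_mul, ← hpg]
    exact pb.lift_gen _ _

variable {F : Type u} [Field F] {A : Type u} [CommRing A] [Algebra F A] {p : ℕ} {ε : A} {e : F}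
  (R : Type u) [CommRing R] [Algebra F R]

open Polynomial

/-- The value of a polynomial at `ε`, in the base change of `A` to `R`. -/
noncomputable abbrev ev (F : Type u) [Field F] {A : Type u} [CommRing A] [Algebra F A] (ε : A)
    (R : Type u) [CommRing R] [Algebra F R] : R[X] →ₐ[R] R ⊗[F] A :=
  aeval ((1 : R) ⊗ₜ[F] ε)

theorem exists_basis (h : IsKummer F A p ε e) : ∃ b : Module.Basis (Fin p) R (R ⊗[F] A),
    ∀ i, b i = ((1 : R) ⊗ₜ[F] ε) ^ (i : ℕ) := by
  obtain ⟨b, hb⟩ := h.basis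
  refine ⟨Algebra.TensorProduct.basis R b, fun i => ?_⟩
  rw [Algebra.TensorProduct.basis_apply, hb, Algebra.TensorProduct.tmul_pow, one_pow]

variable {R}

theorem eq_zero_of_ev_eq_zero (h : IsKummer F A p ε e) {q : R[X]} (hq : q.natDegree < p)
    (h0 : ev F ε R q = 0) : q = 0 := by
  obtain ⟨b, hb⟩ := h.exists_basis R
  rw [aeval_eq_sum_range' hq, Finset.sum_range] at h0
  simp only [← hb] at h0
  have := Fintype.linearIndependent_iff.1 b.linearIndependent _ h0
  ext i
  by_cases hi : i < p
  · exact this ⟨i, hi⟩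
  · rw [coeff_eq_zero_of_natDegree_lt (by omega), coeff_zero]

theorem exists_ev_eq (h : IsKummer F A p ε e) (hp : 0 < p) (s : R ⊗[F] A) :
    ∃ q : R[X], q.natDegree < p ∧ ev F ε R q = s := by
  obtain ⟨b, hb⟩ := h.exists_basis R
  refine ⟨∑ i : Fin p, C (b.repr s i) * X ^ (i : ℕ), ?_, ?_⟩
  · refine (natDegree_sum_le_of_forall_le _ _ (n := p - 1) fun i _ => ?_).trans_lt (by omega)
    exact (natDegree_C_mul_X_pow_le _ _).trans (by omega)
  · rw [map_sum]
    conv_rhs => rw [← b.sum_repr s]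
    refine Finset.sum_congr rfl fun i _ => ?_
    rw [map_mul, map_pow, aeval_C, aeval_X, hb, Algebra.smul_def]

/-- Elements of an extended ideal are polynomials in `ε` with coefficients in the ideal. -/
theorem exists_ev_eq_of_mem (h : IsKummer F A p ε e) (hp : 0 < p) {I : Ideal R} {s : R ⊗[F] A}
    (hs : s ∈ I.map (algebraMap R (R ⊗[F] A))) :
    ∃ q : R[X], q.natDegree < p ∧ (∀ i, q.coeff i ∈ I) ∧ ev F ε R q = s := by
  have key : ∀ t : R ⊗[F] A,
      ∃ q : R[X], q.natDegree < p ∧ (∀ i, q.coeff i ∈ I) ∧ ev F ε R q = t * s := by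
    refine Submodule.span_induction (p := fun s _ => ∀ t : R ⊗[F] A,
      ∃ q : R[X], q.natDegree < p ∧ (∀ i, q.coeff i ∈ I) ∧ ev F ε R q = t * s) ?_ ?_ ?_ ?_ hs
    · rintro _ ⟨a, ha, rfl⟩ t
      obtain ⟨q, hq, rfl⟩ := h.exists_ev_eq hp t
      refine ⟨C a * q, (natDegree_C_mul_le _ _).trans_lt hq, fun i => ?_, ?_⟩
      · rw [coeff_C_mul]
        exact I.mul_mem_right _ ha
      · rw [map_mul, aeval_C, mul_comm]
    · intro t
      exact ⟨0, by simpa using hp, fun i => by simp, by simp⟩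
    · intro a b _ _ ha hb t
      obtain ⟨q, hq, hq', hqt⟩ := ha t
      obtain ⟨r, hr, hr', hrt⟩ := hb t
      refine ⟨q + r, (natDegree_add_le _ _).trans_lt (max_lt hq hr), fun i => ?_, ?_⟩
      · rw [coeff_add]
        exact I.add_mem (hq' i) (hr' i)
      · rw [map_add, hqt, hrt, mul_add]
    · intro a b _ hb t
      obtain ⟨q, hq, hq', hqt⟩ := hb (t * a)
      exact ⟨q, hq, hq', by rw [hqt, smul_eq_mul, mul_assoc]⟩
  obtain ⟨q, hq, hq', hqt⟩ := key 1
  exact ⟨q, hq, hq', by rw [hqt, one_mul]⟩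

/-- Evaluation of polynomials in `ε` at a `p`-th root of `e`. -/
theorem exists_evalHom (h : IsKummer F A p ε e) {R' : Type u} [CommRing R'] [Algebra F R']
    (f : R →ₐ[F] R') (θ : R')
    (hθ : θ ^ p = algebraMap F R' e) :
    ∃ φ : R ⊗[F] A →+* R', ∀ q : R[X], φ (ev F ε R q) = q.eval₂ (f : R →+* R') θ := by
  obtain ⟨ψ, hψ⟩ := h.hom R' θ hθ
  let φ : R ⊗[F] A →ₐ[F] R' := Algebra.TensorProduct.lift f ψ fun _ _ => Commute.all _ _
  refine ⟨φ, fun q => ?_⟩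
  rw [aeval_def, hom_eval₂]
  congr 1
  · ext r
    simp [φ]
  · simp [φ, hψ]

theorem map_ev {R' : Type u} [CommRing R'] [Algebra F R'] (f : R →ₐ[F] R') (q : R[X]) :
    Algebra.TensorProduct.map f (AlgHom.id F A) (ev F ε R q) =
      ev F ε R' (q.map (f : R →+* R')) := by
  have : (Algebra.TensorProduct.map f (AlgHom.id F A)) (ev F ε R q) =
      ((Algebra.TensorProduct.map f (AlgHom.id F A) : R ⊗[F] A →ₐ[F] R' ⊗[F] A) :
        R ⊗[F] A →+* R' ⊗[F] A) (ev F ε R q) := rfl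
  rw [this, aeval_def, hom_eval₂, aeval_def, eval₂_map]
  refine eval₂_congr (RingHom.ext fun r => ?_) ?_ rfl
  · simp
  · simp

theorem map_map_algebraMap {R' : Type u} [CommRing R'] [Algebra F R'] (f : R →ₐ[F] R') (q : F[X]) :
    (q.map (algebraMap F R)).map (f : R →+* R') = q.map (algebraMap F R') := by
  rw [Polynomial.map_map]
  congr 1
  exact f.comp_algebraMap

section Field

variable {ζ : F} {K : Type u} [Field K] [Algebra F K]

theorem eq_zero_of_eval_eq_zero [IsAlgClosed K] (hp : 0 < p) (hζ : IsPrimitiveRoot ζ p)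
    (he : e ≠ 0) {q : K[X]} (hq : q.natDegree < p)
    (h0 : ∀ θ : K, θ ^ p = algebraMap F K e → q.eval θ = 0) : q = 0 := by
  obtain ⟨θ, hθ⟩ := IsAlgClosed.exists_pow_nat_eq (algebraMap F K e) hp
  have hζ' := hζ.map_of_injective (algebraMap F K).injective
  have hθ0 : θ ≠ 0 := by
    rintro rfl
    rw [zero_pow hp.ne'] at hθ
    exact he ((map_eq_zero _).1 hθ.symm)
  refine eq_zero_of_natDegree_lt_card_of_eval_eq_zero q (rootNode_injective hζ' hθ0) (fun i => ?_)
    (by simpa using hq)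
  exact h0 _ (by rw [rootNode_pow hζ', hθ])

/-- Over an algebraically closed field, elements of the base change of `A` are determined by their
values at the `p`-th roots of `e`. -/
theorem ev_eq_ev_iff [IsAlgClosed K] (h : IsKummer F A p ε e) (hp : 0 < p)
    (hζ : IsPrimitiveRoot ζ p) (he : e ≠ 0) (q r : K[X]) :
    ev F ε K q = ev F ε K r ↔ ∀ θ : K, θ ^ p = algebraMap F K e → q.eval θ = r.eval θ := by
  have hev : ∀ θ : K, θ ^ p = algebraMap F K e → ∃ φ : K ⊗[F] A →+* K,
      ∀ q : K[X], φ (ev F ε K q) = q.eval θ := fun θ hθ => h.exists_evalHom (AlgHom.id F K) θ hθ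
  constructor
  · intro hqr θ hθ
    obtain ⟨φ, hφ⟩ := hev θ hθ
    rw [← hφ, ← hφ, hqr]
  · intro hqr
    obtain ⟨d, hd, hd'⟩ := h.exists_ev_eq hp (ev F ε K q - ev F ε K r)
    have : d = 0 := eq_zero_of_eval_eq_zero hp hζ he hd fun θ hθ => by
      obtain ⟨φ, hφ⟩ := hev θ hθ
      rw [← hφ, hd', map_sub, hφ, hφ, hqr θ hθ, sub_self]
    rw [this, map_zero] at hd'
    exact sub_eq_zero.1 hd'.symm

end Field

/-! ### The `p`-th roots of a generic element and their factorisations -/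

/-- Every `p`-th root of `w` is a unit, and a polynomial of degree exactly `p - 1` in `ε` without
multiple roots. -/
def IsGeneric (F : Type u) [Field F] {A : Type u} [CommRing A] [Algebra F A] (p : ℕ) (ε : A) (e : F)
    (w : F[X]) : Prop :=
  ∀ (L : Type u) [Field L] [Algebra F L] [IsAlgClosed L] (v : L[X]), v.natDegree < p →
    ev F ε L v ^ p = ev F ε L (w.map (algebraMap F L)) →
    v.coeff (p - 1) ≠ 0 ∧ (∀ θ : L, θ ^ p = algebraMap F L e → v.eval θ ≠ 0) ∧
    ∀ (y : L) (x : Fin (p - 1) → L), v = C y * ∏ i, (X + C (x i)) → Function.Injective x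

theorem exists_isGeneric {k E : Type u} [Field k] [Field E] [Algebra k E] {p : ℕ} (hp : 0 < p)
    {ζ : k} (hζ : IsPrimitiveRoot ζ p) {e : k} (he : e ≠ 0) {ε : E} (hε : ε ^ p = algebraMap k E e)
    (hgen : IntermediateField.adjoin k {ε} = ⊤) (hdeg : Module.finrank k E = p) :
    ∃ f : MvPolynomial (Fin p) k, f ≠ 0 ∧ ∀ (F : Type u) [Field F] [Algebra k F] (c : Fin p → F),
      MvPolynomial.aeval c f ≠ 0 → IsGeneric F p ((1 : F) ⊗ₜ[k] ε) (algebraMap k F e)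
        (∑ i, C (c i) * X ^ (i : ℕ)) := by
  have : FiniteDimensional k E := FiniteDimensional.of_finrank_pos (hdeg ▸ hp)
  have hε0 : ε ≠ 0 := by
    rintro rfl
    rw [zero_pow hp.ne'] at hε
    exact he ((map_eq_zero _).1 hε.symm)
  obtain ⟨f, hf, H⟩ := exists_generic hp hζ hε0
  refine ⟨f, hf, fun F _ _ c hc L _ _ _ v hv hvw => ?_⟩
  let : Algebra k L := ((algebraMap F L).comp (algebraMap k F)).toAlgebra
  have : IsScalarTower k F L := IsScalarTower.of_algebraMap_eq fun _ => rfl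
  have hk : IsKummer F (F ⊗[k] E) p ((1 : F) ⊗ₜ[k] ε) (algebraMap k F e) :=
    of_field hp hε hgen hdeg F
  have hζF := hζ.map_of_injective (algebraMap k F).injective
  have heF : algebraMap k F e ≠ 0 := (_root_.map_ne_zero _).2 he
  rw [← map_pow, hk.ev_eq_ev_iff hp hζF heF] at hvw
  refine H L (fun i => algebraMap F L (c i)) ?_ e hε v hv fun θ hθ => ?_
  · have h1 : MvPolynomial.aeval (fun i => algebraMap F L (c i)) f =
        algebraMap F L (MvPolynomial.aeval c f) :=
      (MvPolynomial.comp_aeval_apply (φ := IsScalarTower.toAlgHom k F L) c f).symm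
    rw [h1]
    exact (_root_.map_ne_zero _).2 hc
  · have h1 := hvw θ hθ
    rw [eval_pow] at h1
    rw [h1]
    simp [eval_finsetSum, Polynomial.map_sum]

variable {w : F[X]} {ζ : F}

/-- The values of `w` at the `p`-th roots of `e`. -/
theorem IsGeneric.exists_root (hw : IsGeneric F p ε e w) (h : IsKummer F A p ε e) (hp : 0 < p)
    (hζ : IsPrimitiveRoot ζ p) (he : e ≠ 0) (K : Type u) [Field K] [Algebra F K] [IsAlgClosed K] :
    ∃ (θ : Fin p → K) (z : Fin p → K), Function.Injective θ ∧
      (∀ i, θ i ^ p = algebraMap F K e) ∧ (∀ t : K, t ^ p = algebraMap F K e → ∃ i, θ i = t) ∧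
      (∀ i, z i ^ p = (w.map (algebraMap F K)).eval (θ i)) ∧ ∀ i, z i ≠ 0 := by
  have : NeZero p := ⟨hp.ne'⟩
  obtain ⟨θ, hθ⟩ := IsAlgClosed.exists_pow_nat_eq (algebraMap F K e) hp
  have hζ' := hζ.map_of_injective (algebraMap F K).injective
  have hθ0 : θ ≠ 0 := by
    rintro rfl
    rw [zero_pow hp.ne'] at hθ
    exact he ((map_eq_zero _).1 hθ.symm)
  have hinj := rootNode_injective hζ' hθ0
  choose z hz using fun i : Fin p => IsAlgClosed.exists_pow_nat_eq
    ((w.map (algebraMap F K)).eval (algebraMap F K ζ ^ (i : ℕ) * θ)) hp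
  have hpow : ∀ i : Fin p, (algebraMap F K ζ ^ (i : ℕ) * θ) ^ p = algebraMap F K e := fun i => by
    rw [rootNode_pow hζ', hθ]
  have hall : ∀ t : K, t ^ p = algebraMap F K e → ∃ i : Fin p, algebraMap F K ζ ^ (i : ℕ) * θ = t :=
    fun t ht => exists_rootNode_eq hζ' hθ0 (ht.trans hθ.symm)
  refine ⟨fun i => algebraMap F K ζ ^ (i : ℕ) * θ, z, hinj, hpow, hall, hz, ?_⟩
  -- the polynomial with the values `z i` is a `p`-th root of `w`
  let v := Lagrange.interpolate Finset.univ (fun i : Fin p => algebraMap F K ζ ^ (i : ℕ) * θ) z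
  have hv : ∀ i : Fin p, v.eval (algebraMap F K ζ ^ (i : ℕ) * θ) = z i := fun i =>
    Lagrange.eval_interpolate_at_node z hinj.injOn (Finset.mem_univ i)
  have hdeg : v.natDegree < p := by
    have := Lagrange.degree_interpolate_lt z (s := Finset.univ) hinj.injOn
    rw [Finset.card_univ, Fintype.card_fin] at this
    rcases eq_or_ne v 0 with h0 | h0
    · rw [h0, natDegree_zero]
      exact hp
    · exact (natDegree_lt_iff_degree_lt h0).2 this
  have hvw : ev F ε K v ^ p = ev F ε K (w.map (algebraMap F K)) := by
    rw [← map_pow, h.ev_eq_ev_iff hp hζ he]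
    intro t ht
    obtain ⟨i, rfl⟩ := hall t ht
    rw [eval_pow, hv, hz]
  intro i
  rw [← hv i]
  exact (hw K v hdeg hvw).2.1 _ (hpow i)

theorem IsGeneric.isUnit (hw : IsGeneric F p ε e w) (h : IsKummer F A p ε e) (hp : 0 < p)
    (hζ : IsPrimitiveRoot ζ p) (he : e ≠ 0) (R : Type u) [CommRing R] [Algebra F R] :
    IsUnit (ev F ε R (w.map (algebraMap F R))) := by
  have hF : IsUnit (ev F ε F w) := by
    obtain ⟨b, -⟩ := h.exists_basis F
    have : Module.Finite F (F ⊗[F] A) := Module.Finite.of_basis b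
    have : IsArtinianRing (F ⊗[F] A) := IsArtinianRing.of_finite F _
    refine IsArtinianRing.isUnit_of_mem_nonZeroDivisors (mem_nonZeroDivisors_iff_right.2 ?_)
    intro s hs
    obtain ⟨q, hq, rfl⟩ := h.exists_ev_eq hp s
    obtain ⟨θ, z, -, -, hall, hz, hz0⟩ := hw.exists_root h hp hζ he (AlgebraicClosure F)
    have hq0 : q.map (algebraMap F (AlgebraicClosure F)) = 0 := by
      refine eq_zero_of_eval_eq_zero hp hζ he ((natDegree_map_le).trans_lt hq) fun t ht => ?_
      obtain ⟨φ, hφ⟩ := h.exists_evalHom (Algebra.ofId F (AlgebraicClosure F)) t ht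
      have h1 := congrArg φ hs
      rw [map_mul, hφ, hφ, map_zero] at h1
      rw [eval_map]
      refine (mul_eq_zero.1 h1).resolve_right fun h2 => ?_
      obtain ⟨i, rfl⟩ := hall t ht
      have h3 := hz i
      rw [eval_map] at h3
      exact pow_ne_zero p (hz0 i) (h3.trans h2)
    rw [(Polynomial.map_eq_zero_iff (algebraMap F (AlgebraicClosure F)).injective).1 hq0, map_zero]
  have h2 := map_ev (A := A) (ε := ε) (Algebra.ofId F R) w
  have h3 : w.map ((Algebra.ofId F R : F →ₐ[F] R) : F →+* R) = w.map (algebraMap F R) := rfl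
  rw [h3] at h2
  rw [← h2]
  exact hF.map _

/-- `y ∏ (T + x_i)`. -/
noncomputable def linProd {R : Type u} [CommRing R] {m : ℕ} (z : R × (Fin m → R)) : R[X] :=
  C z.1 * ∏ i, (X + C (z.2 i))

theorem map_linProd {R R' : Type u} [CommRing R] [CommRing R'] {m : ℕ} (f : R →+* R')
    (z : R × (Fin m → R)) : (linProd z).map f = linProd (f z.1, fun i => f (z.2 i)) := by
  simp [linProd, Polynomial.map_prod]

theorem natDegree_linProd_lt (hp : 0 < p) {R : Type u} [CommRing R] (z : R × (Fin (p - 1) → R)) :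
    (linProd z).natDegree < p :=
  (natDegree_C_mul_prod_le _ _).trans_lt (by omega)

theorem coeff_linProd {R : Type u} [CommRing R] {m : ℕ} (z : R × (Fin m → R)) :
    (linProd z).coeff m = z.1 := coeff_C_mul_prod _ _

/-- The systems `(y, x)` such that `(y ∏ (ε + x_i)) ^ p = w`. -/
def Sol (F : Type u) [Field F] {A : Type u} [CommRing A] [Algebra F A] (p : ℕ) (ε : A) (w : F[X])
    (R : Type u) [CommRing R] [Algebra F R] : Set (R × (Fin (p - 1) → R)) :=
  {z | ev F ε R (linProd z) ^ p = ev F ε R (w.map (algebraMap F R))}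

theorem map_mem_Sol {R R' : Type u} [CommRing R] [Algebra F R] [CommRing R'] [Algebra F R']
    (f : R →ₐ[F] R') {z : R × (Fin (p - 1) → R)} (hz : z ∈ Sol F p ε w R) :
    (f z.1, fun i => f (z.2 i)) ∈ Sol F p ε w R' := by
  have h := congrArg (Algebra.TensorProduct.map f (AlgHom.id F A)) hz
  rw [map_pow, map_ev, map_ev, map_map_algebraMap, map_linProd] at h
  exact h

end IsKummer

namespace IsKummer

open Polynomial

variable {F : Type u} [Field F] {A : Type u} [CommRing A] [Algebra F A] {p : ℕ} {ε : A} {e : F}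
  {w : F[X]} {ζ : F}

theorem isUnit_of_mem_Sol (hw : IsGeneric F p ε e w) (h : IsKummer F A p ε e) (hp : 0 < p)
    (hζ : IsPrimitiveRoot ζ p) (he : e ≠ 0) {R : Type u} [CommRing R] [Algebra F R]
    {z : R × (Fin (p - 1) → R)} (hz : z ∈ Sol F p ε w R) : IsUnit (ev F ε R (linProd z)) := by
  have h1 := hw.isUnit h hp hζ he R
  have h2 : ev F ε R (linProd z) ^ p = _ := hz
  rw [← h2] at h1
  exact (isUnit_pow_iff hp.ne').1 h1

theorem ne_zero_and_injective_of_mem_Sol (hw : IsGeneric F p ε e w) (hp : 0 < p) {L : Type u}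
    [Field L] [Algebra F L] {z : L × (Fin (p - 1) → L)} (hz : z ∈ Sol F p ε w L) :
    z.1 ≠ 0 ∧ Function.Injective z.2 := by
  let f : L →ₐ[F] AlgebraicClosure L := IsScalarTower.toAlgHom F L (AlgebraicClosure L)
  have hz' := map_mem_Sol f hz
  obtain ⟨h1, -, h3⟩ := hw (AlgebraicClosure L) _ (natDegree_linProd_lt hp _) hz'
  rw [coeff_linProd] at h1
  refine ⟨fun h0 => h1 (by rw [h0, map_zero]), fun i j hij => h3 _ _ rfl ?_⟩
  dsimp only
  rw [hij]

theorem eval_linProd_neg {R : Type u} [CommRing R] {m : ℕ} (z : R × (Fin m → R)) (i : Fin m) :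
    (linProd z).eval (-z.2 i) = 0 := by
  rw [linProd, eval_mul, eval_prod, Finset.prod_eq_zero (Finset.mem_univ i), mul_zero]
  simp

/-- A solution has no infinitesimal deformations. -/
theorem eq_of_mem_Sol_thickening [CharZero F] (hw : IsGeneric F p ε e w) (h : IsKummer F A p ε e)
    (hp : 0 < p) (hζ : IsPrimitiveRoot ζ p) (he : e ≠ 0) {K : Type u} [Field K] [Algebra F K]
    {R : Type u} [CommRing R] [IsLocalRing R] [Algebra F R] (T : Thickening F K R)
    {z : R × (Fin (p - 1) → R)} (hz : z ∈ Sol F p ε w R) :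
    z.1 = T.s (T.π z.1) ∧ ∀ i, z.2 i = T.s (T.π (z.2 i)) := by
  have := T.isLocalHom
  have hz₀ := map_mem_Sol T.π hz
  have hz₁ := map_mem_Sol T.s hz₀
  set z₁ : R × (Fin (p - 1) → R) := (T.s (T.π z.1), fun i => T.s (T.π (z.2 i))) with hz₁_def
  have hd : ∀ i, T.π ((linProd z - linProd z₁).coeff i) = 0 := fun i => by
    have h1 : (linProd z - linProd z₁).map (T.π : R →+* K) = 0 := by
      rw [Polynomial.map_sub, map_linProd, map_linProd]
      simp [hz₁_def, T.π_s]
    have h2 := congrArg (fun q => Polynomial.coeff q i) h1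
    simpa [coeff_map] using h2
  have hsq : (linProd z - linProd z₁) ^ 2 = 0 := by
    ext i
    rw [sq, coeff_mul, coeff_zero]
    exact Finset.sum_eq_zero fun j _ => T.sq _ _ (hd _) (hd _)
  have hN : ev F ε R (linProd z - linProd z₁) = 0 := by
    obtain ⟨k, hk⟩ := Polynomial.powAddExpansion (ev F ε R (linProd z₁))
      (ev F ε R (linProd z - linProd z₁)) p
    rw [← map_pow _ (linProd z - linProd z₁), hsq, map_zero, mul_zero, add_zero, ← map_add,
      add_sub_cancel] at hk
    have h1 : ev F ε R (linProd z) ^ p = ev F ε R (linProd z₁) ^ p := hz.trans hz₁.symm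
    rw [h1, left_eq_add] at hk
    have hpu : IsUnit ((p : ℕ) : R ⊗[F] A) := by
      have h2 := (IsUnit.mk0 (p : F) (Nat.cast_ne_zero.2 hp.ne')).map (algebraMap F (R ⊗[F] A))
      simpa using h2
    have hu := hpu.mul ((isUnit_of_mem_Sol hw h hp hζ he hz₁).pow (p - 1))
    exact (hu.mul_right_eq_zero).1 hk
  have hd0 : linProd z - linProd z₁ = 0 := h.eq_zero_of_ev_eq_zero
    ((natDegree_sub_le _ _).trans_lt
      (max_lt (natDegree_linProd_lt hp _) (natDegree_linProd_lt hp _))) hN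
  have heq := sub_eq_zero.1 hd0
  refine ⟨?_, fun i => ?_⟩
  · rw [← coeff_linProd z, heq, coeff_linProd]
    simp [hz₁_def, T.π_s]
  · obtain ⟨hy, hinj⟩ := ne_zero_and_injective_of_mem_Sol hw hp hz₀
    have h1 := eval_linProd_neg z i
    rw [heq, linProd, eval_mul, eval_prod, eval_C, ← Finset.mul_prod_erase _ _ (Finset.mem_univ i),
      mul_left_comm] at h1
    have hu : IsUnit (z₁.1 * ∏ j ∈ Finset.univ.erase i, eval (-z.2 i) (X + C (z₁.2 j))) := by
      refine IsUnit.mul ?_ ((IsUnit.prod_iff).2 fun j hj => ?_)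
      · exact (IsUnit.mk0 _ hy).map T.s
      · refine isUnit_of_map_unit T.π _ (IsUnit.mk0 _ ?_)
        simp only [eval_add, eval_X, eval_C, map_add, map_neg, hz₁_def, T.π_s]
        rw [neg_add_eq_sub, sub_ne_zero]
        exact hinj.ne (Finset.ne_of_mem_erase hj)
    have h2 := (hu.mul_left_eq_zero).1 h1
    simp only [eval_add, eval_X, eval_C] at h2
    rw [neg_add_eq_zero] at h2
    exact h2

/-- Over an algebraically closed field there are `p ^ p` roots of a generic `w`, each with
`(p - 1)!` orderings of its linear factors. -/
theorem nonempty_Sol_equiv (hw : IsGeneric F p ε e w) (h : IsKummer F A p ε e) (hp : 0 < p)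
    (hζ : IsPrimitiveRoot ζ p) (he : e ≠ 0) (K : Type u) [Field K] [Algebra F K] [IsAlgClosed K] :
    Nonempty (Sol F p ε w K ≃ Fin (p - 1).factorial × (Fin p → Fin p)) := by
  have : NeZero p := ⟨hp.ne'⟩
  classical
  obtain ⟨θ, z, hinj, hpow, hall, hz, hz0⟩ := hw.exists_root h hp hζ he K
  have hζ' := hζ.map_of_injective (algebraMap F K).injective
  -- the roots of `w`, as interpolation polynomials
  let v : (Fin p → Fin p) → K[X] := fun f =>
    Lagrange.interpolate Finset.univ θ fun i => algebraMap F K ζ ^ (f i : ℕ) * z i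
  have hv : ∀ f i, (v f).eval (θ i) = algebraMap F K ζ ^ (f i : ℕ) * z i := fun f i =>
    Lagrange.eval_interpolate_at_node _ hinj.injOn (Finset.mem_univ i)
  have hdeg : ∀ f, (v f).natDegree < p := fun f => by
    have := Lagrange.degree_interpolate_lt (fun i => algebraMap F K ζ ^ (f i : ℕ) * z i)
      (s := Finset.univ) hinj.injOn
    rw [Finset.card_univ, Fintype.card_fin] at this
    rcases eq_or_ne (v f) 0 with h0 | h0
    · rw [h0, natDegree_zero]
      exact hp
    · exact (natDegree_lt_iff_degree_lt h0).2 this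
  have hvw : ∀ f, ev F ε K (v f) ^ p = ev F ε K (w.map (algebraMap F K)) := fun f => by
    rw [← map_pow, h.ev_eq_ev_iff hp hζ he]
    intro t ht
    obtain ⟨i, rfl⟩ := hall t ht
    rw [eval_pow, hv, rootNode_pow hζ', hz]
  have hv_inj : Function.Injective v := fun f g hfg => funext fun i => by
    have h1 := hv f i
    rw [hfg, hv] at h1
    exact rootNode_injective hζ' (hz0 i) h1.symm
  have hv_surj : ∀ q : K[X], q.natDegree < p →
      ev F ε K q ^ p = ev F ε K (w.map (algebraMap F K)) → ∃ f, v f = q := fun q hq hqw => by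
    rw [← map_pow, h.ev_eq_ev_iff hp hζ he] at hqw
    choose f hf using fun i => exists_rootNode_eq hζ' (hz0 i) (θ := q.eval (θ i)) (by
      rw [← eval_pow, hqw _ (hpow i), hz])
    refine ⟨f, sub_eq_zero.1 (eq_zero_of_natDegree_lt_card_of_eval_eq_zero _ hinj (fun i => ?_) ?_)⟩
    · rw [eval_sub, hv, hf, sub_self]
    · rw [Fintype.card_fin]
      exact (natDegree_sub_le _ _).trans_lt (max_lt (hdeg f) hq)
  -- a factorisation of each of them
  have hfac : ∀ f, ∃ x : Fin (p - 1) → K, linProd ((v f).coeff (p - 1), x) = v f := fun f => by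
    have hc := (hw K (v f) (hdeg f) (hvw f)).1
    have hd : (v f).natDegree = p - 1 :=
      le_antisymm (by have := hdeg f; omega) (le_natDegree_of_ne_zero hc)
    have hs := IsAlgClosed.splits (v f)
    have hcard : (v f).roots.card = p - 1 := by rw [← hd, hs.natDegree_eq_card_roots]
    obtain ⟨l, hl⟩ := Quotient.exists_rep (v f).roots
    have hl' : (l : Multiset K) = (v f).roots := hl
    have hlen : l.length = p - 1 := by rw [← hcard, ← hl', Multiset.coe_card]
    refine ⟨fun i => -l.get (Fin.cast hlen.symm i), ?_⟩
    have h1 := hs.eq_prod_roots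
    rw [← hl', Multiset.map_coe, Multiset.prod_coe, leadingCoeff, hd] at h1
    conv_rhs => rw [h1]
    rw [linProd]
    congr 1
    have h2 : (l.map fun a => X - C a).prod = ∏ i : Fin l.length, (X - C (l.get i)) := by
      conv_lhs => rw [← List.ofFn_get l, List.map_ofFn, List.prod_ofFn]
      rfl
    rw [h2]
    refine Fintype.prod_equiv (finCongr hlen.symm) _ _ fun i => ?_
    simp [sub_eq_add_neg]
  choose x hx using hfac
  have hx_inj : ∀ f, Function.Injective (x f) := fun f =>
    (hw K (v f) (hdeg f) (hvw f)).2.2 _ _ (hx f).symm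
  have hperm : ∀ f (π : Equiv.Perm (Fin (p - 1))),
      linProd ((v f).coeff (p - 1), fun i => x f (π i)) = v f := fun f π => by
    conv_rhs => rw [← hx f]
    rw [linProd, linProd]
    congr 1
    exact Fintype.prod_equiv π _ _ fun _ => rfl
  let Ψ : Equiv.Perm (Fin (p - 1)) × (Fin p → Fin p) → Sol F p ε w K := fun a =>
    ⟨((v a.2).coeff (p - 1), fun i => x a.2 (a.1 i)), by
      change ev F ε K (linProd _) ^ p = _
      rw [hperm]
      exact hvw a.2⟩
  have hΨ : Function.Bijective Ψ := by
    constructor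
    · rintro ⟨π, f⟩ ⟨π', f'⟩ hab
      have h0 : ((v f).coeff (p - 1), fun i => x f (π i)) =
        ((v f').coeff (p - 1), fun i => x f' (π' i)) := congrArg Subtype.val hab
      have hf : f = f' := hv_inj (by rw [← hperm f π, ← hperm f' π', h0])
      subst hf
      have h1 := (Prod.ext_iff.1 h0).2
      have hπ : π = π' := Equiv.ext fun i => hx_inj f (congrFun h1 i)
      rw [hπ]
    · rintro ⟨a, ha⟩
      obtain ⟨f, hf⟩ := hv_surj (linProd a) (natDegree_linProd_lt hp a) ha
      have ha_inj := (ne_zero_and_injective_of_mem_Sol hw hp ha).2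
      have hc := (hw K (v f) (hdeg f) (hvw f)).1
      have hex : ∀ i, ∃ j, x f j = a.2 i := fun i => by
        have h1 := eval_linProd_neg a i
        rw [← hf, ← hx f, linProd, eval_mul, eval_prod, eval_C, mul_eq_zero] at h1
        obtain ⟨j, -, hj⟩ := Finset.prod_eq_zero_iff.1 (h1.resolve_left hc)
        refine ⟨j, ?_⟩
        simp only [eval_add, eval_X, eval_C] at hj
        rwa [neg_add_eq_zero, eq_comm] at hj
      choose π hπ using hex
      have hπ_inj : Function.Injective π := fun i j hij => ha_inj (by rw [← hπ, ← hπ, hij])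
      refine ⟨(Equiv.ofBijective π (Finite.injective_iff_bijective.1 hπ_inj), f), ?_⟩
      refine Subtype.ext (Prod.ext ?_ (funext fun i => ?_))
      · change (v f).coeff (p - 1) = a.1
        rw [hf, coeff_linProd]
      · exact hπ i
  refine ⟨(Equiv.ofBijective Ψ hΨ).symm.trans (Equiv.prodCongr ?_ (Equiv.refl _))⟩
  exact Fintype.equivFinOfCardEq (by rw [Fintype.card_perm, Fintype.card_fin])

theorem finite_Sol (hw : IsGeneric F p ε e w) (h : IsKummer F A p ε e) (hp : 0 < p)
    (hζ : IsPrimitiveRoot ζ p) (he : e ≠ 0) (L : Type u) [Field L] [Algebra F L] :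
    Finite (Sol F p ε w L) := by
  obtain ⟨E⟩ := nonempty_Sol_equiv hw h hp hζ he (AlgebraicClosure L)
  have := Finite.of_equiv _ E.symm
  let f : L →ₐ[F] AlgebraicClosure L := IsScalarTower.toAlgHom F L (AlgebraicClosure L)
  have hf : Function.Injective f := (f : L →+* AlgebraicClosure L).injective
  refine Finite.of_injective (fun z : Sol F p ε w L =>
    (⟨_, map_mem_Sol f z.2⟩ : Sol F p ε w (AlgebraicClosure L))) fun a b hab => ?_
  have h0 := congrArg Subtype.val hab
  refine Subtype.ext (Prod.ext (hf (Prod.ext_iff.1 h0).1) (funext fun i => hf ?_))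
  exact congrFun (Prod.ext_iff.1 h0).2 i

/-- All solutions are defined over every algebraically closed field. -/
theorem exists_map_eq_of_mem_Sol (hw : IsGeneric F p ε e w) (h : IsKummer F A p ε e) (hp : 0 < p)
    (hζ : IsPrimitiveRoot ζ p) (he : e ≠ 0) {K L : Type u} [Field K] [Algebra F K] [IsAlgClosed K]
    [Field L] [Algebra F L] (f : K →ₐ[F] L) {z : L × (Fin (p - 1) → L)}
    (hz : z ∈ Sol F p ε w L) :
    ∃ z₀ ∈ Sol F p ε w K, (f z₀.1, fun i => f (z₀.2 i)) = z := by
  obtain ⟨E⟩ := nonempty_Sol_equiv hw h hp hζ he (AlgebraicClosure L)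
  obtain ⟨E'⟩ := nonempty_Sol_equiv hw h hp hζ he K
  have := finite_Sol hw h hp hζ he K
  let g : L →ₐ[F] AlgebraicClosure L := IsScalarTower.toAlgHom F L (AlgebraicClosure L)
  have hg : Function.Injective g := (g : L →+* AlgebraicClosure L).injective
  have hgf : Function.Injective (g.comp f) := (g.comp f : K →+* AlgebraicClosure L).injective
  let Φ : Sol F p ε w K → Sol F p ε w (AlgebraicClosure L) :=
    fun z => ⟨_, map_mem_Sol (g.comp f) z.2⟩
  have hΦ : Function.Injective Φ := fun a b hab => by
    have h0 := congrArg Subtype.val hab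
    refine Subtype.ext (Prod.ext (hgf (Prod.ext_iff.1 h0).1) (funext fun i => hgf ?_))
    exact congrFun (Prod.ext_iff.1 h0).2 i
  obtain ⟨⟨z₀, hz₀⟩, h1⟩ := (Finite.injective_iff_surjective_of_equiv (E'.trans E.symm)).1 hΦ
    ⟨_, map_mem_Sol g hz⟩
  have h2 := congrArg Subtype.val h1
  refine ⟨z₀, hz₀, Prod.ext (hg (Prod.ext_iff.1 h2).1) (funext fun i => hg ?_)⟩
  exact congrFun (Prod.ext_iff.1 h2).2 i

end IsKummer

/-! ### Norms in Kummer algebras -/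

section KummerNorm

open Polynomial

variable {R : Type u} [CommRing R]

theorem det_sub_prod_diag_mem {m : Type*} [Fintype m] [DecidableEq m] {I : Ideal R}
    {M : Matrix m m R} (h : ∀ i j, i ≠ j → M i j ∈ I) : M.det - ∏ i, M i i ∈ I * I := by
  rw [Matrix.det_apply, ← Finset.add_sum_erase _ _ (Finset.mem_univ 1)]
  simp only [Equiv.Perm.sign_one, one_smul, Equiv.Perm.one_apply, add_sub_cancel_left]
  refine Ideal.sum_mem _ fun σ hσ => ?_
  obtain ⟨i, hi⟩ : ∃ i, σ i ≠ i := by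
    by_contra! h0
    exact Finset.ne_of_mem_erase hσ (Equiv.ext h0)
  -- a nontrivial permutation moves both `i` and `σ i`
  have hi' : σ (σ i) ≠ σ i := fun h0 => hi (σ.injective h0)
  rw [← Finset.mul_prod_erase _ _ (Finset.mem_univ i),
    ← Finset.mul_prod_erase _ _ (Finset.mem_erase.2 ⟨hi, Finset.mem_univ (σ i)⟩), ← mul_assoc,
    Units.smul_def, zsmul_eq_mul]
  exact Ideal.mul_mem_left _ _ (Ideal.mul_mem_right _ _ (Ideal.mul_mem_mul (h _ _ hi) (h _ _ hi')))

variable {p : ℕ} [NeZero p]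

/-- As a function of the constant coefficient of `b`, the norm is a characteristic polynomial. It
is `x ^ p` modulo the square of every ideal that contains the other coefficients of `b`. -/
theorem exists_kummerNorm_update (I : Ideal R) (c : R) {b : Fin p → R}
    (hb : ∀ j, j ≠ 0 → b j ∈ I) :
    ∃ q : R[X], (∀ i, q.coeff i ∈ I * I) ∧
      ∀ x, kummerNorm c (Function.update b 0 x) = x ^ p + q.eval x := by
  let M : Matrix (Fin p) (Fin p) R :=
    Matrix.of fun l j => if l = j then 0 else if j ≤ l then b (l - j) else c * b (l - j)
  refine ⟨(-M).charpoly - X ^ p, ?_, fun x => ?_⟩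
  · have h1 : ∀ i j, i ≠ j → (-M).charmatrix i j ∈ I.map (C : R →+* R[X]) := fun i j hij => by
      have h' : i - j ≠ 0 := sub_ne_zero.2 hij
      rw [Matrix.charmatrix_apply_ne _ _ _ hij]
      refine (Ideal.neg_mem_iff _).2 (Ideal.mem_map_of_mem _ ?_)
      rw [Matrix.neg_apply, Ideal.neg_mem_iff]
      simp only [M, Matrix.of_apply, if_neg hij]
      split_ifs
      · exact hb _ h'
      · exact I.mul_mem_left c (hb _ h')
    have h2 := det_sub_prod_diag_mem h1
    have h3 : ∏ i, (-M).charmatrix i i = X ^ p := by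
      simp [Matrix.charmatrix_apply_eq, M]
    rw [h3, ← Ideal.map_mul] at h2
    exact Ideal.mem_map_C_iff.1 h2
  · rw [eval_sub, eval_pow, eval_X, add_sub_cancel, Matrix.eval_charpoly, sub_neg_eq_add]
    rw [kummerNorm]
    congr 1
    ext l j
    by_cases h : l = j
    · subst h
      simp [M]
    · have h' : l - j ≠ 0 := sub_ne_zero.2 h
      simp [M, h, h']

theorem kummerNorm_eq_pow {I : Ideal R} (hI : I * I = ⊥) (c : R) {b : Fin p → R}
    (hb : ∀ j, j ≠ 0 → b j ∈ I) : kummerNorm c b = b 0 ^ p := by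
  obtain ⟨q, hq, h⟩ := exists_kummerNorm_update I c hb
  rw [hI] at hq
  have hq0 : q = 0 := Polynomial.ext fun i => hq i
  have := h (b 0)
  rwa [Function.update_eq_self, hq0, eval_zero, add_zero] at this

/-- Monomials in a Kummer algebra over a field are invertible. -/
theorem kummerNorm_single_ne_zero {L : Type u} [Field L] {c : L} (hc : c ≠ 0) {b : Fin p → L}
    {l : Fin p} (hl : b l ≠ 0) (hb : ∀ j, j ≠ l → b j = 0) : kummerNorm c b ≠ 0 := by
  intro h
  obtain ⟨v, hv, hMv⟩ := Matrix.exists_mulVec_eq_zero_iff.2 h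
  refine hv (funext fun j => ?_)
  have h1 := congrFun hMv (l + j)
  rw [Matrix.mulVec, dotProduct, Finset.sum_eq_single j] at h1
  · rw [Matrix.of_apply, add_sub_cancel_right, Pi.zero_apply] at h1
    split_ifs at h1
    · exact (mul_eq_zero.1 h1).resolve_left hl
    · exact (mul_eq_zero.1 h1).resolve_left (mul_ne_zero hc hl)
  · intro j' _ hj'
    have h2 : l + j - j' ≠ l := fun h3 => hj' (by
      rw [sub_eq_iff_eq_add] at h3
      exact (add_left_cancel h3).symm)
    rw [Matrix.of_apply, hb _ h2]
    simp
  · simp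

end KummerNorm

/-! ### First order approximation -/

section Close

variable {B : Type u} [CommRing B]

/-- `a` and `c` agree modulo `𝔪`, the changes from `a` to `a'` and from `c` to `c'` lie in `𝔧`, and
they agree modulo `𝔪 𝔧`. -/
structure Close (𝔪 𝔧 : Ideal B) (a a' c c' : B) : Prop where
  fst : a - c ∈ 𝔪
  snd : a' - c' ∈ 𝔪
  left : a' - a ∈ 𝔧
  right : c' - c ∈ 𝔧
  diff : a' - a - (c' - c) ∈ 𝔪 * 𝔧

variable {𝔪 𝔧 : Ideal B}

theorem Close.mul {a a' b b' c c' d d' : B} (h : Close 𝔪 𝔧 a a' c c') (h' : Close 𝔪 𝔧 b b' d d') :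
    Close 𝔪 𝔧 (a * b) (a' * b') (c * d) (c' * d') where
  fst := by
    have : a * b - c * d = b * (a - c) + c * (b - d) := by ring
    rw [this]
    exact 𝔪.add_mem (𝔪.mul_mem_left _ h.fst) (𝔪.mul_mem_left _ h'.fst)
  snd := by
    have : a' * b' - c' * d' = b' * (a' - c') + c' * (b' - d') := by ring
    rw [this]
    exact 𝔪.add_mem (𝔪.mul_mem_left _ h.snd) (𝔪.mul_mem_left _ h'.snd)
  left := by
    have : a' * b' - a * b = b' * (a' - a) + a * (b' - b) := by ring
    rw [this]
    exact 𝔧.add_mem (𝔧.mul_mem_left _ h.left) (𝔧.mul_mem_left _ h'.left)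
  right := by
    have : c' * d' - c * d = d' * (c' - c) + c * (d' - d) := by ring
    rw [this]
    exact 𝔧.add_mem (𝔧.mul_mem_left _ h.right) (𝔧.mul_mem_left _ h'.right)
  diff := by
    have : a' * b' - a * b - (c' * d' - c * d) = b' * (a' - a - (c' - c)) +
        (b' - d') * (c' - c) + a * (b' - b - (d' - d)) + (a - c) * (d' - d) := by ring
    rw [this]
    exact Ideal.add_mem _ (Ideal.add_mem _ (Ideal.add_mem _ (Ideal.mul_mem_left _ _ h.diff)
      (Ideal.mul_mem_mul h'.snd h.right)) (Ideal.mul_mem_left _ _ h'.diff))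
      (Ideal.mul_mem_mul h.fst h'.right)

theorem Close.prod {ι : Type} {s : Finset ι} {a a' c c' : ι → B}
    (h : ∀ i ∈ s, Close 𝔪 𝔧 (a i) (a' i) (c i) (c' i)) :
    Close 𝔪 𝔧 (∏ i ∈ s, a i) (∏ i ∈ s, a' i) (∏ i ∈ s, c i) (∏ i ∈ s, c' i) := by
  classical
  induction s using Finset.induction_on with
  | empty => exact ⟨by simp, by simp, by simp, by simp, by simp⟩
  | insert i s hi ih =>
    rw [Finset.prod_insert hi, Finset.prod_insert hi, Finset.prod_insert hi, Finset.prod_insert hi]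
    exact (h i (Finset.mem_insert_self _ _)).mul
      (ih fun j hj => h j (Finset.mem_insert_of_mem hj))

theorem close_pow_add_eval {q : Polynomial B} (hq : ∀ i, q.coeff i ∈ 𝔪) {x x' : B}
    (hx : x' - x ∈ 𝔧) (m : ℕ) :
    Close 𝔪 𝔧 (x ^ m + q.eval x) (x' ^ m + q.eval x') (x ^ m) (x' ^ m) := by
  have hpow : ∀ m, x' ^ m - x ^ m ∈ 𝔧 := fun m => by
    obtain ⟨d, hd⟩ := sub_dvd_pow_sub_pow x' x m
    rw [hd]
    exact 𝔧.mul_mem_right _ hx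
  have hev : ∀ x, q.eval x ∈ 𝔪 := fun x => by
    rw [Polynomial.eval_eq_sum_range]
    exact Ideal.sum_mem _ fun i _ => 𝔪.mul_mem_right _ (hq i)
  have hd : q.eval x' - q.eval x ∈ 𝔪 * 𝔧 := by
    rw [Polynomial.eval_eq_sum_range, Polynomial.eval_eq_sum_range, ← Finset.sum_sub_distrib]
    refine Ideal.sum_mem _ fun i _ => ?_
    rw [← mul_sub]
    exact Ideal.mul_mem_mul (hq i) (hpow i)
  refine ⟨by simpa using hev x, by simpa using hev x', ?_, hpow m, ?_⟩
  · rw [add_sub_add_comm]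
    have h1 : q.eval x' - q.eval x ∈ 𝔧 := (Ideal.mul_le_right : 𝔪 * 𝔧 ≤ 𝔧) hd
    exact 𝔧.add_mem (hpow m) h1
  · have : x' ^ m + q.eval x' - (x ^ m + q.eval x) - (x' ^ m - x ^ m) = q.eval x' - q.eval x := by
      ring
    rwa [this]

end Close

namespace IsKummer

open Polynomial

/-! ### Lifting solutions to Artinian rings -/

theorem eq_zero_of_isUnit_sub {R : Type u} [CommRing R] {m : ℕ} {q : R[X]}
    (hq : ∀ i, m ≤ i → q.coeff i = 0) {r : Fin m → R} (hr : ∀ i j, i ≠ j → IsUnit (r i - r j))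
    (h0 : ∀ i, q.eval (r i) = 0) : q = 0 := by
  by_contra hne
  have hd : q.natDegree < m := by
    by_contra hd
    exact hne (leadingCoeff_eq_zero.1 (hq _ (not_lt.1 hd)))
  have hu : IsUnit (Matrix.vandermonde r) := by
    rw [Matrix.isUnit_iff_isUnit_det, Matrix.det_vandermonde]
    exact IsUnit.prod_iff.2 fun i _ => IsUnit.prod_iff.2 fun j hj =>
      hr j i (Finset.mem_Ioi.1 hj).ne'
  have h1 : (fun i : Fin m => q.coeff i) = 0 := by
    refine Matrix.mulVec_injective_of_isUnit hu (funext fun i => ?_)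
    rw [Matrix.mulVec_zero, Pi.zero_apply, ← h0 i, eval_eq_sum_range' hd, Finset.sum_range,
      Matrix.mulVec, dotProduct]
    refine Finset.sum_congr rfl fun j _ => ?_
    rw [Matrix.vandermonde_apply, mul_comm]
  refine hne (Polynomial.ext fun i => ?_)
  by_cases hi : i < m
  · exact congrFun h1 ⟨i, hi⟩
  · exact hq i (not_lt.1 hi)

/-- The derivative of `(y, x) ↦ y ∏ (T + x_i)` is surjective where `y` and the differences of the
`x_i` are units, by Lagrange interpolation at the nodes `-x_i`. -/
theorem exists_linProd_approx {R : Type u} [CommRing R] {m : ℕ} (J : Ideal R)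
    {z : R × (Fin m → R)} (hy : IsUnit z.1) (hx : ∀ i j, i ≠ j → IsUnit (z.2 i - z.2 j))
    {S : R[X]} (hS : S.natDegree ≤ m) (hSJ : ∀ i, S.coeff i ∈ J) :
    ∃ z' : R × (Fin m → R), z'.1 - z.1 ∈ J ∧ (∀ i, z'.2 i - z.2 i ∈ J) ∧
      ∀ i, (linProd z' - linProd z - S).coeff i ∈ J * J := by
  classical
  have hev : ∀ r, S.eval r ∈ J := fun r => by
    rw [eval_eq_sum_range]
    exact Ideal.sum_mem _ fun i _ => J.mul_mem_right _ (hSJ i)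
  have hu : ∀ i, IsUnit (z.1 * ∏ j ∈ Finset.univ.erase i, (z.2 j - z.2 i)) := fun i =>
    hy.mul (IsUnit.prod_iff.2 fun j hj => hx j i (Finset.ne_of_mem_erase hj))
  let d : Fin m → R := fun i => ((hu i).unit⁻¹ : Rˣ) * S.eval (-z.2 i)
  have hd : ∀ i, d i ∈ J := fun i => J.mul_mem_left _ (hev _)
  have hd' : ∀ i, (z.1 * ∏ j ∈ Finset.univ.erase i, (z.2 j - z.2 i)) * d i = S.eval (-z.2 i) :=
    fun i => by
      rw [← mul_assoc, IsUnit.mul_val_inv, one_mul]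
  let z' : R × (Fin m → R) := (z.1 + S.coeff m, fun i => z.2 i + d i)
  refine ⟨z', by simpa [z'] using hSJ m, fun i => by simpa [z'] using hd i, ?_⟩
  let π := Ideal.Quotient.mk (J * J)
  have hπ : ∀ a b, a ∈ J → b ∈ J → π a * π b = 0 := fun a b ha hb => by
    rw [← map_mul, Ideal.Quotient.eq_zero_iff_mem]
    exact Ideal.mul_mem_mul ha hb
  have key : (linProd z' - linProd z - S).map π = 0 := by
    refine eq_zero_of_isUnit_sub (m := m) (r := fun i => -π (z.2 i)) (fun i hi => ?_)
      (fun i j hij => ?_) fun i => ?_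
    · rw [coeff_map, coeff_sub, coeff_sub]
      rcases hi.eq_or_lt with rfl | hi
      · rw [coeff_linProd, coeff_linProd]
        simp [z']
      · have hn : ∀ a : R × (Fin m → R), (linProd a).coeff i = 0 := fun a =>
          coeff_eq_zero_of_natDegree_lt ((natDegree_C_mul_prod_le _ _).trans_lt hi)
        rw [hn, hn, coeff_eq_zero_of_natDegree_lt (hS.trans_lt hi)]
        simp
    · rw [neg_sub_neg, ← map_sub]
      exact (hx j i hij.symm).map π
    · have h1 : ((linProd z' - linProd z - S).map π).eval (-π (z.2 i)) =
          π ((linProd z' - linProd z - S).eval (-z.2 i)) := by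
        rw [← map_neg, eval_map_apply]
      have h2 : π (∏ j ∈ Finset.univ.erase i, (z.2 j - z.2 i + d j)) * π (d i) =
          π (∏ j ∈ Finset.univ.erase i, (z.2 j - z.2 i)) * π (d i) := by
        rw [map_prod, map_prod]
        generalize Finset.univ.erase i = s
        induction s using Finset.induction_on with
        | empty => rfl
        | insert j s hj ih =>
          rw [Finset.prod_insert hj, Finset.prod_insert hj, mul_assoc, ih, map_add]
          linear_combination (∏ j ∈ s, π (z.2 j - z.2 i)) * hπ (d j) (d i) (hd j) (hd i)
      rw [h1, eval_sub, eval_sub, eval_linProd_neg, sub_zero, linProd, eval_mul, eval_prod, eval_C,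
        ← Finset.mul_prod_erase _ _ (Finset.mem_univ i)]
      have h3 : ∀ j, eval (-z.2 i) (X + C (z'.2 j)) = z.2 j - z.2 i + d j := fun j => by
        simp [z']
        ring
      simp only [h3]
      rw [sub_self, zero_add, ← hd']
      simp only [map_sub, map_mul, z', map_add] at h2 ⊢
      linear_combination (π z.1 + π (S.coeff m)) * h2 +
        π (∏ j ∈ Finset.univ.erase i, (z.2 j - z.2 i)) * hπ (S.coeff m) (d i) (hSJ m) (hd i)
  intro i
  rw [← Ideal.Quotient.eq_zero_iff_mem]
  have := congrArg (fun q => coeff q i) key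
  simpa [coeff_map] using this

variable {F : Type u} [Field F] {A : Type u} [CommRing A] [Algebra F A] {p : ℕ} {ε : A} {e : F}
  {w : F[X]} {ζ : F}

/-- The corresponding statement for `(y, x) ↦ (y ∏ (ε + x_i)) ^ p`. -/
theorem exists_pow_linProd_approx [CharZero F] (h : IsKummer F A p ε e) (hp : 0 < p) {R : Type u}
    [CommRing R] [Algebra F R] {I J : Ideal R} (hJI : J ≤ I) {z : R × (Fin (p - 1) → R)}
    (hV : IsUnit (ev F ε R (linProd z)))
    (hy : IsUnit z.1) (hx : ∀ i j, i ≠ j → IsUnit (z.2 i - z.2 j)) {d : R ⊗[F] A}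
    (hd : d ∈ J.map (algebraMap R (R ⊗[F] A))) :
    ∃ z' : R × (Fin (p - 1) → R), z'.1 - z.1 ∈ J ∧ (∀ i, z'.2 i - z.2 i ∈ J) ∧
      ev F ε R (linProd z') ^ p - ev F ε R (linProd z) ^ p - d ∈
        I.map (algebraMap R (R ⊗[F] A)) * J.map (algebraMap R (R ⊗[F] A)) := by
  have hpu : IsUnit ((p : ℕ) : R ⊗[F] A) := by
    have h2 := (IsUnit.mk0 (p : F) (Nat.cast_ne_zero.2 hp.ne')).map (algebraMap F (R ⊗[F] A))
    simpa using h2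
  obtain ⟨u, hu⟩ := hpu.mul (hV.pow (p - 1))
  obtain ⟨S, hS, hSJ, hSd⟩ := h.exists_ev_eq_of_mem hp
    (Ideal.mul_mem_left _ ((u⁻¹ : (R ⊗[F] A)ˣ) : R ⊗[F] A) hd)
  obtain ⟨z', h1, h2, h3⟩ := exists_linProd_approx J hy hx (S := S) (by omega) hSJ
  refine ⟨z', h1, h2, ?_⟩
  set V := ev F ε R (linProd z) with hVdef
  have hle : J.map (algebraMap R (R ⊗[F] A)) * J.map (algebraMap R (R ⊗[F] A)) ≤
      I.map (algebraMap R (R ⊗[F] A)) * J.map (algebraMap R (R ⊗[F] A)) :=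
    Ideal.mul_mono_left (Ideal.map_mono hJI)
  have hr : ev F ε R (linProd z' - linProd z - S) ∈
      J.map (algebraMap R (R ⊗[F] A)) * J.map (algebraMap R (R ⊗[F] A)) := by
    rw [← Ideal.map_mul, aeval_eq_sum_range]
    refine Ideal.sum_mem _ fun i _ => ?_
    rw [Algebra.smul_def]
    exact Ideal.mul_mem_right _ _ (Ideal.mem_map_of_mem _ (h3 i))
  set r := ev F ε R (linProd z' - linProd z - S) with hrdef
  have hs : ev F ε R S ∈ J.map (algebraMap R (R ⊗[F] A)) := by
    rw [hSd]
    exact Ideal.mul_mem_left _ _ hd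
  have hrJ : r ∈ J.map (algebraMap R (R ⊗[F] A)) := (Ideal.mul_le_right) hr
  have hV' : ev F ε R (linProd z') = V + (ev F ε R S + r) := by
    rw [hrdef, map_sub, map_sub]
    ring
  obtain ⟨k, hk⟩ := Polynomial.powAddExpansion V (ev F ε R S + r) p
  have hsu : (p : R ⊗[F] A) * V ^ (p - 1) * ev F ε R S = d := by
    rw [hSd, ← hu, Units.mul_inv_cancel_left]
  have : ev F ε R (linProd z') ^ p - V ^ p - d =
      (p : R ⊗[F] A) * V ^ (p - 1) * r + k * ((ev F ε R S + r) * (ev F ε R S + r)) := by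
    rw [hV', hk]
    linear_combination hsu
  rw [this]
  refine hle (Ideal.add_mem _ (Ideal.mul_mem_left _ _ hr) (Ideal.mul_mem_left _ _ ?_))
  exact Ideal.mul_mem_mul (Ideal.add_mem _ hs hrJ) (Ideal.add_mem _ hs hrJ)

/-- The norm of `y (b₀ ⊗ (b₁ + ε) ⊗ ⋯ ⊗ (b_{p-1} + ε))`, as a function of `y` and of the constant
coefficients `x_i` of the `b_i`. -/
noncomputable def normFun (F : Type u) [Field F] {A : Type u} [CommRing A] [Algebra F A] {p : ℕ}
    [NeZero p] (ε : A) {R : Type u} [CommRing R] [Algebra F R] (N₀ : R) (c : Fin (p - 1) → R)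
    (b : Fin (p - 1) → Fin p → R) (z : R × (Fin (p - 1) → R)) : R ⊗[F] A :=
  algebraMap R (R ⊗[F] A) (z.1 ^ p * N₀) * ∏ i, kummerNorm (algebraMap R (R ⊗[F] A) (c i))
    (Function.update (fun j => algebraMap R (R ⊗[F] A) (b i j)) 0
      (algebraMap R (R ⊗[F] A) (z.2 i) + (1 : R) ⊗ₜ[F] ε))

theorem ev_linProd_pow {R : Type u} [CommRing R] [Algebra F R] (z : R × (Fin (p - 1) → R)) :
    ev F ε R (linProd z) ^ p = algebraMap R (R ⊗[F] A) z.1 ^ p *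
      ∏ i, (algebraMap R (R ⊗[F] A) (z.2 i) + (1 : R) ⊗ₜ[F] ε) ^ p := by
  rw [linProd, map_mul, map_prod, mul_pow, ← Finset.prod_pow, aeval_C]
  congr 1
  refine Finset.prod_congr rfl fun i _ => ?_
  rw [map_add, aeval_X, aeval_C, add_comm]

section Lift

variable [NeZero p] {R : Type u} [CommRing R] [Algebra F R]

theorem normFun_eq {I : Ideal R} (hI : I * I = ⊥) {N₀ : R} (hN₀ : N₀ = 1) {c : Fin (p - 1) → R}
    {b : Fin (p - 1) → Fin p → R} (hb : ∀ i j, j ≠ 0 → b i j ∈ I) (z : R × (Fin (p - 1) → R)) :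
    normFun F ε N₀ c b z = ev F ε R (linProd z) ^ p := by
  rw [ev_linProd_pow, normFun, hN₀, mul_one, map_pow]
  congr 1
  refine Finset.prod_congr rfl fun i _ => ?_
  rw [kummerNorm_eq_pow (I := I.map (algebraMap R (R ⊗[F] A))), Function.update_self]
  · rw [← Ideal.map_mul, hI, Ideal.map_bot]
  · intro j hj
    rw [Function.update_of_ne hj]
    exact Ideal.mem_map_of_mem _ (hb i j hj)

theorem close_normFun {I J : Ideal R} {N₀ : R} (hN₀ : N₀ - 1 ∈ I) {c : Fin (p - 1) → R}
    {b : Fin (p - 1) → Fin p → R} (hb : ∀ i j, j ≠ 0 → b i j ∈ I) {z z' : R × (Fin (p - 1) → R)}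
    (h1 : z'.1 - z.1 ∈ J) (h2 : ∀ i, z'.2 i - z.2 i ∈ J) :
    Close (I.map (algebraMap R (R ⊗[F] A))) (J.map (algebraMap R (R ⊗[F] A)))
      (normFun F ε N₀ c b z) (normFun F ε N₀ c b z')
      (ev F ε R (linProd z) ^ p) (ev F ε R (linProd z') ^ p) := by
  rw [ev_linProd_pow, ev_linProd_pow, normFun, normFun]
  refine Close.mul ?_ (Close.prod fun i _ => ?_)
  · have hN : algebraMap R (R ⊗[F] A) N₀ - 1 ∈ I.map (algebraMap R (R ⊗[F] A)) := by
      have := Ideal.mem_map_of_mem (algebraMap R (R ⊗[F] A)) hN₀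
      rwa [map_sub, map_one] at this
    have hy : algebraMap R (R ⊗[F] A) z'.1 ^ p - algebraMap R (R ⊗[F] A) z.1 ^ p ∈
        J.map (algebraMap R (R ⊗[F] A)) := by
      obtain ⟨d, hd⟩ := sub_dvd_pow_sub_pow z'.1 z.1 p
      rw [← map_pow, ← map_pow, ← map_sub, hd]
      exact Ideal.mem_map_of_mem _ (J.mul_mem_right _ h1)
    rw [map_mul, map_mul, map_pow, map_pow]
    generalize algebraMap R (R ⊗[F] A) N₀ = N at *
    generalize algebraMap R (R ⊗[F] A) z.1 ^ p = a at *
    generalize algebraMap R (R ⊗[F] A) z'.1 ^ p = a' at *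
    refine ⟨?_, ?_, ?_, hy, ?_⟩
    · have : a * N - a = a * (N - 1) := by ring
      rw [this]
      exact Ideal.mul_mem_left _ _ hN
    · have : a' * N - a' = a' * (N - 1) := by ring
      rw [this]
      exact Ideal.mul_mem_left _ _ hN
    · rw [← sub_mul]
      exact Ideal.mul_mem_right _ _ hy
    · have : a' * N - a * N - (a' - a) = (N - 1) * (a' - a) := by ring
      rw [this]
      exact Ideal.mul_mem_mul hN hy
  · obtain ⟨q, hq, h⟩ := exists_kummerNorm_update (I.map (algebraMap R (R ⊗[F] A)))
      (algebraMap R (R ⊗[F] A) (c i)) (b := fun j => algebraMap R (R ⊗[F] A) (b i j))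
      fun j hj => Ideal.mem_map_of_mem _ (hb i j hj)
    rw [h, h]
    refine close_pow_add_eval (fun i => Ideal.mul_le_right (hq i)) ?_ p
    rw [add_sub_add_right_eq_sub, ← map_sub]
    exact Ideal.mem_map_of_mem _ (h2 i)

/-- Newton's method: solutions of `N = w` can be lifted along surjections of local Artinian rings.
-/
theorem exists_normFun_eq [CharZero F] (hw : IsGeneric F p ε e w) (h : IsKummer F A p ε e)
    (hζ : IsPrimitiveRoot ζ p) (he : e ≠ 0) [IsLocalRing R] [IsArtinianRing R] {I : Ideal R}
    (hI : I ≤ IsLocalRing.maximalIdeal R) {N₀ : R} (hN₀ : N₀ - 1 ∈ IsLocalRing.maximalIdeal R)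
    {c : Fin (p - 1) → R} {b : Fin (p - 1) → Fin p → R}
    (hb : ∀ i j, j ≠ 0 → b i j ∈ IsLocalRing.maximalIdeal R) {z : R × (Fin (p - 1) → R)}
    (hy : IsUnit z.1) (hx : ∀ i j, i ≠ j → IsUnit (z.2 i - z.2 j))
    (hz : normFun F ε N₀ c b z - ev F ε R (w.map (algebraMap F R)) ∈
      I.map (algebraMap R (R ⊗[F] A))) :
    ∃ z' : R × (Fin (p - 1) → R), z'.1 - z.1 ∈ I ∧ (∀ i, z'.2 i - z.2 i ∈ I) ∧
      normFun F ε N₀ c b z' = ev F ε R (w.map (algebraMap F R)) := by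
  have hp : 0 < p := Nat.pos_of_neZero p
  set 𝔪 := IsLocalRing.maximalIdeal R with h𝔪
  set W := ev F ε R (w.map (algebraMap F R)) with hW
  obtain ⟨N, hN⟩ : IsNilpotent 𝔪 := by
    rw [h𝔪, ← IsLocalRing.jacobson_eq_maximalIdeal ⊥ bot_ne_top]
    exact IsArtinianRing.isNilpotent_jacobson_bot
  have hnil : ∀ s ∈ 𝔪.map (algebraMap R (R ⊗[F] A)), IsNilpotent s := fun s hs => by
    refine ⟨N, ?_⟩
    have h1 := Ideal.pow_mem_pow hs N
    rw [← Ideal.map_pow, hN, Ideal.zero_eq_bot, Ideal.map_bot] at h1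
    exact h1
  have key : ∀ m : ℕ, ∃ z' : R × (Fin (p - 1) → R), z'.1 - z.1 ∈ I ∧ (∀ i, z'.2 i - z.2 i ∈ I) ∧
      normFun F ε N₀ c b z' - W ∈ (𝔪 ^ m * I).map (algebraMap R (R ⊗[F] A)) := by
    intro m
    induction m with
    | zero => exact ⟨z, by simp, by simp, by simpa using hz⟩
    | succ m ih =>
      obtain ⟨z₁, h1, h2, h3⟩ := ih
      have hJ : 𝔪 ^ m * I ≤ I := Ideal.mul_le_right
      have hu : ∀ {a a' : R}, IsUnit a → a' - a ∈ I → IsUnit a' := fun {a a'} ha hd => by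
        by_contra h0
        have h1 : a' ∈ 𝔪 := (IsLocalRing.mem_maximalIdeal _).2 h0
        have h2 := 𝔪.sub_mem h1 (hI hd)
        rw [sub_sub_cancel] at h2
        exact (IsLocalRing.mem_maximalIdeal _).1 h2 ha
      have hy₁ : IsUnit z₁.1 := hu hy h1
      have hx₁ : ∀ i j, i ≠ j → IsUnit (z₁.2 i - z₁.2 j) := fun i j hij =>
        hu (hx i j hij) (by
          rw [sub_sub_sub_comm]
          exact I.sub_mem (h2 i) (h2 j))
      have hV₁ : IsUnit (ev F ε R (linProd z₁)) := by
        have hc := (close_normFun (F := F) (ε := ε) hN₀ hb (c := c) (J := I) (z := z₁) (z' := z₁)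
          (by simp) (by simp)).fst
        have h4 : ev F ε R (linProd z₁) ^ p - W ∈ 𝔪.map (algebraMap R (R ⊗[F] A)) := by
          have h5 := Ideal.sub_mem _ (Ideal.map_mono (hJ.trans hI) h3) hc
          rwa [sub_sub_sub_cancel_left] at h5
        rw [← isUnit_pow_iff hp.ne', ← add_sub_cancel W (ev F ε R (linProd z₁) ^ p)]
        exact (hnil _ h4).isUnit_add_left_of_commute (hw.isUnit h hp hζ he R) (Commute.all _ _)
      obtain ⟨z₂, h5, h6, h7⟩ := h.exists_pow_linProd_approx hp (hJ.trans hI) hV₁ hy₁ hx₁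
        ((Ideal.neg_mem_iff _).2 h3)
      refine ⟨z₂, ?_, fun i => ?_, ?_⟩
      · rw [← sub_add_sub_cancel _ z₁.1]
        exact I.add_mem (hJ h5) h1
      · rw [← sub_add_sub_cancel _ (z₁.2 i)]
        exact I.add_mem (hJ (h6 i)) (h2 i)
      · have hc := (close_normFun (F := F) (ε := ε) hN₀ hb (c := c) h5 h6).diff
        have h8 := Ideal.add_mem _ hc h7
        rw [pow_succ', mul_assoc, Ideal.map_mul]
        convert h8 using 1
        ring
  obtain ⟨z', h1, h2, h3⟩ := key N
  refine ⟨z', h1, h2, sub_eq_zero.1 ?_⟩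
  rw [hN, zero_mul, Ideal.zero_eq_bot, Ideal.map_bot] at h3
  exact h3

end Lift

end IsKummer

/-! ### Coordinates on `ℙ(L ⊕ 𝒪)` -/

namespace PL

variable {k : Type u} [Field k] {p n : ℕ} {S : Shape n} (J : FormLine k p S)

variable {J} in
/-- The coordinate `y`. -/
abbrev iY : (shapePL J).total.ι := .inr (.inr true)

variable {J} in
/-- The coordinate `t`. -/
abbrev iTT : (shapePL J).total.ι := .inr (.inr false)

variable {J} in
/-- The coordinates of `b₀`. -/
abbrev iB₀ (j : Fin p) : (shapePL J).total.ι := .inr (.inl (.inl (.inr j)))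

variable {J} in
/-- The coordinates of `b₁, …, b_{p-1}`. -/
abbrev iB (a : Fin (p - 1)) (j : Fin p) : (shapePL J).total.ι :=
  .inr (.inl (.inr (a, .inr (some j))))

variable {J} in
/-- The coordinates `t₁, …, t_{p-1}`. -/
abbrev iT (a : Fin (p - 1)) : (shapePL J).total.ι := .inr (.inl (.inr (a, .inr none)))

/-- The projections to the factors `ℙ(ℬ)` of `U`. -/
noncomputable def forgetB (a : Fin (p - 1)) : Shape.Forget (shapePL J).total (shapePB J).total :=
  (RelShape.forgetPow (shapePB J) (p - 1) a).comp
    ((RelShape.forgetSnd (shapePA J) ((shapePB J).pow (p - 1))).comp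
      (RelShape.forgetProj (shapeU J) _))

/-- The projection to the factor `ℙ(𝒜)` of `U`. -/
noncomputable def forgetA : Shape.Forget (shapePL J).total (shapePA J).total :=
  (RelShape.forgetFst (shapePA J) ((shapePB J).pow (p - 1))).comp
    (RelShape.forgetProj (shapeU J) _)

/-- The `p` projections to `S`. -/
noncomputable def forgetS : Option (Fin (p - 1)) → Shape.Forget (shapePL J).total S
  | none => (RelShape.forgetOverPt S).comp
      ((RelShape.forgetProj (RelShape.overPt S) (lineA J)).comp (forgetA J))
  | some a => (RelShape.forgetOverPt S).comp
      ((RelShape.forgetProj (RelShape.overPt S) (lineB J)).comp (forgetB J a))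

variable {J}

theorem forgetS_none_i (c : S.ι) : (forgetS J none).i c = .inr (.inl (.inl (.inl c))) := rfl

theorem forgetS_some_i (a : Fin (p - 1)) (c : S.ι) :
    (forgetS J (some a)).i c = .inr (.inl (.inr (a, .inl c))) := rfl

theorem forall_ι {q : (shapePL J).total.ι → Prop} :
    (∀ i, q i) ↔ (∀ o c, q ((forgetS J o).i c)) ∧ (∀ j, q (iB₀ j)) ∧ (∀ a j, q (iB a j)) ∧
      (∀ a, q (iT a)) ∧ q iY ∧ q iTT := by
  constructor
  · intro h
    exact ⟨fun _ _ => h _, fun _ => h _, fun _ _ => h _, fun _ => h _, h _, h _⟩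
  · rintro ⟨h1, h2, h3, h4, h5, h6⟩ (i | ((i | i) | ⟨a, i | _ | i⟩) | _ | _)
    · exact i.elim
    · exact h1 none i
    · exact h2 i
    · exact h1 (some a) i
    · exact h4 a
    · exact h3 a i
    · exact h6
    · exact h5

/-! ### Characters at the fixed points -/

theorem lineChar_lineA (P : (RelShape.overPt S).total.FixPt) (j : Fin p) :
    P.lineChar (lineA J j) = (j : ℤ) • ((RelShape.forgetOverPt S).push P).lineChar J.toLine := by
  rw [lineA, Shape.FixPt.lineChar_npow, FormLine.lineChar_overPt]

theorem coordChar_iB₀ {P : (shapePL J).total.FixPt} {j₀ : Fin p}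
    (h : P.σ (.inr (.inl (.inl (.inr ())))) = iB₀ j₀) (j : Fin p) :
    P.coordChar (iB₀ j) = ((j : ℤ) - j₀) • ((forgetS J none).push P).lineChar J.toLine := by
  have h1 : ((forgetA J).push P).σ (.inr (.inr ())) = .inr (.inr j₀) :=
    (forgetA J).i_inj (((forgetA J).i_push_σ P _).trans h)
  have h2 := (forgetA J).coordChar_i P (.inr (.inr j))
  have h3 : P.coordChar (iB₀ j) = _ := h2.trans (RelShape.coordChar_proj (lineA J) _ h1 j)
  rw [h3, lineChar_lineA, lineChar_lineA, ← sub_smul, ← Shape.Forget.push_comp,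
    ← Shape.Forget.push_comp]
  rfl

theorem coordChar_iB_none {P : (shapePL J).total.FixPt} {a : Fin (p - 1)}
    (h : P.σ (.inr (.inl (.inr (a, .inr ())))) = iT a) (j : Fin p) :
    P.coordChar (iB a j) = (j : ℤ) • ((forgetS J (some a)).push P).lineChar J.toLine := by
  have h1 : ((forgetB J a).push P).σ (.inr (.inr ())) = .inr (.inr none) :=
    (forgetB J a).i_inj (((forgetB J a).i_push_σ P _).trans h)
  have h2 := (forgetB J a).coordChar_i P (.inr (.inr (some j)))
  have h3 : P.coordChar (iB a j) = _ := h2.trans (RelShape.coordChar_proj (lineB J) _ h1 (some j))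
  rw [h3, lineB, lineB, Shape.FixPt.lineChar_one, sub_zero, lineChar_lineA,
    ← Shape.Forget.push_comp, ← Shape.Forget.push_comp]
  rfl

theorem coordChar_iB_some {P : (shapePL J).total.FixPt} {a : Fin (p - 1)} {j₀ : Fin p}
    (h : P.σ (.inr (.inl (.inr (a, .inr ())))) = iB a j₀) (j : Fin p) :
    P.coordChar (iB a j) = ((j : ℤ) - j₀) • ((forgetS J (some a)).push P).lineChar J.toLine := by
  have h1 : ((forgetB J a).push P).σ (.inr (.inr ())) = .inr (.inr (some j₀)) :=
    (forgetB J a).i_inj (((forgetB J a).i_push_σ P _).trans h)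
  have h2 := (forgetB J a).coordChar_i P (.inr (.inr (some j)))
  have h3 : P.coordChar (iB a j) = _ := h2.trans (RelShape.coordChar_proj (lineB J) _ h1 (some j))
  rw [h3, lineB, lineB, lineChar_lineA, lineChar_lineA, ← sub_smul,
    ← Shape.Forget.push_comp, ← Shape.Forget.push_comp]
  rfl

theorem coordChar_iY {P : (shapePL J).total.FixPt} {j₀ : Fin p}
    (h₀ : P.σ (.inr (.inl (.inl (.inr ())))) = iB₀ j₀)
    (h : ∀ a, P.σ (.inr (.inl (.inr (a, .inr ())))) = iT a) (hT : P.σ (.inr (.inr ())) = iTT) :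
    P.coordChar iY = (j₀ : ℤ) • ((forgetS J none).push P).lineChar J.toLine := by
  have h1 : ((forgetA J).push P).σ (.inr (.inr ())) = .inr (.inr j₀) :=
    (forgetA J).i_inj (((forgetA J).i_push_σ P _).trans h₀)
  have h2 : ∀ a, ((forgetB J a).push P).σ (.inr (.inr ())) = .inr (.inr none) := fun a =>
    (forgetB J a).i_inj (((forgetB J a).i_push_σ P _).trans (h a))
  have h3 := RelShape.coordChar_proj (fun b : Bool => bif b then lineL J else Line.one) P hT true
  rw [cond_true, cond_false, Shape.FixPt.lineChar_one, sub_zero] at h3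
  refine h3.trans ((RelShape.lineChar_lineMul _ _ _).trans ?_)
  rw [RelShape.lineChar_linePow]
  have h4 : ((forgetA J).push P).lineChar ((RelShape.overPt S).taut (lineA J)) = _ :=
    RelShape.lineChar_taut (lineA J) _ h1
  have h5 : ∀ a, ((forgetB J a).push P).lineChar ((RelShape.overPt S).taut (lineB J)) = _ :=
    fun a =>
    RelShape.lineChar_taut (lineB J) _ (h2 a)
  rw [lineChar_lineA, ← Shape.Forget.push_comp, ← Shape.Forget.push_comp] at h4
  refine (congrArg₂ (· + ·) h4 (Finset.sum_eq_zero fun a _ => ?_)).trans (add_zero _)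
  rw [← Shape.Forget.push_comp, ← Shape.Forget.push_comp]
  exact (h5 a).trans (Shape.FixPt.lineChar_one _)

/-! ### Coordinates of the fixed points -/

/-- A family of fixed points of `S` determines a fixed point of `ℙ(L ⊕ 𝒪)`, at which `b₀ = 1`,
`b_i = 0`, `t_i = 1`, and `[α : t] = [0 : 1]`. -/
noncomputable def baseSection [NeZero p] (Q : Option (Fin (p - 1)) → S.FixPt) :
    (shapePL J).total.β → (shapePL J).total.ι :=
  Sum.elim nofun (Sum.elim (Sum.elim
    (Sum.elim (fun b => (forgetS J none).i ((Q none).σ b)) fun _ => iB₀ 0)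
    fun b => Sum.elim (fun c => (forgetS J (some b.1)).i ((Q (some b.1)).σ c))
      (fun _ => iT b.1) b.2)
    fun _ => iTT)

theorem blk_baseSection [NeZero p] (Q : Option (Fin (p - 1)) → S.FixPt) :
    ∀ b, (shapePL J).total.blk (baseSection (J := J) Q b) = b := by
  rintro (b | ((b | b) | ⟨a, b | b⟩) | b)
  · exact b.elim
  · simp [baseSection, forgetS, forgetA, RelShape.forgetOverPt, RelShape.forgetProj,
      RelShape.forgetFst,
      Shape.Forget.comp, (Q none).blk_σ]
  · rfl
  · simp [baseSection, forgetS, forgetB, RelShape.forgetOverPt, RelShape.forgetProj,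
      RelShape.forgetSnd,
      RelShape.forgetPow, Shape.Forget.comp, (Q (some a)).blk_σ]
  · rfl
  · rfl

/-- The coordinates of the fixed points of `Ȳ_w`. -/
noncomputable def coord [NeZero p] (Q : Option (Fin (p - 1)) → S.FixPt) {R : Type u} [CommRing R]
    (z : R × (Fin (p - 1) → R)) : (shapePL J).total.ι → R :=
  Sum.elim nofun (Sum.elim (Sum.elim
    (Sum.elim ((Q none).point R) fun j => if j = 0 then 1 else 0)
    fun b => Sum.elim ((Q (some b.1)).point R)
      (fun j => j.elim 1 fun j => if j = 0 then z.2 b.1 else 0) b.2)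
    fun c => bif c then z.1 else 1)

variable [NeZero p] {R : Type u} [CommRing R] (Q : Option (Fin (p - 1)) → S.FixPt)
  (z : R × (Fin (p - 1) → R))

theorem coord_S (o : Option (Fin (p - 1))) (c : S.ι) :
    coord (J := J) Q z ((forgetS J o).i c) = (Q o).point R c := by
  cases o <;> rfl

theorem coord_B₀ (j : Fin p) : coord (J := J) Q z (iB₀ j) = if j = 0 then 1 else 0 := rfl

theorem coord_B (a : Fin (p - 1)) (j : Fin p) :
    coord (J := J) Q z (iB a j) = if j = 0 then z.2 a else 0 := rfl

theorem coord_T (a : Fin (p - 1)) : coord (J := J) Q z (iT a) = 1 := rfl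

theorem coord_TT : coord (J := J) Q z iTT = 1 := rfl

theorem coord_baseSection (b) : coord (J := J) Q z (baseSection Q b) = 1 := by
  rcases b with b | ((b | b) | ⟨a, b | b⟩) | b
  · exact b.elim
  · exact (coord_S Q z none _).trans ((Q none).point_σ R b)
  · simp [baseSection, coord_B₀]
  · exact (coord_S Q z (some a) _).trans ((Q (some a)).point_σ R b)
  · rfl
  · rfl

theorem map_coord {R' : Type u} [CommRing R'] (f : R →+* R') (i) :
    f (coord (J := J) Q z i) = coord (J := J) Q (f z.1, fun a => f (z.2 a)) i := by
  revert i
  rw [forall_ι]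
  refine ⟨fun o c => ?_, fun j => ?_, fun a j => ?_, fun a => ?_, rfl, ?_⟩
  · rw [coord_S, coord_S, Shape.FixPt.map_point]
  · rw [coord_B₀, coord_B₀]
    split_ifs <;> simp
  · rw [coord_B, coord_B]
    split_ifs <;> simp
  · simp [coord_T]
  · simp [coord_TT]

variable {Q z}

theorem push_forgetS (hS : Shape.Unimodular.{0} S) {P : (shapePL J).total.FixPt}
    (hP : P.σ = baseSection Q) (o : Option (Fin (p - 1))) : (forgetS J o).push P = Q o := by
  refine Shape.FixPt.eq_of_σ_eq hS (funext fun b => (forgetS J o).i_inj ?_)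
  rw [Shape.Forget.i_push_σ, hP]
  cases o <;> rfl

end PL

/-! ### Nondegenerate line bundles -/

theorem red_smul_ne_zero {p n : ℕ} [Fact p.Prime] {c : Fin n → ℤ} (hc : red p c ≠ 0) {j l : Fin p}
    (h : j ≠ l) : red p (((j : ℤ) - l) • c) ≠ 0 := by
  rw [red_zsmul]
  refine smul_ne_zero ?_ hc
  push_cast
  rw [sub_ne_zero]
  intro h0
  have h1 := (ZMod.natCast_eq_natCast_iff' _ _ _).1 h0
  rw [Nat.mod_eq_of_lt j.2, Nat.mod_eq_of_lt l.2] at h1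
  exact h (Fin.ext h1)

/-- The properties of the line bundle `J` on the variety `S` of the chain lemma that are used:
`μ_pⁿ` has isolated fixed points on `S`, and at each of them it acts nontrivially on the fibre of
`J`, and the `p`-form of `J` does not vanish. -/
structure FormLine.IsNondegenerate {k : Type u} [Field k] {p n : ℕ} {S : Shape n}
    (J : FormLine k p S) : Prop where
  unimodular : Shape.Unimodular.{u} S
  unimodular₀ : Shape.Unimodular.{0} S
  finite : Finite S.ι
  regular : ∀ P : S.FixPt, P.Regular p
  char_ne : ∀ P : S.FixPt, red p (P.lineChar J.toLine) ≠ 0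
  form_ne : ∀ P : S.FixPt, P.formAt J ≠ 0

namespace PL

open Polynomial

section Unimodular

universe v

variable {k : Type u} [Field k] {p n : ℕ} {S : Shape n} (J : FormLine k p S)

theorem unimodular_shapePA (hS : Shape.Unimodular.{v} S) :
    Shape.Unimodular.{v} (shapePA J).total :=
  RelShape.Unimodular.total Shape.unimodular_pt ((RelShape.Unimodular.overPt hS).proj _)

theorem unimodular_shapePL (hS : Shape.Unimodular.{v} S) :
    Shape.Unimodular.{v} (shapePL J).total :=
  RelShape.Unimodular.total Shape.unimodular_pt ((((RelShape.Unimodular.overPt hS).proj _).mul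
    (((RelShape.Unimodular.overPt hS).proj _).pow _)).proj _)

end Unimodular

variable {k : Type u} [Field k] {p n : ℕ} {S : Shape n} {J : FormLine k p S}
  {A : Type u} [CommRing A] [Algebra k A] {ε : A} {w : k[X]}

/-! ### The equation of `Ȳ_w` where all `t_i` and `t` are `1` -/

section Equation

variable [NeZero p] {R : Type u} [CommRing R] [Algebra k R]

theorem normα_eq_normFun {x : (shapePL J).total.ι → R} (ht : ∀ a, x (iT a) = 1) :
    normα x A ε = IsKummer.normFun k ε (norm₀ x) (fun a => MvPolynomial.aeval (s x a) J.form) (b x)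
      (x iY, fun a => x (iB a 0)) := by
  rw [normα, IsKummer.normFun]
  congr 1
  refine Finset.prod_congr rfl fun a _ => ?_
  rw [norm]
  congr 1
  funext j
  by_cases hj : j = 0
  · subst hj
    have h1 : t x a = 1 := ht a
    rw [Function.update_self, h1]
    simp [b]
  · have hj' : (j : ℕ) ≠ 0 := fun h => hj (Fin.ext h)
    rw [Function.update_of_ne hj, if_neg hj', add_zero]

theorem one_tmul_aeval : (1 : R) ⊗ₜ[k] (aeval ε w) =
    IsKummer.ev k ε R (w.map (algebraMap k R)) := by
  rw [IsKummer.ev, aeval_map_algebraMap]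
  have : (1 : R) ⊗ₜ[k] (aeval ε w) = Algebra.TensorProduct.includeRight (R := k) (aeval ε w) := rfl
  rw [this, ← aeval_algHom_apply]
  rfl

theorem eqn_iff {x : (shapePL J).total.ι → R} (ht : ∀ a, x (iT a) = 1) (hT : x iTT = 1) :
    (locusY J A ε (aeval ε w)).eqn R x ↔
      IsKummer.normFun k ε (norm₀ x) (fun a => MvPolynomial.aeval (s x a) J.form) (b x)
        (x iY, fun a => x (iB a 0)) = IsKummer.ev k ε R (w.map (algebraMap k R)) := by
  have hT' : tt x = 1 := hT
  rw [← normα_eq_normFun ht, ← one_tmul_aeval]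
  change normα x A ε = algebraMap R (R ⊗[k] A) (tt x ^ p) * ((1 : R) ⊗ₜ[k] aeval ε w) ↔ _
  rw [hT', one_pow, map_one, one_mul]

theorem eqn_iff_mem_Sol {I : Ideal R} (hI : I * I = ⊥) {x : (shapePL J).total.ι → R}
    (ht : ∀ a, x (iT a) = 1) (hT : x iTT = 1) (h₀ : x (iB₀ 0) = 1)
    (hB₀ : ∀ j, j ≠ 0 → x (iB₀ j) ∈ I) (hB : ∀ a j, j ≠ 0 → x (iB a j) ∈ I) :
    (locusY J A ε (aeval ε w)).eqn R x ↔
      (x iY, fun a => x (iB a 0)) ∈ IsKummer.Sol k p ε w R := by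
  have hN : norm₀ x = 1 := by
    have h1 : b₀ x 0 = 1 := h₀
    rw [norm₀, kummerNorm_eq_pow (b := b₀ x) hI _ hB₀, h1, one_pow]
  rw [eqn_iff ht hT, IsKummer.normFun_eq (b := b x) hI hN hB]
  rfl

theorem coord_eqn (Q : Option (Fin (p - 1)) → S.FixPt) (z : R × (Fin (p - 1) → R)) :
    (locusY J A ε (aeval ε w)).eqn R (coord Q z) ↔ z ∈ IsKummer.Sol k p ε w R := by
  refine (eqn_iff_mem_Sol (I := ⊥) (by simp) (coord_T Q z) (coord_TT Q z) ?_ (fun j hj => ?_)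
    fun a j hj => ?_).trans ?_
  · rw [coord_B₀, if_pos rfl]
  · rw [coord_B₀, if_neg hj]
    exact Ideal.zero_mem _
  · rw [coord_B, if_neg hj]
    exact Ideal.zero_mem _
  · have : (coord (J := J) Q z iY, fun a => coord (J := J) Q z (iB a 0)) = z :=
      Prod.ext rfl (funext fun a => by simp [coord_B])
    rw [this]

/-- The coordinates `coord Q z`, as coordinates of a point of `Ȳ_w`. -/
noncomputable def yCoord (Q : Option (Fin (p - 1)) → S.FixPt) {z : R × (Fin (p - 1) → R)}
    (hz : z ∈ IsKummer.Sol k p ε w R) : (locusY J A ε (aeval ε w)).Coord R :=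
  ⟨coord Q z, fun b => ⟨baseSection Q b, blk_baseSection Q b, by
    rw [coord_baseSection]; exact isUnit_one⟩, (coord_eqn Q z).2 hz⟩

end Equation

/-! ### The fixed points of `Ȳ_w` -/

/-- The solutions of `(y ∏ (x_i + ε)) ^ p = w` over a family of fixed points of `S` give points
whose coordinates with a nontrivial character vanish: these points are fixed. -/
theorem coord_eq_zero_of_red_coordChar_ne_zero [Fact p.Prime] (hJ : J.IsNondegenerate)
    {Q : Option (Fin (p - 1)) → S.FixPt} {P : (shapePL J).total.FixPt}
    (hP : P.σ = baseSection Q) {R : Type u} [CommRing R] (z : R × (Fin (p - 1) → R)) (i) :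
    red p (P.coordChar i) ≠ 0 → coord Q z i = 0 := by
  have hσ : ∀ b, P.coordChar (baseSection Q b) = 0 := fun b => by rw [← hP, P.coordChar_σ]
  revert i
  rw [forall_ι]
  refine ⟨fun o c hc => ?_, fun j hj => ?_, fun a j hj => ?_, fun a ha => ?_, fun h => ?_,
    fun h => ?_⟩
  · rw [(forgetS J o).coordChar_i, push_forgetS hJ.unimodular₀ hP] at hc
    rw [coord_S]
    refine (Q o).point_of_ne R fun h => hc ?_
    rw [← h, (Q o).coordChar_σ, map_zero]
  · rw [coord_B₀, if_neg]
    rintro rfl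
    exact hj (by rw [show iB₀ 0 = baseSection Q (.inr (.inl (.inl (.inr ())))) from rfl, hσ,
      map_zero])
  · rw [coord_B, if_neg]
    rintro rfl
    refine hj ?_
    rw [coordChar_iB_none (by rw [hP]; rfl)]
    simp
  · exact absurd (by rw [show iT a = baseSection Q (.inr (.inl (.inr (a, .inr ())))) from rfl, hσ,
      map_zero]) ha
  · refine absurd ?_ h
    rw [coordChar_iY (j₀ := 0) (by rw [hP]; rfl) (fun a => by rw [hP]; rfl) (by rw [hP]; rfl)]
    simp
  · exact absurd (by rw [show iTT = baseSection Q (.inr (.inr ())) from rfl, hσ, map_zero]) h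

theorem exists_fixPt [Fact p.Prime] (hJ : J.IsNondegenerate) (Q : Option (Fin (p - 1)) → S.FixPt) :
    ∃ P : (shapePL J).total.FixPt, P.σ = baseSection Q :=
  Shape.FixPt.exists_of_section (unimodular_shapePL J hJ.unimodular₀) _ (blk_baseSection Q)

theorem pt_yCoord_mem_fix [Fact p.Prime] (hJ : J.IsNondegenerate) {ζ : k}
    (hζ : IsPrimitiveRoot ζ p) {L : Type u} [Field L] [Algebra k L]
    (Q : Option (Fin (p - 1)) → S.FixPt) {z : L × (Fin (p - 1) → L)}
    (hz : z ∈ IsKummer.Sol k p ε w L) :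
    (locusY J A ε (aeval ε w)).pt (yCoord Q hz) ∈ (varY J A ε (aeval ε w)).Fix L := by
  obtain ⟨P, hP⟩ := exists_fixPt hJ Q
  refine (Locus.pt_mem_fix_iff hζ (unimodular_shapePL J hJ.unimodular) P _ fun b => ?_).2
    (coord_eq_zero_of_red_coordChar_ne_zero hJ hP z)
  rw [hP]
  exact coord_baseSection Q z b

theorem eq_of_pt_yCoord_eq [Fact p.Prime] (hJ : J.IsNondegenerate) {L : Type u} [Field L]
    [Algebra k L] {Q Q' : Option (Fin (p - 1)) → S.FixPt} {z z' : L × (Fin (p - 1) → L)}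
    {hz : z ∈ IsKummer.Sol k p ε w L} {hz' : z' ∈ IsKummer.Sol k p ε w L}
    (h : (locusY J A ε (aeval ε w)).pt (yCoord Q hz) =
      (locusY J A ε (aeval ε w)).pt (yCoord Q' hz')) : Q = Q' ∧ z = z' := by
  have hQ : Q = Q' := by
    obtain ⟨lam, hl⟩ := Locus.pt_eq_pt.1 h
    funext o
    refine Shape.FixPt.eq_of_point_support hJ.unimodular₀ L fun b => ?_
    have h1 : coord (J := J) Q' z' ((forgetS J o).i ((Q o).σ b)) =
      _ * coord (J := J) Q z ((forgetS J o).i ((Q o).σ b)) := congrFun hl _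
    rw [coord_S, coord_S, (Q o).point_σ, mul_one] at h1
    rw [h1]
    exact Units.ne_zero _
  subst hQ
  obtain ⟨P, hP⟩ := exists_fixPt hJ Q
  have h1 := Locus.eq_of_pt_eq (unimodular_shapePL J hJ.unimodular) P
    (fun b => by rw [hP]; exact coord_baseSection Q z b)
    (fun b => by rw [hP]; exact coord_baseSection Q z' b) h
  have h2 : coord (J := J) Q z = coord Q z' := congrArg Subtype.val h1
  refine ⟨rfl, Prod.ext (congrFun h2 iY) (funext fun a => ?_)⟩
  have h3 := congrFun h2 (iB a 0)
  rwa [coord_B, coord_B, if_pos rfl, if_pos rfl] at h3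

/-- A section of the blocks along which a point has nonzero coordinates, and which selects the
coordinates `t_i` and `t` where they do not vanish. -/
theorem exists_section_T {L : Type u} [Field L] {x : (shapePL J).total.ι → L}
    (hx : (shapePL J).total.IsCoord x) : ∃ σ : (shapePL J).total.β → (shapePL J).total.ι,
      (∀ b, (shapePL J).total.blk (σ b) = b) ∧ (∀ b, x (σ b) ≠ 0) ∧
      (∀ a, x (iT a) ≠ 0 → σ (.inr (.inl (.inr (a, .inr ())))) = iT a) ∧
      (x iTT ≠ 0 → σ (.inr (.inr ())) = iTT) := by
  have : ∀ b : (shapePL J).total.β, ∃ i, (shapePL J).total.blk i = b ∧ x i ≠ 0 ∧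
      (∀ a, b = .inr (.inl (.inr (a, .inr ()))) → x (iT a) ≠ 0 → i = iT a) ∧
      (b = .inr (.inr ()) → x iTT ≠ 0 → i = iTT) := fun b => by
    by_cases h1 : ∃ a, b = .inr (.inl (.inr (a, .inr ()))) ∧ x (iT a) ≠ 0
    · obtain ⟨a, rfl, ha⟩ := h1
      refine ⟨iT a, rfl, ha, fun a' h _ => ?_, fun h => by simp at h⟩
      have h2 : a = a' := by simpa using h
      rw [h2]
    · by_cases h2 : b = .inr (.inr ()) ∧ x iTT ≠ 0
      · obtain ⟨rfl, h2⟩ := h2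
        exact ⟨iTT, rfl, h2, fun a h => by simp at h, fun _ _ => rfl⟩
      · obtain ⟨i, hi, hu⟩ := hx b
        exact ⟨i, hi, hu.ne_zero, fun a ha ha' => absurd ⟨a, ha, ha'⟩ h1,
          fun hb hb' => absurd ⟨hb, hb'⟩ h2⟩
  choose σ h1 h2 h3 h4 using this
  exact ⟨σ, h1, h2, fun a => h3 _ a rfl, h4 _ rfl⟩

/-- Normalise the coordinates of a fixed point with `t = 1` and `t_i = 1` wherever these are
nonzero. The coordinates with a nontrivial character vanish, so `N(α)` is a scalar times the `p`-th
power of a product of as many factors `x_i + ε` as there are `t_i ≠ 0`. As `w` is generic, none of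
the `t_i` and neither `t` nor `y` is zero; hence `μ_pⁿ` acts trivially on `y`, and `b₀` is a
scalar. -/
theorem exists_pt_yCoord_eq [Fact p.Prime] (hJ : J.IsNondegenerate) {ζ : k}
    (hζ : IsPrimitiveRoot ζ p) {e : k} (he : e ≠ 0) (h : IsKummer k A p ε e)
    (hw : IsKummer.IsGeneric k p ε e w) {L : Type u} [Field L] [Algebra k L]
    {y : (varY J A ε (aeval ε w)).pts L} (hy : y ∈ (varY J A ε (aeval ε w)).Fix L) :
    ∃ (Q : Option (Fin (p - 1)) → S.FixPt) (z : L × (Fin (p - 1) → L))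
      (hz : z ∈ IsKummer.Sol k p ε w L), (locusY J A ε (aeval ε w)).pt (yCoord Q hz) = y := by
  have hp : 0 < p := Nat.pos_of_neZero p
  obtain ⟨x₀, rfl⟩ := Locus.exists_pt y
  obtain ⟨σ, hσ, hσ0, hσT, hσTT⟩ := exists_section_T x₀.2.1
  obtain ⟨P, rfl⟩ := Shape.FixPt.exists_of_section (unimodular_shapePL J hJ.unimodular₀) σ hσ
  obtain ⟨x, hxx, hx1, hx0⟩ := Locus.exists_normalized (unimodular_shapePL J hJ.unimodular) P x₀
    fun b => (hσ0 b).isUnit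
  rw [← hxx] at hy ⊢
  have hfix := (Locus.pt_mem_fix_iff hζ (unimodular_shapePL J hJ.unimodular) P x hx1).1 hy
  replace hσT : ∀ a, x.1 (iT a) ≠ 0 → P.σ (.inr (.inl (.inr (a, .inr ())))) = iT a :=
    fun a ha => hσT a (mt (hx0 _).1 ha)
  replace hσTT : x.1 iTT ≠ 0 → P.σ (.inr (.inr ())) = iTT := fun ht => hσTT (mt (hx0 _).1 ht)
  clear hxx hx0 hσ0 hσ x₀
  obtain ⟨x, hxc, heqn⟩ := x
  dsimp only at hx1 hfix hσT hσTT
  -- the points `s_i` are fixed points of `S`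
  let Q : Option (Fin (p - 1)) → S.FixPt := fun o => (forgetS J o).push P
  have hS : ∀ o c, x ((forgetS J o).i c) = (Q o).point L c := fun o c => by
    have := (hJ.regular (Q o)).eq_point (x := fun c => x ((forgetS J o).i c)) (fun b => by
      rw [Shape.Forget.i_push_σ, hx1]) fun i hi => hfix _ (by rwa [Shape.Forget.coordChar_i])
    exact congrFun this c
  have hform : ∀ o, MvPolynomial.aeval (fun c => x ((forgetS J o).i c)) J.form ≠ 0 := fun o => by
    have h1 : (fun c => x ((forgetS J o).i c)) =
        fun c => algebraMap k L ((Q o).point k c) := funext fun c => by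
      rw [hS, (Q o).map_point]
    have h2 : MvPolynomial.aeval (fun c => algebraMap k L ((Q o).point k c)) J.form =
        algebraMap k L ((Q o).formAt J) :=
      (MvPolynomial.comp_aeval_apply (φ := Algebra.ofId k L) ((Q o).point k) J.form).symm
    rw [h1, h2]
    exact (_root_.map_ne_zero _).2 (hJ.form_ne _)
  -- `b₀` is a monomial
  obtain ⟨j₀, hj₀⟩ : ∃ j₀, P.σ (.inr (.inl (.inl (.inr ())))) = iB₀ j₀ := by
    have h1 := P.blk_σ (.inr (.inl (.inl (.inr ()))))
    rcases h2 : P.σ (.inr (.inl (.inl (.inr ())))) with i | ((i | i) | i) | i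
    · exact i.elim
    · rw [h2] at h1; simp at h1
    · exact ⟨i, rfl⟩
    · rw [h2] at h1; simp at h1
    · rw [h2] at h1; simp at h1
  have hB₀ : ∀ j, j ≠ j₀ → x (iB₀ j) = 0 := fun j hj => hfix _ (by
    rw [coordChar_iB₀ hj₀]
    exact red_smul_ne_zero (hJ.char_ne _) hj)
  have hB₀' : x (iB₀ j₀) = 1 := by rw [← hj₀, hx1]
  have hN₀ : norm₀ x ≠ 0 := by
    refine kummerNorm_single_ne_zero (hform none) (l := j₀) ?_ hB₀
    change x (iB₀ j₀) ≠ 0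
    rw [hB₀']
    exact one_ne_zero
  -- each factor `N(b_i + t_i ε)` is a scalar times the `p`-th power of `ε + x_i` or of `1`
  have hB : ∀ a, x (iT a) ≠ 0 → ∀ j, j ≠ 0 → x (iB a j) = 0 := fun a ha j hj => hfix _ (by
    have h1 := red_smul_ne_zero (hJ.char_ne (Q (some a))) hj
    rw [coordChar_iB_none (hσT a ha)]
    simpa using h1)
  have hT1 : ∀ a, x (iT a) ≠ 0 → x (iT a) = 1 := fun a ha => by rw [← hσT a ha, hx1]
  have hfac : ∀ a, ∃ (μ : L) (q : L[X]), μ ≠ 0 ∧ q.Monic ∧ q.natDegree ≤ 1 ∧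
      (x (iT a) = 0 → q = 1) ∧
      norm x A ε a = algebraMap L (L ⊗[k] A) μ * IsKummer.ev k ε L q ^ p := fun a => by
    by_cases ha : x (iT a) = 0
    · obtain ⟨l, hl⟩ : ∃ l, P.σ (.inr (.inl (.inr (a, .inr ())))) = iB a l := by
        have h1 := P.blk_σ (.inr (.inl (.inr (a, .inr ()))))
        have h3 := hx1 (.inr (.inl (.inr (a, .inr ()))))
        rcases h2 : P.σ (.inr (.inl (.inr (a, .inr ())))) with i | ((i | i) | ⟨a', i | _ | i⟩) | i
        · exact i.elim
        · rw [h2] at h1; simp at h1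
        · rw [h2] at h1; simp at h1
        · rw [h2] at h1; simp at h1
        · rw [h2] at h1 h3
          have h4 : a' = a := by simpa using h1
          subst h4
          exact absurd (ha.symm.trans h3) zero_ne_one
        · rw [h2] at h1
          have h4 : a' = a := by simpa using h1
          subst h4
          exact ⟨i, rfl⟩
        · rw [h2] at h1; simp at h1
      refine ⟨kummerNorm (MvPolynomial.aeval (s x a) J.form) (b x a), 1, ?_, monic_one, by simp,
        fun _ => rfl, ?_⟩
      · refine kummerNorm_single_ne_zero (hform (some a)) (l := l) ?_ fun j hj => hfix _ ?_
        · have h1 : x (iB a l) = 1 := by rw [← hl, hx1]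
          exact h1.trans_ne one_ne_zero
        · rw [coordChar_iB_some hl]
          exact red_smul_ne_zero (hJ.char_ne _) hj
      · have ha' : t x a = 0 := ha
        rw [map_one, one_pow, mul_one, norm, map_kummerNorm]
        congr 1
        funext j
        rw [ha']
        simp
    · refine ⟨1, X + C (x (iB a 0)), one_ne_zero, monic_X_add_C _, (natDegree_X_add_C _).le,
        fun h => absurd h ha, ?_⟩
      have ha' : t x a = 1 := hT1 a ha
      rw [norm, kummerNorm_eq_pow (I := ⊥) (by simp), map_one, one_mul, map_add, aeval_X, aeval_C,
        ha', add_comm]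
      · simp [b]
      · intro j hj
        have hj' : (j : ℕ) ≠ 0 := fun h => hj (Fin.ext h)
        have h1 : b x a j = 0 := hB a ha j hj
        rw [if_neg hj', h1, map_zero, add_zero]
        exact Ideal.zero_mem _
  choose μ q hμ hqm hqd hq1 hq using hfac
  have heqn' : algebraMap L (L ⊗[k] A) (y x ^ p * norm₀ x * ∏ a, μ a) *
      IsKummer.ev k ε L (∏ a, q a) ^ p = algebraMap L (L ⊗[k] A) (tt x ^ p) *
        IsKummer.ev k ε L (w.map (algebraMap k L)) := by
    have h1 : normα x A ε = algebraMap L (L ⊗[k] A) (tt x ^ p) * ((1 : L) ⊗ₜ[k] aeval ε w) := heqn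
    rw [one_tmul_aeval, normα] at h1
    rw [← h1, map_mul _ (y x ^ p * norm₀ x), map_prod, map_prod, mul_assoc, ← Finset.prod_pow,
      ← Finset.prod_mul_distrib]
    congr 1
    exact Finset.prod_congr rfl fun a _ => (hq a).symm
  let g : L →ₐ[k] AlgebraicClosure L := IsScalarTower.toAlgHom k L (AlgebraicClosure L)
  have hg : Function.Injective g := (g : L →+* AlgebraicClosure L).injective
  have hqm' : (∏ a, q a).Monic := monic_prod_of_monic _ _ fun a _ => hqm a
  have hqd' : (∏ a, q a).natDegree ≤ p - 1 := by
    refine (natDegree_prod_le _ _).trans ((Finset.sum_le_sum fun a _ => hqd a).trans ?_)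
    simp
  -- `t ≠ 0`: a nonzero polynomial of degree `< p` in `ε` is not nilpotent
  have hTT : x iTT ≠ 0 := fun h0 => by
    have hy1 : x iY = 1 := by
      have h1 := P.blk_σ (.inr (.inr ()))
      have h3 := hx1 (.inr (.inr ()))
      rcases h2 : P.σ (.inr (.inr ())) with i | i | _ | _
      · rw [h2] at h1; simp at h1
      · rw [h2] at h1; simp at h1
      · rw [h2] at h3
        exact absurd (h0.symm.trans h3) zero_ne_one
      · rw [h2] at h3
        exact h3
    have h1 : tt x = 0 := h0
    have h2 : y x = 1 := hy1
    rw [h1, h2, one_pow, one_mul, zero_pow hp.ne', map_zero, zero_mul] at heqn'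
    have hu : IsUnit (algebraMap L (L ⊗[k] A) (norm₀ x * ∏ a, μ a)) :=
      (IsUnit.mk0 _ (mul_ne_zero hN₀ (Finset.prod_ne_zero_iff.2 fun a _ => hμ a))).map _
    have h3 := hu.mul_right_eq_zero.1 heqn'
    refine (hqm'.map (g : L →+* AlgebraicClosure L)).ne_zero ?_
    refine IsKummer.eq_zero_of_eval_eq_zero hp hζ he (natDegree_map_le.trans_lt (by omega))
      fun θ hθ => ?_
    obtain ⟨φ, hφ⟩ := h.exists_evalHom g θ hθ
    have h4 := congrArg φ h3
    rw [map_pow, hφ, map_zero] at h4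
    rw [eval_map]
    exact pow_eq_zero_iff hp.ne' |>.1 h4
  have hTT1 : x iTT = 1 := by rw [← hσTT hTT, hx1]
  have htt : tt x = 1 := hTT1
  rw [htt, one_pow, map_one, one_mul] at heqn'
  -- the coefficient of `ε ^ (p - 1)` in a `p`-th root of `w` is `0` unless all `t_i ≠ 0`
  obtain ⟨ν, hν⟩ := IsAlgClosed.exists_pow_nat_eq (g (y x ^ p * norm₀ x * ∏ a, μ a)) hp
  have hv : IsKummer.ev k ε (AlgebraicClosure L) (C ν * (∏ a, q a).map (g : L →+* _)) ^ p =
      IsKummer.ev k ε (AlgebraicClosure L) (w.map (algebraMap k (AlgebraicClosure L))) := by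
    have h1 := congrArg (Algebra.TensorProduct.map g (AlgHom.id k A)) heqn'
    rw [map_mul, map_pow, IsKummer.map_ev, IsKummer.map_ev, IsKummer.map_map_algebraMap] at h1
    rw [← h1, map_mul, mul_pow, aeval_C, ← map_pow, hν]
    congr 1
  have hvd : (C ν * (∏ a, q a).map (g : L →+* AlgebraicClosure L)).natDegree ≤
      (∏ a, q a).natDegree := (natDegree_C_mul_le _ _).trans natDegree_map_le
  obtain ⟨hc, -, -⟩ := hw (AlgebraicClosure L) _ (by omega) hv
  have hT0 : ∀ a, x (iT a) ≠ 0 := fun a ha => by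
    refine hc (coeff_eq_zero_of_natDegree_lt
      ((hvd.trans (natDegree_prod_le _ _)).trans_lt ?_))
    calc ∑ a, (q a).natDegree < ∑ _a : Fin (p - 1), 1 :=
          Finset.sum_lt_sum (fun a _ => hqd a) ⟨a, Finset.mem_univ a, by rw [hq1 a ha]; simp⟩
      _ = p - 1 := by simp
  have hT1' : ∀ a, x (iT a) = 1 := fun a => hT1 a (hT0 a)
  have hy0 : x iY ≠ 0 := fun h0 => hc (by
    have h1 : y x = 0 := h0
    have hν0 : ν = 0 := by
      rw [h1, zero_pow hp.ne', zero_mul, zero_mul, map_zero] at hν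
      exact pow_eq_zero_iff hp.ne' |>.1 hν
    rw [hν0, C_0, zero_mul, coeff_zero])
  have hj0 : j₀ = 0 := by
    by_contra hj
    refine hy0 (hfix _ ?_)
    rw [coordChar_iY hj₀ (fun a => hσT a (hT0 a)) (hσTT hTT)]
    have h1 := red_smul_ne_zero (hJ.char_ne (Q none)) hj
    simpa using h1
  subst hj0
  have hz : (x iY, fun a => x (iB a 0)) ∈ IsKummer.Sol k p ε w L :=
    (eqn_iff_mem_Sol (I := ⊥) (by simp) hT1' hTT1 hB₀' hB₀ fun a => hB a (hT0 a)).1 heqn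
  refine ⟨Q, _, hz, ?_⟩
  congr 1
  refine Subtype.ext (funext fun i => ?_)
  change coord Q _ i = x i
  revert i
  rw [forall_ι]
  refine ⟨fun o c => ?_, fun j => ?_, fun a j => ?_, fun a => ?_, rfl, ?_⟩
  · rw [coord_S, hS]
  · rw [coord_B₀]
    split_ifs with hj
    · rw [hj, hB₀']
    · rw [hB₀ j hj]
  · rw [coord_B]
    split_ifs with hj
    · rw [hj]
    · rw [hB a (hT0 a) j hj]
  · rw [coord_T, hT1']
  · rw [coord_TT, hTT1]

end PL

namespace PL

open Polynomial

variable {k : Type u} [Field k] {p n : ℕ} [Fact p.Prime] {S : Shape n}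
  {J : FormLine k p S} {A : Type u} [CommRing A] [Algebra k A] {ε : A} {w : k[X]} {ζ e : k}

/-! ### Smoothness and tangent spaces at the fixed points of `Ȳ_w` -/

theorem smoothAt_pt_yCoord [CharZero k] (hJ : J.IsNondegenerate)
    (hζ : IsPrimitiveRoot ζ p) (he : e ≠ 0)
    (h : IsKummer k A p ε e) (hw : IsKummer.IsGeneric k p ε e w) {L : Type u} [Field L]
    [Algebra k L] (Q : Option (Fin (p - 1)) → S.FixPt) {z : L × (Fin (p - 1) → L)}
    (hz : z ∈ IsKummer.Sol k p ε w L) :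
    (varY J A ε (aeval ε w)).SmoothAt ((locusY J A ε (aeval ε w)).pt (yCoord Q hz)) := by
  classical
  have hp : 0 < p := Nat.pos_of_neZero p
  intro R R' _ _ _ _ _ _ _ _ q r hq hr a ha
  obtain ⟨P, hP⟩ := exists_fixPt hJ Q
  have := isLocalHom_of_surjective_algHom q hq
  have := isLocalHom_of_surjective_algHom r hr
  obtain ⟨x, rfl, hx1, hxz⟩ := Locus.exists_normalized_of_map
    (unimodular_shapePL J hJ.unimodular) P r
    (fun b => by rw [hP]; exact coord_baseSection Q z b) ha
  rw [hP] at hx1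
  have hxz' : ∀ i, r (x.1 i) = coord Q z i := hxz
  -- an arbitrary lift of the coordinates, to be corrected at `y` and at the `b_i`
  have hlift : ∀ i, ∃ c : R', q c = x.1 i ∧ (x.1 i = 1 → c = 1) := fun i => by
    by_cases h1 : x.1 i = 1
    · exact ⟨1, by rw [h1, map_one], fun _ => rfl⟩
    · obtain ⟨c, hc⟩ := hq (x.1 i)
      exact ⟨c, hc, fun h2 => absurd h2 h1⟩
  choose x' hx' hx'1 using hlift
  have hrx : ∀ i, r (q (x' i)) = coord Q z i := fun i => by rw [hx', hxz']
  have hunit : ∀ c : R', r (q c) ≠ 0 → IsUnit c := fun c hc =>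
    isUnit_of_map_unit q _ (isUnit_of_map_unit r _ (IsUnit.mk0 _ hc))
  have hmax : ∀ c : R', r (q c) = 0 → c ∈ IsLocalRing.maximalIdeal R' := fun c hc => by
    rw [IsLocalRing.mem_maximalIdeal]
    intro hu
    have h1 := (hu.map q).map r
    rw [hc] at h1
    exact not_isUnit_zero h1
  have hT : ∀ a, x' (iT a) = 1 := fun a => hx'1 _ (hx1 (.inr (.inl (.inr (a, .inr ())))))
  have hTT : x' iTT = 1 := hx'1 _ (hx1 (.inr (.inr ())))
  have hB₀0 : x' (iB₀ 0) = 1 := hx'1 _ (hx1 (.inr (.inl (.inl (.inr ())))))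
  have hB₀ : ∀ j, j ≠ 0 → x' (iB₀ j) ∈ IsLocalRing.maximalIdeal R' := fun j hj =>
    hmax _ (by rw [hrx, coord_B₀, if_neg hj])
  have hB : ∀ a j, j ≠ 0 → x' (iB a j) ∈ IsLocalRing.maximalIdeal R' := fun a j hj =>
    hmax _ (by rw [hrx, coord_B, if_neg hj])
  have hN₀ : norm₀ x' - 1 ∈ IsLocalRing.maximalIdeal R' := by
    obtain ⟨d, hd, hN⟩ := exists_kummerNorm_update (IsLocalRing.maximalIdeal R')
      (MvPolynomial.aeval (s₀ x') J.form) (b := b₀ x') hB₀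
    have h1 := hN (b₀ x' 0)
    have h2 : b₀ x' 0 = 1 := hB₀0
    rw [Function.update_eq_self, h2, one_pow] at h1
    rw [norm₀, h1, add_sub_cancel_left, eval_eq_sum_range]
    exact Ideal.sum_mem _ fun i _ => Ideal.mul_mem_right _ _ (Ideal.mul_le_right (hd i))
  obtain ⟨hz0, hzinj⟩ := IsKummer.ne_zero_and_injective_of_mem_Sol hw hp hz
  have hI : RingHom.ker q ≤ IsLocalRing.maximalIdeal R' := fun c hc =>
    hmax c (by rw [(RingHom.mem_ker).1 hc, map_zero])
  have hker : IsKummer.normFun k ε (norm₀ x') (fun a => MvPolynomial.aeval (s x' a) J.form) (b x')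
      (x' iY, fun a => x' (iB a 0)) - IsKummer.ev k ε R' (w.map (algebraMap k R')) ∈
      (RingHom.ker q).map (algebraMap R' (R' ⊗[k] A)) := by
    have h1 : Algebra.TensorProduct.map q (AlgHom.id k A)
        (normα x' A ε - IsKummer.ev k ε R' (w.map (algebraMap k R'))) = 0 := by
      rw [map_sub, normα_map, IsKummer.map_ev, IsKummer.map_map_algebraMap, sub_eq_zero]
      have h2 : (fun i => q (x' i)) = x.1 := funext hx'
      have h3 := (eqn_iff (x := x.1) (ε := ε) (w := w)
        (fun a => hx1 (.inr (.inl (.inr (a, .inr ()))))) (hx1 (.inr (.inr ())))).1 x.2.2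
      rw [h2, ← h3]
      exact normα_eq_normFun fun a => hx1 (.inr (.inl (.inr (a, .inr ()))))
    rw [normα_eq_normFun hT] at h1
    generalize IsKummer.normFun k ε (norm₀ x') (fun a => MvPolynomial.aeval (s x' a) J.form) (b x')
      (x' iY, fun a => x' (iB a 0)) - IsKummer.ev k ε R' (w.map (algebraMap k R')) = d at h1 ⊢
    obtain ⟨v, hv, rfl⟩ := h.exists_ev_eq hp d
    rw [IsKummer.map_ev] at h1
    have h2 := h.eq_zero_of_ev_eq_zero (natDegree_map_le.trans_lt hv) h1
    rw [aeval_eq_sum_range]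
    refine Ideal.sum_mem _ fun i _ => ?_
    rw [Algebra.smul_def]
    refine Ideal.mul_mem_right _ _ (Ideal.mem_map_of_mem _ ((RingHom.mem_ker).2 ?_))
    have h3 := congrArg (fun v => coeff v i) h2
    simpa [coeff_map] using h3
  obtain ⟨z', hz1, hz2, hz3⟩ := IsKummer.exists_normFun_eq hw h hζ he hI hN₀ hB
    (hunit _ (by rw [hrx]; exact hz0)) (fun i j hij => hunit _ (by
      rw [map_sub, map_sub, hrx, hrx, coord_B, coord_B, if_pos rfl, if_pos rfl, sub_ne_zero]
      exact hzinj.ne hij)) hker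
  let y : (shapePL J).total.ι → R' := Function.update
    (fun i => if hi : ∃ a, i = iB a 0 then z'.2 hi.choose else x' i) iY z'.1
  have hyY : y iY = z'.1 := Function.update_self _ _ _
  have hyB : ∀ a, y (iB a 0) = z'.2 a := fun a => by
    have h1 : ∃ a', (iB a 0 : (shapePL J).total.ι) = iB a' 0 := ⟨a, rfl⟩
    have h2 : h1.choose = a := by simp
    have h3 : y (iB a 0) = z'.2 h1.choose :=
      (Function.update_of_ne (by simp) _ _).trans (dif_pos h1)
    rw [h3, h2]
  have hy : ∀ i, i ≠ iY → (∀ a, i ≠ iB a 0) → y i = x' i := fun i h1 h2 =>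
    (Function.update_of_ne h1 _ _).trans (dif_neg (not_exists.2 h2))
  have hqy : ∀ i, q (y i) = x.1 i := fun i => by
    have hk : ∀ c c' : R', c - c' ∈ RingHom.ker q → q c = q c' := fun c c' hc => by
      rw [RingHom.mem_ker, map_sub, sub_eq_zero] at hc
      exact hc
    by_cases h1 : i = iY
    · rw [h1, hyY, ← hx', hk _ _ hz1]
    · by_cases h2 : ∃ a, i = iB a 0
      · obtain ⟨a, rfl⟩ := h2
        rw [hyB, ← hx', hk _ _ (hz2 a)]
      · rw [hy i h1 (not_exists.1 h2), hx']
  have hyeqn : (locusY J A ε (aeval ε w)).eqn R' y := by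
    rw [eqn_iff (fun a => by rw [hy _ (by simp) (by simp), hT])
      (by rw [hy _ (by simp) (by simp), hTT]), ← hz3]
    have h1 : norm₀ y = norm₀ x' := by
      have h2 : s₀ y = s₀ x' := funext fun i => hy _ (by simp) (by simp)
      have h3 : b₀ y = b₀ x' := funext fun i => hy _ (by simp) (by simp)
      rw [norm₀, norm₀, h2, h3]
    have h2 : ∀ a, s y a = s x' a := fun a => funext fun i => hy _ (by simp) (by simp)
    rw [h1]
    simp only [h2, hyY, hyB]
    rw [IsKummer.normFun, IsKummer.normFun]
    congr 1
    refine Finset.prod_congr rfl fun a _ => ?_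
    congr 1
    funext j
    by_cases hj : j = 0
    · rw [hj, Function.update_self, Function.update_self]
    · rw [Function.update_of_ne hj, Function.update_of_ne hj]
      congr 1
      exact hy _ (by simp) fun a' => by simp [hj]
  refine ⟨(locusY J A ε (aeval ε w)).pt ⟨y, fun b => ?_, hyeqn⟩, ?_⟩
  · obtain ⟨i, hi, hu⟩ := x.2.1 b
    exact ⟨i, hi, isUnit_of_map_unit q _ (by rwa [hqy])⟩
  · refine (Locus.map_pt _ _).trans ?_
    congr 1
    exact Subtype.ext (funext hqy)

/-- The index type of the tangent coordinates at a point of `S` and of those in the fibre of `ℙ(𝒜)`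
over it. -/
abbrev TangentIndex (p : ℕ) [NeZero p] (P : S.FixPt) : Type :=
  {c : S.ι // P.σ (S.blk c) ≠ c} ⊕ {j : Fin p // j ≠ 0}

/-- The characters through which `μ_pⁿ` acts on these tangent coordinates. -/
noncomputable def tangentChar (J : FormLine k p S) (P : S.FixPt) : TangentIndex p P → Fin n → ℤ :=
  Sum.elim (fun c => P.coordChar c) fun j => (j.1 : ℤ) • P.lineChar J.toLine

/-- The coordinates of `ℙ(L ⊕ 𝒪)` that may be varied along `Ȳ_w` to first order. -/
noncomputable def tangentCoord (Q : Option (Fin (p - 1)) → S.FixPt) :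
    (Σ o, TangentIndex p (Q o)) → (shapePL J).total.ι
  | ⟨o, .inl c⟩ => (forgetS J o).i c
  | ⟨none, .inr j⟩ => iB₀ j
  | ⟨some a, .inr j⟩ => iB a j

theorem tangentCoord_injective (Q : Option (Fin (p - 1)) → S.FixPt) :
    Function.Injective (tangentCoord (J := J) Q) := by
  rintro ⟨_ | a, c | c⟩ ⟨_ | a', c' | c'⟩ h <;>
    simp [tangentCoord, forgetS_none_i, forgetS_some_i] at h
  · rw [Subtype.ext h]
  · rw [Subtype.ext h]
  · obtain ⟨rfl, h⟩ := h
    rw [Subtype.ext h]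
  · obtain ⟨rfl, h⟩ := h
    rw [Subtype.ext h]

theorem iY_notMem_range (Q : Option (Fin (p - 1)) → S.FixPt) :
    (iY : (shapePL J).total.ι) ∉ Set.range (tangentCoord (J := J) Q) := by
  rintro ⟨⟨_ | a, c | c⟩, h⟩ <;> simp [tangentCoord, forgetS_none_i, forgetS_some_i] at h

theorem iB_zero_notMem_range (Q : Option (Fin (p - 1)) → S.FixPt) (a : Fin (p - 1)) :
    (iB a 0 : (shapePL J).total.ι) ∉ Set.range (tangentCoord (J := J) Q) := by
  rintro ⟨⟨_ | a', c | c⟩, h⟩ <;> simp [tangentCoord, forgetS_none_i, forgetS_some_i] at h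
  exact c.2 h.2

theorem baseSection_notMem_range (Q : Option (Fin (p - 1)) → S.FixPt) {P : (shapePL J).total.FixPt}
    (hP : P.σ = baseSection Q) (hS : Shape.Unimodular.{0} S) (b) :
    P.σ b ∉ Set.range (tangentCoord (J := J) Q) := by
  rintro ⟨⟨o, c | c⟩, h⟩
  · have h1 : (forgetS J o).i c = P.σ b := h
    have h2 := ((forgetS J o).push_σ_blk P c).2 (by rw [h1, P.blk_σ])
    rw [push_forgetS hS hP] at h2
    exact c.2 h2
  · rw [hP] at h
    rcases o with _ | a
    · have h1 : (iB₀ c.1 : (shapePL J).total.ι) = baseSection Q b := h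
      have h2 := blk_baseSection (J := J) Q b
      rw [← h1] at h2
      rw [← h2] at h1
      have h3 : (iB₀ c.1 : (shapePL J).total.ι) = iB₀ 0 := h1
      exact c.2 (by simpa using h3)
    · have h1 : (iB a c.1 : (shapePL J).total.ι) = baseSection Q b := h
      have h2 := blk_baseSection (J := J) Q b
      rw [← h1] at h2
      rw [← h2] at h1
      have h3 : (iB a c.1 : (shapePL J).total.ι) = iT a := h1
      simp at h3

theorem coordChar_tangentCoord (hS : Shape.Unimodular.{0} S)
    {Q : Option (Fin (p - 1)) → S.FixPt} {P : (shapePL J).total.FixPt}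
    (hP : P.σ = baseSection Q) (m : Σ o, TangentIndex p (Q o)) :
    P.coordChar (tangentCoord Q m) = tangentChar J (Q m.1) m.2 := by
  rcases m with ⟨o, c | c⟩
  · have h1 := (forgetS J o).coordChar_i P c.1
    rw [push_forgetS hS hP] at h1
    exact h1
  · rcases o with _ | a
    · have h1 := coordChar_iB₀ (J := J) (P := P) (j₀ := 0) (by rw [hP]; rfl) c.1
      rw [push_forgetS hS hP] at h1
      refine h1.trans ?_
      simp [tangentChar]
    · have h1 := coordChar_iB_none (J := J) (P := P) (a := a) (by rw [hP]; rfl) c.1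
      rw [push_forgetS hS hP] at h1
      exact h1

/-- The tangent space of `Ȳ_w` at a fixed point is the direct sum of the tangent spaces of `ℙ(𝒜)` at
the points `1` over the `s_i`: the system `(y, x)` has no infinitesimal deformations, and the other
coordinates may be varied freely since the norm of `x + ∑ b_j u ^ j` is `x ^ p` to first order. -/
noncomputable def tangentChart [CharZero k] (hJ : J.IsNondegenerate)
    (hζ : IsPrimitiveRoot ζ p) (he : e ≠ 0)
    (h : IsKummer k A p ε e) (hw : IsKummer.IsGeneric k p ε e w) {K : Type u} [Field K]
    [Algebra k K] {Q : Option (Fin (p - 1)) → S.FixPt} {z : K × (Fin (p - 1) → K)}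
    (hz : z ∈ IsKummer.Sol k p ε w K) {P : (shapePL J).total.FixPt} (hP : P.σ = baseSection Q) :
    TangentChart (varY J A ε (aeval ε w)) ((locusY J A ε (aeval ε w)).pt (yCoord Q hz))
      (Set.range (tangentCoord (J := J) Q)) fun g m =>
        ((Shape.scale (muUnits k g) (P.coordChar m) : kˣ) : k) :=
  TangentChart.ofLocus (unimodular_shapePL J hJ.unimodular) P (yCoord Q hz)
    (fun b => by rw [hP]; exact coord_baseSection Q z b)
    (coord_eq_zero_of_red_coordChar_ne_zero hJ hP z) _
    (baseSection_notMem_range Q hP hJ.unimodular₀)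
    fun {R} _ _ _ T x hx hxz => by
      have hp : 0 < p := Nat.pos_of_neZero p
      have hxz' : ∀ i, T.π (x i) = coord Q z i := hxz
      rw [hP] at hx
      have hI : RingHom.ker T.π * RingHom.ker T.π = ⊥ := by
        rw [eq_bot_iff, Ideal.mul_le]
        intro a ha b hb
        exact T.sq a b ha hb
      have hsol := eqn_iff_mem_Sol (J := J) (ε := ε) (w := w) hI (x := x)
        (fun a => hx (.inr (.inl (.inr (a, .inr ()))))) (hx (.inr (.inr ())))
        (hx (.inr (.inl (.inl (.inr ())))))
        (fun j hj => (RingHom.mem_ker).2 (by rw [hxz', coord_B₀, if_neg hj]))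
        (fun a j hj => (RingHom.mem_ker).2 (by rw [hxz', coord_B, if_neg hj]))
      rw [hsol]
      constructor
      · intro hmem i hi
        obtain ⟨h1, h2⟩ := IsKummer.eq_of_mem_Sol_thickening hw h hp hζ he T hmem
        dsimp only at h1 h2
        change x i = T.s (coord Q z i)
        rw [← hxz']
        have hone : ∀ i, x i = 1 → x i = T.s (T.π (x i)) := fun i hi => by
          rw [hi, map_one, map_one]
        revert i
        rw [forall_ι]
        refine ⟨fun o c hc => ?_, fun j hj => ?_, fun a j hj => ?_, fun a _ => ?_, fun _ => h1,
          fun _ => ?_⟩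
        · by_cases hc' : (Q o).σ (S.blk c) = c
          · refine hone _ ?_
            have h3 := hx ((forgetS J o).b (S.blk c))
            rw [← hP, ← Shape.Forget.i_push_σ, push_forgetS hJ.unimodular₀ hP, hc'] at h3
            exact h3
          · exact absurd ⟨⟨o, .inl ⟨c, hc'⟩⟩, rfl⟩ hc
        · by_cases hj' : j = 0
          · subst hj'
            exact hone _ (hx (.inr (.inl (.inl (.inr ())))))
          · exact absurd ⟨⟨none, .inr ⟨j, hj'⟩⟩, rfl⟩ hj
        · by_cases hj' : j = 0
          · subst hj'
            exact h2 a
          · exact absurd ⟨⟨some a, .inr ⟨j, hj'⟩⟩, rfl⟩ hj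
        · exact hone _ (hx (.inr (.inl (.inr (a, .inr ())))))
        · exact hone _ (hx (.inr (.inr ())))
      · intro hx'
        have h1 := IsKummer.map_mem_Sol T.s hz
        have h2 : x iY = T.s z.1 := hx' _ (iY_notMem_range Q)
        have h3 : ∀ a, x (iB a 0) = T.s (z.2 a) := fun a => by
          refine (hx' _ (iB_zero_notMem_range Q a)).trans ?_
          change T.s (coord Q z (iB a 0)) = _
          rw [coord_B, if_pos rfl]
        rw [h2]
        simp only [h3]
        exact h1

end PL

/-! ### Fixed points and tangent spaces of `ℙ(𝒜)` -/

namespace PA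

variable {k : Type u} [Field k] {p n : ℕ} {S : Shape n} {J : FormLine k p S}

/-- The projection `ℙ(𝒜) → S`. -/
noncomputable def forgetS (J : FormLine k p S) : Shape.Forget (shapePA J).total S :=
  (RelShape.forgetOverPt S).comp (RelShape.forgetProj (RelShape.overPt S) (lineA J))

/-- The section of the blocks that selects the coordinates of a fixed point of `S`, and the summand
`J^{⊗ l}` of `𝒜`. -/
noncomputable def baseSection (Q : S.FixPt) (l : Fin p) :
    (shapePA J).total.β → (shapePA J).total.ι :=
  Sum.elim nofun (Sum.elim (fun b => (forgetS J).i (Q.σ b)) fun _ => .inr (.inr l))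

theorem blk_baseSection (Q : S.FixPt) (l : Fin p) (b) :
    (shapePA J).total.blk (baseSection (J := J) Q l b) = b := by
  rcases b with b | b | b
  · exact b.elim
  · exact ((forgetS J).blk _).trans (congrArg (forgetS J).b (Q.blk_σ b))
  · rfl

theorem exists_σ_eq (P : (shapePA J).total.FixPt) :
    ∃ l, P.σ = baseSection ((forgetS J).push P) l := by
  obtain ⟨l, hl⟩ := RelShape.exists_σ_proj (lineA J) P
  refine ⟨l, funext fun b => ?_⟩
  rcases b with b | b | b
  · exact b.elim
  · exact ((forgetS J).i_push_σ P b).symm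
  · exact hl

theorem push_forgetS (hS : Shape.Unimodular.{0} S) {Q : S.FixPt} {l : Fin p}
    {P : (shapePA J).total.FixPt} (hP : P.σ = baseSection Q l) : (forgetS J).push P = Q := by
  refine Shape.FixPt.eq_of_σ_eq hS (funext fun b => (forgetS J).i_inj ?_)
  rw [Shape.Forget.i_push_σ, hP]
  rfl

theorem exists_fixPt_equiv (hJ : J.IsNondegenerate) :
    ∃ E : S.FixPt × Fin p ≃ (shapePA J).total.FixPt, ∀ Q l, (E (Q, l)).σ = baseSection Q l := by
  have hX := PL.unimodular_shapePA J hJ.unimodular₀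
  choose E hE using fun a : S.FixPt × Fin p =>
    Shape.FixPt.exists_of_section hX (baseSection a.1 a.2) (blk_baseSection a.1 a.2)
  refine ⟨Equiv.ofBijective E ⟨fun a a' h => ?_, fun P => ?_⟩, fun Q l => hE (Q, l)⟩
  · have h1 : a.1 = a'.1 := by
      rw [← push_forgetS hJ.unimodular₀ (hE a), h, push_forgetS hJ.unimodular₀ (hE a')]
    have h2 : (.inr (.inr a.2) : (shapePA J).total.ι) = .inr (.inr a'.2) := by
      have h3 := congrFun (hE a) (.inr (.inr ()))
      rw [h, hE a'] at h3
      exact h3.symm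
    exact Prod.ext h1 (by simpa using h2)
  · obtain ⟨l, hl⟩ := exists_σ_eq P
    exact ⟨((forgetS J).push P, l), Shape.FixPt.eq_of_σ_eq hX ((hE _).trans hl.symm)⟩

theorem coordChar_inr {Q : S.FixPt} {l : Fin p} (hS : Shape.Unimodular.{0} S)
    {P : (shapePA J).total.FixPt} (hP : P.σ = baseSection Q l) (j : Fin p) :
    P.coordChar (.inr (.inr j)) = ((j : ℤ) - l) • Q.lineChar J.toLine := by
  refine (RelShape.coordChar_proj (lineA J) P (by rw [hP]; rfl) j).trans ?_
  rw [PL.lineChar_lineA, PL.lineChar_lineA, ← sub_smul, ← Shape.Forget.push_comp,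
    ← push_forgetS hS hP]
  rfl

variable [Fact p.Prime]

theorem regular (hJ : J.IsNondegenerate) (P : (shapePA J).total.FixPt) : P.Regular p := by
  obtain ⟨l, hP⟩ := exists_σ_eq P
  rintro (i | i | i) hi
  · exact i.elim
  · have h1 := hJ.regular ((forgetS J).push P) i (mt ((forgetS J).push_σ_blk P i).1 hi)
    rwa [← (forgetS J).coordChar_i P i] at h1
  · rw [coordChar_inr hJ.unimodular₀ hP]
    refine red_smul_ne_zero (hJ.char_ne _) ?_
    rintro rfl
    exact hi (by rw [hP]; rfl)

/-- The coordinates of `ℙ(𝒜)` near a fixed point, indexed by the coordinates at the point `1` over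
the same fixed point of `S`. -/
def tangentCoord (Q : S.FixPt) (l : Fin p) : PL.TangentIndex p Q → (shapePA J).total.ι :=
  Sum.elim (fun c => .inr (.inl c.1)) fun j => .inr (.inr (j.1 + l))

theorem tangentCoord_injective (Q : S.FixPt) (l : Fin p) :
    Function.Injective (tangentCoord (J := J) Q l) := by
  rintro (c | c) (c' | c') h <;> simp [tangentCoord] at h
  · rw [Subtype.ext h]
  · rw [Subtype.ext h]

theorem range_tangentCoord {Q : S.FixPt} {l : Fin p} {P : (shapePA J).total.FixPt}
    (hS : Shape.Unimodular.{0} S) (hP : P.σ = baseSection Q l) :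
    Set.range (tangentCoord (J := J) Q l) = {i | P.σ ((shapePA J).total.blk i) ≠ i} := by
  have hc : ∀ c, P.σ ((shapePA J).total.blk (.inr (.inl c))) = .inr (.inl c) ↔
      Q.σ (S.blk c) = c := fun c => by
    have := (forgetS J).push_σ_blk P c
    rw [push_forgetS hS hP] at this
    exact this.symm
  ext i
  constructor
  · rintro ⟨c | j, rfl⟩
    · exact mt (hc c.1).1 c.2
    · intro h
      rw [hP] at h
      have h1 : (.inr (.inr l) : (shapePA J).total.ι) = .inr (.inr (j.1 + l)) := h
      exact j.2 (by simpa using h1)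
  · intro hi
    rcases i with i | i | i
    · exact i.elim
    · exact ⟨.inl ⟨i, mt (hc i).2 hi⟩, rfl⟩
    · refine ⟨.inr ⟨i - l, fun h => hi ?_⟩, by simp [tangentCoord]⟩
      rw [hP, sub_eq_zero.1 h]
      rfl

theorem red_coordChar_tangentCoord (hS : Shape.Unimodular.{0} S) {Q : S.FixPt} {l : Fin p}
    {P : (shapePA J).total.FixPt} (hP : P.σ = baseSection Q l) (m : PL.TangentIndex p Q) :
    red p (P.coordChar (tangentCoord Q l m)) = red p (PL.tangentChar J Q m) := by
  rcases m with c | j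
  · have h1 := (forgetS J).coordChar_i P c.1
    rw [push_forgetS hS hP] at h1
    exact congrArg (red p) h1
  · refine (congrArg (red p) (coordChar_inr hS hP (j.1 + l))).trans ?_
    have h1 : (((((j.1 + l : Fin p) : ℕ) : ℤ) - ((l : ℕ) : ℤ) : ℤ) : ZMod p) =
        ((((j.1 : Fin p) : ℕ) : ℤ) : ZMod p) := by
      rw [Fin.val_add]
      push_cast
      ring
    rw [PL.tangentChar, Sum.elim_inr, red_zsmul, red_zsmul, h1]

end PA

/-! ### The fixed point equivalence -/

variable {F : Type u} [Field F] [CharZero F] {p n : ℕ} [Fact p.Prime] {S : Shape n}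
  {J : FormLine F p S} {A : Type u} [CommRing A] [Algebra F A] {ε : A} {w : Polynomial F} {ζ e : F}

/-- Both sides have one fixed point for each family of `p` fixed points of `S` and each element of a
set with `p ^ p (p - 1)!` elements, and the tangent representation depends on the family only. -/
theorem fixedPointEquivalent (hJ : J.IsNondegenerate) (hζ : IsPrimitiveRoot ζ p) (he : e ≠ 0)
    (h : IsKummer F A p ε e) (hw : IsKummer.IsGeneric F p ε e w) :
    GFunctor.FixedPointEquivalent (varY J A ε (Polynomial.aeval ε w))
      (((varPA J).pow (Fin p)).copies (Fin (p - 1).factorial)) := by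
  have hp : 0 < p := Nat.pos_of_neZero p
  have hXA := PL.unimodular_shapePA J hJ.unimodular
  have hXA₀ := PL.unimodular_shapePA J hJ.unimodular₀
  have := hJ.finite
  have hfinS : Finite S.FixPt := Shape.FixPt.finite hJ.unimodular₀
  obtain ⟨Φ, hΦ⟩ := PA.exists_fixPt_equiv hJ
  have hfinA : Finite (shapePA J).total.FixPt := Finite.of_equiv _ Φ
  have hfixA : ∀ (L : Type u) [Field L] [Algebra F L], (varPA J).Fix L =
      Set.range fun P : (shapePA J).total.FixPt => P.toPts F p L := fun L _ _ =>
    Shape.FixPt.fix_univ hζ hXA hXA₀ (PA.regular hJ) L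
  -- the fixed points of the two varieties
  let y : ∀ (L : Type u) [Field L] [Algebra F L], (Option (Fin (p - 1)) → S.FixPt) ×
      IsKummer.Sol F p ε w L → (varY J A ε (Polynomial.aeval ε w)).Fix L := fun L _ _ a =>
    ⟨_, PL.pt_yCoord_mem_fix hJ hζ a.1 a.2.2⟩
  have hy : ∀ (L : Type u) [Field L] [Algebra F L], Function.Bijective (y L) := fun L _ _ => by
    refine ⟨fun a a' haa => ?_, fun ⟨b, hb⟩ => ?_⟩
    · obtain ⟨h1, h2⟩ := PL.eq_of_pt_yCoord_eq hJ (congrArg Subtype.val haa)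
      exact Prod.ext h1 (Subtype.ext h2)
    · obtain ⟨Q, z, hz, hzb⟩ := PL.exists_pt_yCoord_eq hJ hζ he h hw hb
      exact ⟨(Q, ⟨z, hz⟩), Subtype.ext hzb⟩
  let X := ((varPA J).pow (Fin p)).copies (Fin (p - 1).factorial)
  let x : ∀ (L : Type u) [Field L] [Algebra F L], Fin (p - 1).factorial ×
      (Fin p → (shapePA J).total.FixPt) → X.Fix L := fun L _ _ a =>
    ⟨(a.1, fun i => (a.2 i).toPts F p L), fun g => Prod.ext rfl (funext fun i => by
      have h1 : (a.2 i).toPts F p L ∈ (varPA J).Fix L := by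
        rw [hfixA]
        exact ⟨_, rfl⟩
      exact h1 g)⟩
  have hx : ∀ (L : Type u) [Field L] [Algebra F L], Function.Bijective (x L) := fun L _ _ => by
    refine ⟨fun a a' haa => ?_, fun ⟨b, hb⟩ => ?_⟩
    · have h1 : (x L a).1 = (x L a').1 := congrArg Subtype.val haa
      have h2 : a.1 = a'.1 := (Prod.ext_iff.1 h1).1
      have h3 : ∀ i, (a.2 i).toPts F p L = (a'.2 i).toPts F p L := congrFun (Prod.ext_iff.1 h1).2
      exact Prod.ext h2 (funext fun i => Shape.FixPt.toPts_injective hXA₀ L (h3 i))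
    · have h1 : ∀ i, b.2 i ∈ (varPA J).Fix L := fun i g =>
        congrFun (congrArg Prod.snd (hb g)) i
      simp only [hfixA] at h1
      choose P hP using h1
      exact ⟨(b.1, P), Subtype.ext (Prod.ext rfl (funext hP))⟩
  refine ⟨fun L _ _ => ⟨?_, ?_⟩, fun L _ _ => ⟨?_, ?_⟩, AlgebraicClosure F, inferInstance,
    inferInstance, inferInstance, ?_, ?_, ?_⟩
  · have := IsKummer.finite_Sol hw h hp hζ he L
    exact Finite.of_surjective _ (hy L).2
  · intro a ha
    obtain ⟨b, hb⟩ := (hy L).2 ⟨a, ha⟩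
    have h1 : (y L b).1 = a := congrArg Subtype.val hb
    rw [← h1]
    exact PL.smoothAt_pt_yCoord hJ hζ he h hw b.1 b.2.2
  · exact Finite.of_surjective _ (hx L).2
  · intro a _
    exact GFunctor.SmoothAt.copies (GFunctor.SmoothAt.pow fun i => GFunctor.smoothAt_univ _ _)
  · intro L _ _ f a ha
    obtain ⟨⟨Q, z, hz⟩, hb⟩ := (hy L).2 ⟨a, ha⟩
    have h1 : (y L (Q, ⟨z, hz⟩)).1 = a := congrArg Subtype.val hb
    obtain ⟨z₀, hz₀, rfl⟩ := IsKummer.exists_map_eq_of_mem_Sol hw h hp hζ he f hz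
    refine ⟨_, (y _ (Q, ⟨z₀, hz₀⟩)).2, ?_⟩
    rw [← h1]
    refine (Locus.map_pt _ _).trans ?_
    congr 1
    exact Subtype.ext (funext (PL.map_coord Q z₀ (f : AlgebraicClosure F →+* L)))
  · intro L _ _ f a ha
    obtain ⟨b, hb⟩ := (hx L).2 ⟨a, ha⟩
    have h1 : (x L b).1 = a := congrArg Subtype.val hb
    refine ⟨_, (x _ b).2, ?_⟩
    rw [← h1]
    exact Prod.ext rfl (funext fun i => (b.2 i).map_toPts f)
  · -- over the algebraic closure, the solutions correspond to `(p - 1)!` copies of the choices of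
    -- a summand of `𝒜` at each of the `p` points of `S`
    obtain ⟨Ψ⟩ := IsKummer.nonempty_Sol_equiv hw h hp hζ he (AlgebraicClosure F)
    obtain ⟨η⟩ : Nonempty (Option (Fin (p - 1)) ≃ Fin p) := by
      refine ⟨Fintype.equivFinOfCardEq ?_⟩
      rw [Fintype.card_option, Fintype.card_fin]
      omega
    let Θ : (Option (Fin (p - 1)) → S.FixPt) × IsKummer.Sol F p ε w (AlgebraicClosure F) ≃
        Fin (p - 1).factorial × (Fin p → (shapePA J).total.FixPt) :=
      { toFun := fun a => ((Ψ a.2).1, fun i => Φ (a.1 (η.symm i), (Ψ a.2).2 i))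
        invFun := fun a => (fun o => (Φ.symm (a.2 (η o))).1,
          Ψ.symm (a.1, fun i => (Φ.symm (a.2 i)).2))
        left_inv := fun a => by simp
        right_inv := fun a => by simp }
    refine ⟨((Equiv.ofBijective _ (hy _)).symm.trans Θ).trans (Equiv.ofBijective _ (hx _)), ?_⟩
    intro a
    obtain ⟨⟨Q, z, hz⟩, rfl⟩ := (Equiv.ofBijective _ (hy (AlgebraicClosure F))).surjective a
    rw [Equiv.trans_apply, Equiv.trans_apply, Equiv.symm_apply_apply]
    obtain ⟨P, hP⟩ := PL.exists_fixPt hJ Q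
    let l : Fin p → Fin p := (Ψ ⟨z, hz⟩).2
    let R : Fin p → (shapePA J).total.FixPt := fun i => Φ (Q (η.symm i), l i)
    have hR : ∀ i, (R i).σ = PA.baseSection (Q (η.symm i)) (l i) := fun i => hΦ _ _
    let c := PL.tangentChart hJ hζ he h hw hz hP
    let c' := TangentChart.copies (I := Fin (p - 1).factorial)
      (x := (x (AlgebraicClosure F) (Θ (Q, ⟨z, hz⟩))).1)
      (TangentChart.pow fun i => TangentChart.ofFixPt (k := F) (p := p) (K := AlgebraicClosure F)
        hXA (R i))
    let e₁ : (Σ i, {c | (R i).σ ((shapePA J).total.blk c) ≠ c}) ≃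
        Σ i, PL.TangentIndex p (Q (η.symm i)) :=
      Equiv.sigmaCongrRight fun i =>
        ((Equiv.ofInjective _ (PA.tangentCoord_injective (J := J) (Q (η.symm i)) (l i))).trans
          (Equiv.setCongr (PA.range_tangentCoord hJ.unimodular₀ (hR i)))).symm
    let e₂ : (Σ i, PL.TangentIndex p (Q (η.symm i))) ≃ Σ o, PL.TangentIndex p (Q o) :=
      Equiv.sigmaCongrLeft (β := fun o => PL.TangentIndex p (Q o)) η.symm
    let e₃ := Equiv.ofInjective _ (PL.tangentCoord_injective (J := J) Q)
    refine c.tangentIso c' ((e₁.trans e₂).trans e₃) fun g m => ?_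
    obtain ⟨m, rfl⟩ := e₁.symm.surjective m
    congr 1
    refine scale_muUnits_eq_of_red_eq g ?_
    rw [Equiv.trans_apply, Equiv.trans_apply, Equiv.apply_symm_apply]
    refine (congrArg (red p) (PL.coordChar_tangentCoord hJ.unimodular₀ hP (e₂ m))).trans ?_
    exact (PA.red_coordChar_tangentCoord hJ.unimodular₀ (hR m.1) m.2).symm

end NormPrinciple

open NormPrinciple in
theorem mainTheorem9 {k E : Type u} [Field k] [CharZero k] [Field E] [Algebra k E]
    (p : ℕ) (hp : p.Prime) (hp2 : p ≠ 2) (ζ : k) (hζ : IsPrimitiveRoot ζ p)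
    (n : ℕ) (hn : 2 ≤ n) (a : Fin n → k) (ha : ∀ i, a i ≠ 0)
    (e : k) (ε : E) (hε : ε ^ p = algebraMap k E e)
    (hgen : IntermediateField.adjoin k {ε} = ⊤) (hdeg : Module.finrank k E = p) :
    ∃ f : MvPolynomial (Fin p) k, f ≠ 0 ∧
      ∀ (F : Type u) [Field F] [Algebra k F] (c : Fin p → F),
        MvPolynomial.aeval c f ≠ 0 →
        GFunctor.FixedPointEquivalent
          (varY (chainVariety p fun i => algebraMap k F (a i)).J (F ⊗[k] E) ((1 : F) ⊗ₜ[k] ε)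
            (∑ i : Fin p, c i ⊗ₜ[k] (ε ^ (i : ℕ))))
          (((varPA (chainVariety p fun i => algebraMap k F (a i)).J).pow (Fin p)).copies
            (Fin (Nat.factorial (p - 1)))) := by
  have : Fact p.Prime := ⟨hp⟩
  have he : e ≠ 0 := by
    rintro rfl
    have hε0 : ε = 0 := by
      rw [map_zero] at hε
      exact pow_eq_zero_iff hp.ne_zero |>.1 hε
    rw [hε0, IntermediateField.adjoin_zero] at hgen
    have h1 : Module.finrank k (⊥ : IntermediateField k E) = p := by
      rw [hgen, IntermediateField.finrank_top', hdeg]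
    rw [IntermediateField.finrank_bot] at h1
    exact hp.ne_one h1.symm
  obtain ⟨f, hf, H⟩ := IsKummer.exists_isGeneric hp.pos hζ he hε hgen hdeg
  refine ⟨f, hf, fun F _ _ c hc => ?_⟩
  have : CharZero F := charZero_of_injective_algebraMap (algebraMap k F).injective
  have hgood := chainVariety_good (p := p) hn (a := fun i => algebraMap k F (a i))
    fun i => (_root_.map_ne_zero _).2 (ha i)
  have hJ : (chainVariety p fun i => algebraMap k F (a i)).J.IsNondegenerate :=
    { unimodular := chainVariety_unimodular p _
      unimodular₀ := chainVariety_unimodular p _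
      finite := hgood.finite
      regular := hgood.regular
      char_ne := fun P h0 => hgood.ind_J P (by rw [h0]; exact Submodule.zero_mem _)
      form_ne := hgood.form_J }
  have hw : (∑ i : Fin p, c i ⊗ₜ[k] (ε ^ (i : ℕ)) : F ⊗[k] E) =
      Polynomial.aeval ((1 : F) ⊗ₜ[k] ε)
        (∑ i : Fin p, Polynomial.C (c i) * Polynomial.X ^ (i : ℕ)) := by
    rw [map_sum]
    refine Finset.sum_congr rfl fun i _ => ?_
    rw [map_mul, map_pow, Polynomial.aeval_C, Polynomial.aeval_X, Algebra.TensorProduct.tmul_pow,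
      one_pow, Algebra.TensorProduct.algebraMap_apply, Algebra.TensorProduct.tmul_mul_tmul, one_mul,
      Algebra.algebraMap_self_apply, mul_one]
  rw [hw]
  exact fixedPointEquivalent hJ (hζ.map_of_injective (algebraMap k F).injective)
    ((_root_.map_ne_zero _).2 he) (IsKummer.of_field hp.pos hε hgen hdeg F) (H F c hc)
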